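/- **Setting.** Let $k$ be a commutative ring of characteristic $\neq 2$ and let $F$ be an $\mathbb N$-graded Frobenius $k$-superalgebra, free of finite rank as a $k$-module: there is a parity-preserving linear trace map $\operatorname{tr}\colon F\to k$, homogeneous of degree $-\delta$, where $\delta$ is the maximum degree occurring in $F$, such that $f\mapsto(g\mapsto(-1)^{\bar f\bar g}\operatorname{tr}(gf))$ is an isomorphism $F\to\operatorname{Hom}_k(F,k)$. (Formulas involving the parity $\bar f$ are extended linearly from homogeneous elements.) Let $\psi$ be the Nakayama automorphism, $\operatorname{tr}(fg)=(-1)^{\bar f\bar g}\operatorname{tr}(g\psi(f))$. Assume that $\psi$ has finite order $\theta$, that the characteristic of $k$ does not divide $\theta$, and that $F$ has a basis of eigenvectors of $\psi$. Let $B$ be a basis of $F$ of homogeneous elements, with left dual basis $\{b^\vee\}$, $\operatorname{tr}(b^\vee c)=\delta_{b,c}$ for $b,c\in B$. Let $n\ge 1$. Tensor products are of superalgebras, $(a_1\otimes a_2)(b_1\otimes b_2)=(-1)^{\bar a_2\bar b_1}a_1b_1\otimes a_2b_2$, and $S_n$ acts on $F^{\otimes n}$ by superpermutation of the factors, $\mathbf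 f\mapsto{}^\pi\mathbf f$. Write $f_i=1^{\otimes(i-1)}\otimes f\otimes1^{\otimes(n-i)}$, $\psi_i=\mathrm{id}^{\otimes(i-1)}\otimes\psi\otimes\mathrm{id}^{\otimes(n-i)}$ and $t_{i,j}=\sum_{b\in B}b_i(b^\vee)_j$. The affine wreath product algebra $\mathcal A_n(F)$ is the free product of $k$-algebras $k[x_1,\dots,x_n]\star F^{\otimes n}\star kS_n$ modulo the relations $$\mathbf f x_i=x_i\psi_i(\mathbf f),\qquad s_ix_j=x_js_i\ (j\ne i,i+1),\qquad s_ix_i=x_{i+1}s_i-t_{i,i+1},\qquad \pi\mathbf f={}^\pi\mathbf f\,\pi,$$ for $\mathbf f\in F^{\otimes n}$, $\pi\in S_n$ and all indices for which they make sense, where $s_i$ is the transposition of $i$ and $i+1$. For $m\in\mathbb Z$ let $F_\psi^{(m)}=\{f\in F\mid\psi(f)=f,\ gf=(-1)^{\bar f\bar g}f\psi^m(g)\ \forall g\in F\}$, and let $\mathbf F_1^{(m)}\subseteq F^{\otimes n}$ be the set of elements of $F_\psi^{(m)}\otimes F_\psi^{(0)}\otimes\dots\otimes F_\psi^{(0)}$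 invariant under all $\pi\in S_n$ with $\pi(1)=1$. For each $1\le m\le\theta$ choose $e_m\in\mathbb N$ and even elements $\mathbf c^{(m,1)},\dots,\mathbf c^{(m,e_m)}\in\mathbf F_1^{(m)}$ of degree $m\delta$. Let $\mathbf C$ be the family of all the $\mathbf c^{(m,j)}$, let $J_{\mathbf C}$ be the two-sided ideal of $\mathcal A_n(F)$ generated by $$\chi_{\mathbf C}=\prod_{m=1}^\theta\prod_{j=1}^{e_m}\bigl(x_1^m-\mathbf c^{(m,j)}\bigr),$$ and put $\mathcal A_n^{\mathbf C}(F)=\mathcal A_n(F)/J_{\mathbf C}$ and $d_{\mathbf C}=\sum_{m=1}^\theta m\,e_m$. **Theorem (Basis theorem for cyclotomic quotients).** The canonical images of the elements $$x_1^{\alpha_1}\cdots x_n^{\alpha_n}\,\mathbf b\,\pi,\qquad \alpha\in\mathbb N^n\text{ with }\alpha_1,\dots,\alpha_n<d_{\mathbf C},\quad \mathbf b=b_1\otimes\dots\otimes b_n\text{ with }b_1,\dots,b_n\in B,\quad \pi\in S_n,$$ form a $k$-basis of $\mathcal A_n^{\mathbf C}(F)$ (these images being pairwise distinct). -/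

import Mathlib

open scoped TensorProduct BigOperators

noncomputable section

namespace AffineWreath

universe u v w

/-! ## Signs and parity in a graded superalgebra

A graded superalgebra is a `k`-algebra `F` with a grading `𝒜` by `ℕ × ZMod 2`: the piece
`𝒜 (m, ε)` consists of the elements of degree `m` and parity `ε`. -/

/-- The sign `(-1)^ε`, for a parity `ε`, as an element of `k`. -/
def sgn (k : Type u) [CommRing k] (ε : ZMod 2) : k := if ε = 0 then 1 else -1

theorem sgn_add (k : Type u) [CommRing k] (a b : ZMod 2) :
    sgn k (a + b) = sgn k a * sgn k b := by
  have h : ∀ c : ZMod 2, c = 0 ∨ c = 1 := by decide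
  have h2 : (1 : ZMod 2) + 1 = 0 := by decide
  rcases h a with rfl | rfl <;> rcases h b with rfl | rfl <;> simp [sgn, h2]

section Parity

variable {k : Type u} [CommRing k] {F : Type v} [Ring F] [Algebra k F]
variable (𝒜 : ℕ × ZMod 2 → Submodule k F) [GradedAlgebra 𝒜]

/-- The projection of `F` onto its part of parity `ε`. -/
def parityProj (ε : ZMod 2) : F →ₗ[k] F :=
  (DirectSum.toModule k (ℕ × ZMod 2) F fun p => if p.2 = ε then (𝒜 p).subtype else 0) ∘ₗ
    (DirectSum.decomposeLinearEquiv 𝒜).toLinearMap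

theorem parityProj_of_mem {p : ℕ × ZMod 2} {f : F} (hf : f ∈ 𝒜 p) (ε : ZMod 2) :
    parityProj 𝒜 ε f = if p.2 = ε then f else 0 := by
  simp only [parityProj, LinearMap.comp_apply, LinearEquiv.coe_coe,
    DirectSum.decomposeLinearEquiv_apply]
  rw [DirectSum.decompose_of_mem 𝒜 hf, ← DirectSum.lof_eq_of k, DirectSum.toModule_lof]
  split_ifs <;> simp

theorem parityProj_parityProj (ε η : ZMod 2) (f : F) :
    parityProj 𝒜 ε (parityProj 𝒜 η f) = if η = ε then parityProj 𝒜 η f else 0 := by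
  induction f using DirectSum.Decomposition.inductionOn 𝒜 with
  | zero => simp
  | @homogeneous p f =>
    rw [parityProj_of_mem 𝒜 f.2]
    by_cases h : p.2 = η
    · simp [h, parityProj_of_mem 𝒜 f.2]
    · simp [h]
  | add f g hf hg => rw [map_add, map_add, hf, hg]; split_ifs <;> simp

theorem sum_parityProj (f : F) : ∑ ε : ZMod 2, parityProj 𝒜 ε f = f := by
  induction f using DirectSum.Decomposition.inductionOn 𝒜 with
  | zero => simp
  | @homogeneous p f => simp [parityProj_of_mem 𝒜 f.2]
  | add f g hf hg => simp only [map_add, Finset.sum_add_distrib, hf, hg]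

theorem parityProj_mul (ε η : ZMod 2) (f g : F) :
    parityProj 𝒜 (ε + η) (parityProj 𝒜 ε f * parityProj 𝒜 η g) =
      parityProj 𝒜 ε f * parityProj 𝒜 η g := by
  induction f using DirectSum.Decomposition.inductionOn 𝒜 with
  | zero => simp
  | @homogeneous p f =>
    induction g using DirectSum.Decomposition.inductionOn 𝒜 with
    | zero => simp
    | @homogeneous q g =>
      rw [parityProj_of_mem 𝒜 f.2, parityProj_of_mem 𝒜 g.2]
      by_cases h : p.2 = ε
      · by_cases h' : q.2 = η
        · rw [if_pos h, if_pos h', parityProj_of_mem 𝒜 (SetLike.mul_mem_graded f.2 g.2), if_pos]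
          rw [Prod.snd_add, h, h']
        · simp [h']
      · simp [h]
    | add g g' hg hg' => simp only [map_add, mul_add, hg, hg']
  | add f f' hf hf' => simp only [map_add, add_mul, hf, hf']

theorem parityProj_zero_one : parityProj 𝒜 0 (1 : F) = 1 := by
  rw [parityProj_of_mem 𝒜 (SetLike.GradedOne.one_mem (A := 𝒜))]; simp

/-- The bilinear map which is `(f, g) ↦ (-1)^{|f| |g|} M f g` for `f` and `g` homogeneous with
respect to parity. -/
def koszul {N : Type w} [AddCommGroup N] [Module k N] (M : F →ₗ[k] F →ₗ[k] N) :
    F →ₗ[k] F →ₗ[k] N :=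
  ∑ ε : ZMod 2, ∑ η : ZMod 2,
    sgn k (ε * η) • M.compl₁₂ (parityProj 𝒜 ε) (parityProj 𝒜 η)

theorem koszul_of_mem {N : Type w} [AddCommGroup N] [Module k N] (M : F →ₗ[k] F →ₗ[k] N)
    {p q : ℕ × ZMod 2} {f g : F} (hf : f ∈ 𝒜 p) (hg : g ∈ 𝒜 q) :
    koszul 𝒜 M f g = sgn k (p.2 * q.2) • M f g := by
  simp only [koszul, LinearMap.sum_apply, LinearMap.smul_apply, LinearMap.compl₁₂_apply]
  rw [Finset.sum_eq_single p.2, Finset.sum_eq_single q.2]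
  · simp [parityProj_of_mem 𝒜 hf, parityProj_of_mem 𝒜 hg]
  · intro η _ h
    simp [parityProj_of_mem 𝒜 hg, h.symm]
  · simp
  · intro ε _ h
    simp [parityProj_of_mem 𝒜 hf, h.symm]
  · simp

end Parity

/-! ## Frobenius superalgebras -/

section Frobenius

variable {k : Type u} [CommRing k] {F : Type v} [Ring F] [Algebra k F]

/-- The structure of an `ℕ`-graded Frobenius superalgebra on the graded superalgebra `F`: a
parity-preserving trace map, homogeneous of degree `-δ` where `δ` is the top degree of `F`, such
that `f ↦ (g ↦ (-1)^{|f| |g|} tr (g f))` is an isomorphism from `F` onto its linear dual. -/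
structure FrobeniusStructure (𝒜 : ℕ × ZMod 2 → Submodule k F) [GradedAlgebra 𝒜] where
  tr : F →ₗ[k] k
  δ : ℕ
  isGreatest_δ : IsGreatest {m : ℕ | ∃ ε : ZMod 2, 𝒜 (m, ε) ≠ ⊥} δ
  tr_eq_zero : ∀ p : ℕ × ZMod 2, p ≠ (δ, 0) → ∀ f ∈ 𝒜 p, tr f = 0
  bijective : Function.Bijective (koszul 𝒜 ((LinearMap.mul k F).flip.compr₂ tr))

namespace FrobeniusStructure

variable {𝒜 : ℕ × ZMod 2 → Submodule k F} [GradedAlgebra 𝒜] (T : FrobeniusStructure 𝒜)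

/-- The isomorphism `f ↦ (g ↦ (-1)^{|f| |g|} tr (g f))`. -/
def dualEquiv : F ≃ₗ[k] Module.Dual k F := LinearEquiv.ofBijective _ T.bijective

/-- The map `f ↦ (g ↦ tr (f g))`. -/
def leftForm : F →ₗ[k] Module.Dual k F := (LinearMap.mul k F).compr₂ T.tr

theorem leftForm_apply (f g : F) : T.leftForm f g = T.tr (f * g) := rfl

theorem dualEquiv_of_mem {p q : ℕ × ZMod 2} {f g : F} (hf : f ∈ 𝒜 p) (hg : g ∈ 𝒜 q) :
    T.dualEquiv f g = sgn k (p.2 * q.2) * T.tr (g * f) := by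
  simp only [dualEquiv, LinearEquiv.ofBijective_apply]
  rw [koszul_of_mem 𝒜 _ hf hg]
  simp

/-- Since the trace map is even, the sign `(-1)^{|f| |g|}` can be replaced by `(-1)^{|g|}`. -/
theorem dualEquiv_apply_of_mem {q : ℕ × ZMod 2} (f : F) {g : F} (hg : g ∈ 𝒜 q) :
    T.dualEquiv f g = sgn k q.2 * T.tr (g * f) := by
  induction f using DirectSum.Decomposition.inductionOn 𝒜 with
  | zero => simp
  | @homogeneous p f =>
    rw [T.dualEquiv_of_mem f.2 hg]
    by_cases h : q + p = (T.δ, 0)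
    · have h2 : q.2 + p.2 = 0 := congrArg Prod.snd h
      have h3 : p.2 = q.2 := by
        revert h2; generalize p.2 = a; generalize q.2 = b; revert a b; decide
      have h4 : q.2 * q.2 = q.2 := by generalize q.2 = b; revert b; decide
      rw [h3, h4]
    · rw [T.tr_eq_zero _ h _ (SetLike.mul_mem_graded hg f.2)]; simp
  | add f f' hf hf' => simp only [map_add, LinearMap.add_apply, mul_add, hf, hf']

theorem sgn_mul_self (ε : ZMod 2) : sgn k ε * sgn k ε = 1 := by
  rw [← sgn_add]
  have : ε + ε = 0 := by revert ε; decide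
  simp [this, sgn]

theorem leftForm_bijective [Module.Free k F] [Module.Finite k F] :
    Function.Bijective T.leftForm := by
  have hp : (T.dualEquiv : F →ₗ[k] F →ₗ[k] k).IsPerfPair :=
    LinearMap.IsPerfPair.of_bijective _ T.dualEquiv.bijective
  have hflip := hp.bijective_right
  -- the parity involution
  let γ : F →ₗ[k] F := ∑ ε : ZMod 2, sgn k ε • parityProj 𝒜 ε
  have hγ : ∀ {q : ℕ × ZMod 2} {g : F}, g ∈ 𝒜 q → γ g = sgn k q.2 • g := by
    intro q g hg
    simp [γ, parityProj_of_mem 𝒜 hg]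
  have hγγ : ∀ g, γ (γ g) = g := by
    intro g
    induction g using DirectSum.Decomposition.inductionOn 𝒜 with
    | zero => simp
    | homogeneous g => rw [hγ g.2, map_smul, hγ g.2, smul_smul, sgn_mul_self, one_smul]
    | add g g' hg hg' => simp only [map_add, hg, hg']
  have key : ∀ g, (T.dualEquiv : F →ₗ[k] F →ₗ[k] k).flip (γ g) = T.leftForm g := by
    intro g
    induction g using DirectSum.Decomposition.inductionOn 𝒜 with
    | zero => simp
    | @homogeneous q g =>
      ext f
      rw [hγ g.2, map_smul, LinearMap.smul_apply, LinearMap.flip_apply]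
      erw [T.dualEquiv_apply_of_mem f g.2]
      rw [smul_eq_mul, ← mul_assoc, sgn_mul_self, one_mul, leftForm_apply]
    | add g g' hg hg' => rw [map_add, map_add, hg, hg', map_add]
  have hcomp : (T.leftForm : F → Module.Dual k F) =
      (T.dualEquiv : F →ₗ[k] F →ₗ[k] k).flip ∘ γ := funext fun g => (key g).symm
  rw [hcomp]
  exact hflip.comp (Function.Involutive.bijective hγγ)

variable [Module.Free k F] [Module.Finite k F]

/-- `leftForm` as a linear equivalence. -/
def leftEquiv : F ≃ₗ[k] Module.Dual k F := LinearEquiv.ofBijective _ T.leftForm_bijective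

/-- The Nakayama automorphism: `ψ f` is the element with
`(-1)^{|ψ f| |g|} tr (g (ψ f)) = tr (f g)` for all `g`. -/
def nakayama : F ≃ₗ[k] F := T.leftEquiv.trans T.dualEquiv.symm

/-- The defining property of the Nakayama automorphism. -/
theorem tr_mul_nakayama {p q : ℕ × ZMod 2} {f g : F} (hf : f ∈ 𝒜 p) (hg : g ∈ 𝒜 q) :
    T.tr (f * g) = sgn k (p.2 * q.2) * T.tr (g * T.nakayama f) := by
  have h1 : T.dualEquiv (T.nakayama f) g = T.tr (f * g) := by
    simp only [nakayama, LinearEquiv.trans_apply, LinearEquiv.apply_symm_apply]; rfl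
  have h2 : T.tr (f * g) = sgn k q.2 * T.tr (g * T.nakayama f) := by
    rw [← h1, T.dualEquiv_apply_of_mem _ hg]
  by_cases h : p + q = (T.δ, 0)
  · have h3 : p.2 + q.2 = 0 := congrArg Prod.snd h
    have h4 : p.2 * q.2 = q.2 := by
      revert h3; generalize p.2 = a; generalize q.2 = b; revert a b; decide
    rw [h4, h2]
  · have h0 := T.tr_eq_zero _ h _ (SetLike.mul_mem_graded hf hg)
    have h5 : T.tr (g * T.nakayama f) = 0 := by
      have := congrArg (fun z => sgn k q.2 * z) h2
      simp only [← mul_assoc, sgn_mul_self, one_mul, h0, mul_zero] at this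
      exact this.symm
    rw [h0, h5, mul_zero]

/-- The left dual basis `B^∨` of a basis `B`. -/
def leftDual {ι : Type w} (B : Module.Basis ι k F) (b : ι) : F := T.leftEquiv.symm (B.coord b)

theorem tr_leftDual_mul {ι : Type w} [DecidableEq ι] (B : Module.Basis ι k F) (b c : ι) :
    T.tr (T.leftDual B b * B c) = if b = c then 1 else 0 := by
  have h : T.leftForm (T.leftDual B b) = B.coord b := T.leftEquiv.apply_symm_apply _
  rw [← leftForm_apply, h, Module.Basis.coord_apply, Module.Basis.repr_self,
    Finsupp.single_apply]
  simp [eq_comm]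

/-- The order `θ` of the Nakayama automorphism (`0` if the order is infinite). -/
def θ : ℕ := orderOf T.nakayama

/-- `F_ψ^{(m)}`: the elements `f` fixed by `ψ` with `g f = (-1)^{|f| |g|} f ψ^m(g)` for all
`g`. -/
def twistedCenter (m : ℤ) : Submodule k F where
  carrier := {f | T.nakayama f = f ∧ ∀ g, g * f =
    koszul 𝒜 ((LinearMap.mul k F).compl₂ ((T.nakayama ^ m : F ≃ₗ[k] F) : F →ₗ[k] F)) f g}
  zero_mem' := by simp
  add_mem' := by
    rintro a b ⟨ha, ha'⟩ ⟨hb, hb'⟩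
    exact ⟨by rw [map_add, ha, hb], fun g => by
      rw [mul_add, ha' g, hb' g, map_add, LinearMap.add_apply]⟩
  smul_mem' := by
    rintro r a ⟨ha, ha'⟩
    exact ⟨by rw [map_smul, ha], fun g => by
      rw [mul_smul_comm, ha' g, map_smul, LinearMap.smul_apply]⟩

end FrobeniusStructure

end Frobenius

/-! ## The superalgebra `F^{⊗ n}` -/

section TensorPower

variable {k : Type u} [CommRing k] {F : Type v} [Ring F] [Algebra k F]

/-- The `n`-th tensor power of the superalgebra `F`. It is a type synonym because its
multiplication involves signs. -/
def SuperPower (_𝒜 : ℕ × ZMod 2 → Submodule k F) (n : ℕ) : Type (max u v) :=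
  ⨂[k] _ : Fin n, F

namespace SuperPower

variable (𝒜 : ℕ × ZMod 2 → Submodule k F) (n : ℕ)

instance : AddCommGroup (SuperPower 𝒜 n) := inferInstanceAs (AddCommGroup (⨂[k] _ : Fin n, F))

instance : Module k (SuperPower 𝒜 n) := inferInstanceAs (Module k (⨂[k] _ : Fin n, F))

variable {n}

/-- The pure tensor `a_1 ⊗ ⋯ ⊗ a_n`. -/
def tprod : MultilinearMap k (fun _ : Fin n => F) (SuperPower 𝒜 n) :=
  PiTensorProduct.tprod k

theorem tprod_eq_zero {a : Fin n → F} (i : Fin n) (h : a i = 0) : tprod 𝒜 a = 0 :=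
  MultilinearMap.map_coord_zero _ i h

instance : One (SuperPower 𝒜 n) := ⟨tprod 𝒜 fun _ => 1⟩

theorem one_def : (1 : SuperPower 𝒜 n) = tprod 𝒜 fun _ => 1 := rfl

/-- The exponent of the sign `(-1)^{∑_{j < i} ε_i η_j}` produced by moving each `b_j`, of parity `η_j`, past the
`a_i`, of parity `ε_i`, with `i > j`. -/
def mulExp (ε η : Fin n → ZMod 2) : ZMod 2 := ∑ i, ∑ j, if j < i then ε i * η j else 0

variable [GradedAlgebra 𝒜]

/-- The bilinear map `(⊗ a_i, ⊗ b_i) ↦ ⊗ a_i' b_i'`, where `a_i'` is the component of parity `ε_i`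
of `a_i` and `b_i'` is the component of parity `η_i` of `b_i`. -/
def mulComponent (ε η : Fin n → ZMod 2) :
    SuperPower 𝒜 n →ₗ[k] SuperPower 𝒜 n →ₗ[k] SuperPower 𝒜 n :=
  PiTensorProduct.map₂ fun i =>
    (LinearMap.mul k F).compl₁₂ (parityProj 𝒜 (ε i)) (parityProj 𝒜 (η i))

theorem mulComponent_tprod (ε η : Fin n → ZMod 2) (a b : Fin n → F) :
    mulComponent 𝒜 ε η (tprod 𝒜 a) (tprod 𝒜 b) =
      tprod 𝒜 fun i => parityProj 𝒜 (ε i) (a i) * parityProj 𝒜 (η i) (b i) :=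
  PiTensorProduct.map₂_tprod_tprod _ _ _

/-- The multiplication of `F^{⊗ n}`, given for factors homogeneous with respect to parity by
`(a_1 ⊗ ⋯ ⊗ a_n)(b_1 ⊗ ⋯ ⊗ b_n) = (-1)^{∑_{j < i} |a_i| |b_j|} a_1 b_1 ⊗ ⋯ ⊗ a_n b_n`. -/
def mulMap : SuperPower 𝒜 n →ₗ[k] SuperPower 𝒜 n →ₗ[k] SuperPower 𝒜 n :=
  ∑ ε : Fin n → ZMod 2, ∑ η : Fin n → ZMod 2, sgn k (mulExp ε η) • mulComponent 𝒜 ε η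

instance : Mul (SuperPower 𝒜 n) := ⟨fun a b => mulMap 𝒜 a b⟩

theorem mul_def (a b : SuperPower 𝒜 n) : a * b = mulMap 𝒜 a b := rfl

theorem tprod_eq_sum (a : Fin n → F) :
    tprod 𝒜 a = ∑ ε : Fin n → ZMod 2, tprod 𝒜 fun i => parityProj 𝒜 (ε i) (a i) := by
  rw [← (tprod 𝒜).map_sum fun i ε => parityProj 𝒜 ε (a i)]
  simp only [sum_parityProj]

/-- Two linear maps agree if they agree on pure tensors of elements of pure parity. -/
theorem hom_ext {N : Type w} [AddCommGroup N] [Module k N] {f g : SuperPower 𝒜 n →ₗ[k] N}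
    (h : ∀ (ε : Fin n → ZMod 2) (a : Fin n → F), (∀ i, parityProj 𝒜 (ε i) (a i) = a i) →
      f (tprod 𝒜 a) = g (tprod 𝒜 a)) : f = g := by
  refine PiTensorProduct.ext (MultilinearMap.ext fun a => ?_)
  change f (tprod 𝒜 a) = g (tprod 𝒜 a)
  rw [tprod_eq_sum, map_sum, map_sum]
  refine Finset.sum_congr rfl fun ε _ => h ε _ fun i => ?_
  rw [parityProj_parityProj, if_pos rfl]

theorem tprod_mul_tprod {ε η : Fin n → ZMod 2} {a b : Fin n → F}
    (ha : ∀ i, parityProj 𝒜 (ε i) (a i) = a i) (hb : ∀ i, parityProj 𝒜 (η i) (b i) = b i) :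
    tprod 𝒜 a * tprod 𝒜 b = sgn k (mulExp ε η) • tprod 𝒜 fun i => a i * b i := by
  have key : tprod 𝒜 a * tprod 𝒜 b =
      ∑ ε' : Fin n → ZMod 2, ∑ η' : Fin n → ZMod 2, sgn k (mulExp ε' η') •
        tprod 𝒜 fun i => parityProj 𝒜 (ε' i) (a i) * parityProj 𝒜 (η' i) (b i) := by
    simp only [mul_def, mulMap, LinearMap.sum_apply, LinearMap.smul_apply, mulComponent_tprod]
  have hz : ∀ {ε ε' : ZMod 2} {f : F}, parityProj 𝒜 ε f = f → ε ≠ ε' →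
      parityProj 𝒜 ε' f = 0 := by
    intro ε ε' f hf h
    rw [← hf, parityProj_parityProj, if_neg h]
  rw [key, Finset.sum_eq_single ε, Finset.sum_eq_single η]
  · simp only [ha, hb]
  · intro η' _ h
    obtain ⟨i, hi⟩ := Function.ne_iff.1 h
    rw [tprod_eq_zero 𝒜 i, smul_zero]
    simp only [hz (hb i) (Ne.symm hi), mul_zero]
  · simp
  · intro ε' _ h
    obtain ⟨i, hi⟩ := Function.ne_iff.1 h
    refine Finset.sum_eq_zero fun η' _ => ?_
    rw [tprod_eq_zero 𝒜 i, smul_zero]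
    simp only [hz (ha i) (Ne.symm hi), zero_mul]
  · simp

theorem mulExp_add_left (ε ε' η : Fin n → ZMod 2) :
    mulExp (ε + ε') η = mulExp ε η + mulExp ε' η := by
  simp only [mulExp, ← Finset.sum_add_distrib]
  refine Finset.sum_congr rfl fun i _ => Finset.sum_congr rfl fun j _ => ?_
  split_ifs <;> simp [add_mul]

theorem mulExp_add_right (ε η η' : Fin n → ZMod 2) :
    mulExp ε (η + η') = mulExp ε η + mulExp ε η' := by
  simp only [mulExp, ← Finset.sum_add_distrib]
  refine Finset.sum_congr rfl fun i _ => Finset.sum_congr rfl fun j _ => ?_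
  split_ifs <;> simp [mul_add]

theorem mulMap_assoc (a b c : SuperPower 𝒜 n) : a * b * c = a * (b * c) := by
  have h : (mulMap 𝒜 (n := n)).compr₂ (mulMap 𝒜 (n := n)) =
      (LinearMap.llcomp k _ _ _).compl₁₂ (mulMap 𝒜 (n := n)) (mulMap 𝒜 (n := n)) := by
    refine hom_ext 𝒜 fun ε a ha => hom_ext 𝒜 fun η b hb => hom_ext 𝒜 fun ζ c hc => ?_
    change tprod 𝒜 a * tprod 𝒜 b * tprod 𝒜 c = tprod 𝒜 a * (tprod 𝒜 b * tprod 𝒜 c)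
    have hab : ∀ i, parityProj 𝒜 ((ε + η) i) (a i * b i) = a i * b i := fun i => by
      rw [← ha i, ← hb i]; exact parityProj_mul 𝒜 _ _ _ _
    have hbc : ∀ i, parityProj 𝒜 ((η + ζ) i) (b i * c i) = b i * c i := fun i => by
      rw [← hb i, ← hc i]; exact parityProj_mul 𝒜 _ _ _ _
    rw [tprod_mul_tprod 𝒜 ha hb, tprod_mul_tprod 𝒜 hb hc, mul_def, map_smul,
      LinearMap.smul_apply, ← mul_def, tprod_mul_tprod 𝒜 hab hc, mul_def, map_smul, ← mul_def,
      tprod_mul_tprod 𝒜 ha hbc, smul_smul, smul_smul, ← sgn_add, ← sgn_add, mulExp_add_left,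
      mulExp_add_right]
    simp only [mul_assoc]
    congr 2
    ring
  exact congrArg (fun M => M a b c) h

theorem one_mulMap (a : SuperPower 𝒜 n) : 1 * a = a := by
  have h : mulMap 𝒜 (n := n) 1 = LinearMap.id := by
    refine hom_ext 𝒜 fun ε a ha => ?_
    rw [← mul_def, one_def,
      tprod_mul_tprod 𝒜 (ε := fun _ => 0) (fun _ => parityProj_zero_one 𝒜) ha]
    simp [mulExp, sgn]
  exact congrArg (fun M => M a) h

theorem mulMap_one (a : SuperPower 𝒜 n) : a * 1 = a := by
  have h : (mulMap 𝒜 (n := n)).flip 1 = LinearMap.id := by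
    refine hom_ext 𝒜 fun ε a ha => ?_
    rw [LinearMap.flip_apply, ← mul_def, one_def,
      tprod_mul_tprod 𝒜 (η := fun _ => 0) ha (fun _ => parityProj_zero_one 𝒜)]
    simp [mulExp, sgn]
  exact congrArg (fun M => M a) h

instance : Ring (SuperPower 𝒜 n) :=
  { (inferInstance : AddCommGroup (SuperPower 𝒜 n)) with
    mul := (· * ·)
    one := 1
    mul_assoc := mulMap_assoc 𝒜
    one_mul := one_mulMap 𝒜
    mul_one := mulMap_one 𝒜
    left_distrib := fun a b c => map_add (mulMap 𝒜 a) b c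
    right_distrib := fun a b c => LinearMap.map_add₂ (mulMap 𝒜) a b c
    zero_mul := fun a => LinearMap.map_zero₂ (mulMap 𝒜) a
    mul_zero := fun a => map_zero (mulMap 𝒜 a) }

instance : Algebra k (SuperPower 𝒜 n) :=
  Algebra.ofModule (fun r a b => LinearMap.map_smul₂ (mulMap 𝒜) r a b)
    (fun r a b => map_smul (mulMap 𝒜 a) r b)

/-! ### Superpermutations -/

/-- The exponent of the sign `(-1)^{∑ ε_i ε_j}`, the sum being over the inversions `i < j`,
`π j < π i` of `π`. -/
def permExp (π : Equiv.Perm (Fin n)) (ε : Fin n → ZMod 2) : ZMod 2 :=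
  ∑ i, ∑ j, if i < j ∧ π j < π i then ε i * ε j else 0

/-- The linear map taking the component of parity `ε_i` of each factor, and moving the factor in
place `i` to place `π i`. -/
def permComponent (π : Equiv.Perm (Fin n)) (ε : Fin n → ZMod 2) :
    SuperPower 𝒜 n →ₗ[k] SuperPower 𝒜 n :=
  (PiTensorProduct.reindex k (fun _ : Fin n => F) π).toLinearMap ∘ₗ
    PiTensorProduct.map fun i => parityProj 𝒜 (ε i)

theorem permComponent_tprod (π : Equiv.Perm (Fin n)) (ε : Fin n → ZMod 2) (a : Fin n → F) :
    permComponent 𝒜 π ε (tprod 𝒜 a) =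
      tprod 𝒜 fun i => parityProj 𝒜 (ε (π.symm i)) (a (π.symm i)) := by
  refine (congrArg (PiTensorProduct.reindex k (fun _ : Fin n => F) π)
    (PiTensorProduct.map_tprod _ a)).trans ?_
  exact PiTensorProduct.reindex_tprod π _

/-- The action of `S_n` on `F^{⊗ n}` by superpermutation of the factors. -/
def superPerm (π : Equiv.Perm (Fin n)) : SuperPower 𝒜 n →ₗ[k] SuperPower 𝒜 n :=
  ∑ ε : Fin n → ZMod 2, sgn k (permExp π ε) • permComponent 𝒜 π ε

theorem superPerm_tprod (π : Equiv.Perm (Fin n)) {ε : Fin n → ZMod 2} {a : Fin n → F}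
    (ha : ∀ i, parityProj 𝒜 (ε i) (a i) = a i) :
    superPerm 𝒜 π (tprod 𝒜 a) = sgn k (permExp π ε) • tprod 𝒜 fun i => a (π.symm i) := by
  simp only [superPerm, LinearMap.sum_apply, LinearMap.smul_apply, permComponent_tprod]
  rw [Finset.sum_eq_single ε]
  · simp only [ha]
  · intro ε' _ h
    obtain ⟨i, hi⟩ := Function.ne_iff.1 h
    rw [tprod_eq_zero 𝒜 (π i), smul_zero]
    rw [Equiv.symm_apply_apply, ← ha i, parityProj_parityProj, if_neg (Ne.symm hi)]
  · simp

theorem permExp_mul (π σ : Equiv.Perm (Fin n)) (ε : Fin n → ZMod 2) :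
    permExp (π * σ) ε = permExp σ ε + permExp π (fun i => ε (σ.symm i)) := by
  have h1 : permExp π (fun i => ε (σ.symm i)) =
      ∑ i, ∑ j, if σ i < σ j ∧ π (σ j) < π (σ i) then ε i * ε j else 0 := by
    rw [permExp, ← Equiv.sum_comp σ]
    refine Finset.sum_congr rfl fun i _ => ?_
    rw [← Equiv.sum_comp σ]
    simp
  have hneg : ∀ a b : ZMod 2, a + b = 0 → a = b := by decide
  refine hneg _ _ ?_
  rw [h1]
  simp only [permExp, ← Finset.sum_add_distrib, Equiv.Perm.mul_apply]
  rw [← Finset.sum_product']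
  refine Finset.sum_involution (fun p _ => p.swap) ?_ ?_ ?_ ?_
  · rintro ⟨i, j⟩ -
    simp only [Prod.fst_swap, Prod.snd_swap]
    have h2 : ∀ a : ZMod 2, a + a = 0 := by decide
    rw [mul_comm (ε j) (ε i)]
    generalize ε i * ε j = a
    rcases lt_trichotomy i j with h | rfl | h
    · have hs : σ i ≠ σ j := fun hh => h.ne (σ.injective hh)
      have hp : π (σ i) ≠ π (σ j) := fun hh => hs (π.injective hh)
      rcases lt_or_gt_of_ne hs with h3 | h3 <;> rcases lt_or_gt_of_ne hp with h4 | h4 <;>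
        simp [h, h3, h4, h.not_gt, h3.not_gt, h4.not_gt, h2]
    · simp
    · have hs : σ i ≠ σ j := fun hh => h.ne' (σ.injective hh)
      have hp : π (σ i) ≠ π (σ j) := fun hh => hs (π.injective hh)
      rcases lt_or_gt_of_ne hs with h3 | h3 <;> rcases lt_or_gt_of_ne hp with h4 | h4 <;>
        simp [h, h3, h4, h.not_gt, h3.not_gt, h4.not_gt, h2]
  · rintro ⟨i, j⟩ - h hh
    obtain rfl : j = i := congrArg Prod.fst hh
    simp at h
  · simp
  · simp

/-- Superpermutation is a left action. -/
theorem superPerm_mul (π σ : Equiv.Perm (Fin n)) (a : SuperPower 𝒜 n) :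
    superPerm 𝒜 (π * σ) a = superPerm 𝒜 π (superPerm 𝒜 σ a) := by
  have h : superPerm 𝒜 (π * σ) = superPerm 𝒜 π ∘ₗ superPerm 𝒜 σ := by
    refine hom_ext 𝒜 fun ε a ha => ?_
    rw [LinearMap.comp_apply, superPerm_tprod 𝒜 _ ha, superPerm_tprod 𝒜 _ ha, map_smul,
      superPerm_tprod 𝒜 π (ε := fun i => ε (σ.symm i)) (fun i => ha _), smul_smul, ← sgn_add,
      permExp_mul]
    rfl
  exact congrArg (fun M => M a) h

/-- A simple transposition `s_i` exchanges the factors in the places `i` and `j = i + 1`, with the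
sign `(-1)^{|a_i| |a_j|}`. -/
theorem superPerm_swap {i j : Fin n} (hij : (j : ℕ) = i + 1) {ε : Fin n → ZMod 2}
    {a : Fin n → F} (ha : ∀ i, parityProj 𝒜 (ε i) (a i) = a i) :
    superPerm 𝒜 (Equiv.swap i j) (tprod 𝒜 a) =
      sgn k (ε i * ε j) • tprod 𝒜 fun l => a (Equiv.swap i j l) := by
  rw [superPerm_tprod 𝒜 _ ha]
  have hlt : i < j := by rw [Fin.lt_def]; omega
  have h : permExp (Equiv.swap i j) ε = ε i * ε j := by
    rw [permExp, Finset.sum_eq_single i, Finset.sum_eq_single j]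
    · simp [hlt]
    · intro l _ hl
      rw [if_neg]
      rintro ⟨h1, h2⟩
      rw [Equiv.swap_apply_left, Equiv.swap_apply_of_ne_of_ne h1.ne' hl] at h2
      rw [Fin.lt_def] at h1 h2
      omega
    · simp
    · intro m _ hm
      refine Finset.sum_eq_zero fun l _ => if_neg ?_
      rintro ⟨h1, h2⟩
      by_cases hmj : m = j
      · subst hmj
        rw [Equiv.swap_apply_right, Equiv.swap_apply_of_ne_of_ne (hlt.trans h1).ne' h1.ne'] at h2
        exact absurd (hlt.trans h1) h2.not_gt
      · rw [Equiv.swap_apply_of_ne_of_ne hm hmj] at h2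
        have hne : (m : ℕ) ≠ i := fun hh => hm (Fin.ext hh)
        have hne' : (m : ℕ) ≠ j := fun hh => hmj (Fin.ext hh)
        rw [Equiv.swap_apply_def] at h2
        split_ifs at h2 <;> simp only [Fin.lt_def, Fin.ext_iff] at * <;> omega
    · simp
  rw [h]
  rfl

/-- The element `f_i = 1 ⊗ ⋯ ⊗ 1 ⊗ f ⊗ 1 ⊗ ⋯ ⊗ 1`, with `f` in place `i`. -/
def single (i : Fin n) (f : F) : SuperPower 𝒜 n := tprod 𝒜 (Function.update (fun _ => 1) i f)

/-- The map `ψ_i = id ⊗ ⋯ ⊗ id ⊗ ψ ⊗ id ⊗ ⋯ ⊗ id`, with `ψ` in place `i`. -/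
def mapAt (ψ : F →ₗ[k] F) (i : Fin n) : SuperPower 𝒜 n →ₗ[k] SuperPower 𝒜 n :=
  PiTensorProduct.map (Function.update (fun _ => LinearMap.id) i ψ)

variable (n) in
/-- The elements of `F^{⊗ n}` of degree `p.1` and parity `p.2`. -/
def homogeneous (p : ℕ × ZMod 2) : Submodule k (SuperPower 𝒜 n) :=
  Submodule.span k {z | ∃ (q : Fin n → ℕ × ZMod 2) (a : Fin n → F),
    (∀ i, a i ∈ 𝒜 (q i)) ∧ ∑ i, q i = p ∧ tprod 𝒜 a = z}

end SuperPower
end TensorPower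

/-! ## Affine wreath product algebras -/

section Affine

variable {k : Type u} [CommRing k] {F : Type v} [Ring F] [Algebra k F]
variable {𝒜 : ℕ × ZMod 2 → Submodule k F} [GradedAlgebra 𝒜]
variable [Module.Free k F] [Module.Finite k F] (T : FrobeniusStructure 𝒜)

open FrobeniusStructure

/-- The element `t_{i,j} = ∑_b b_i (b^∨)_j` of `F^{⊗ n}`. -/
def casimir {ι : Type w} [Fintype ι] (B : Module.Basis ι k F) {n : ℕ} (i j : Fin n) :
    SuperPower 𝒜 n :=
  ∑ b : ι, SuperPower.single 𝒜 i (B b) * SuperPower.single 𝒜 j (T.leftDual B b)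

/-- Generators of the free product of `k[x_1, …, x_n]`, `F^{⊗ n}` and `k S_n`. The places
`1, …, n` are numbered `0, …, n - 1`. -/
inductive Gen (𝒜 : ℕ × ZMod 2 → Submodule k F) (n : ℕ) : Type (max u v)
  | x (i : Fin n) : Gen 𝒜 n
  | tensor (a : SuperPower 𝒜 n) : Gen 𝒜 n
  | perm (π : Equiv.Perm (Fin n)) : Gen 𝒜 n

/-- The free generator `x_i`. -/
abbrev genX {n : ℕ} (i : Fin n) : FreeAlgebra k (Gen 𝒜 n) := FreeAlgebra.ι k (Gen.x i)

/-- The free generator given by an element of `F^{⊗ n}`. -/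
abbrev genTensor {n : ℕ} (a : SuperPower 𝒜 n) : FreeAlgebra k (Gen 𝒜 n) :=
  FreeAlgebra.ι k (Gen.tensor a)

/-- The free generator given by a permutation. -/
abbrev genPerm (𝒜 : ℕ × ZMod 2 → Submodule k F) {n : ℕ} (π : Equiv.Perm (Fin n)) :
    FreeAlgebra k (Gen 𝒜 n) := FreeAlgebra.ι k (Gen.perm π)

/-- The defining relations of the affine wreath product algebra. The relations `x_comm` to
`perm_mul` give the free product of `k[x_1, …, x_n]`, `F^{⊗ n}` and `k S_n`; the others are the
relations imposed on this free product. -/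
inductive Rel {ι : Type w} [Fintype ι] (B : Module.Basis ι k F) (n : ℕ) :
    FreeAlgebra k (Gen 𝒜 n) → FreeAlgebra k (Gen 𝒜 n) → Prop
  | x_comm (i j : Fin n) : Rel B n (genX i * genX j) (genX j * genX i)
  | tensor_one : Rel B n (genTensor 1) 1
  | tensor_add (a b : SuperPower 𝒜 n) : Rel B n (genTensor (a + b)) (genTensor a + genTensor b)
  | tensor_smul (r : k) (a : SuperPower 𝒜 n) : Rel B n (genTensor (r • a)) (r • genTensor a)
  | tensor_mul (a b : SuperPower 𝒜 n) : Rel B n (genTensor (a * b)) (genTensor a * genTensor b)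
  | perm_one : Rel B n (genPerm 𝒜 1) 1
  | perm_mul (π σ : Equiv.Perm (Fin n)) : Rel B n (genPerm 𝒜 (π * σ)) (genPerm 𝒜 π * genPerm 𝒜 σ)
  | tensor_x (a : SuperPower 𝒜 n) (i : Fin n) :
      Rel B n (genTensor a * genX i)
        (genX i * genTensor (SuperPower.mapAt 𝒜 (T.nakayama : F →ₗ[k] F) i a))
  | simple_x_of_ne (i i' j : Fin n) (hi : (i' : ℕ) = i + 1) (h : j ≠ i) (h' : j ≠ i') :
      Rel B n (genPerm 𝒜 (Equiv.swap i i') * genX j) (genX j * genPerm 𝒜 (Equiv.swap i i'))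
  | simple_x (i i' : Fin n) (hi : (i' : ℕ) = i + 1) :
      Rel B n (genPerm 𝒜 (Equiv.swap i i') * genX i)
        (genX i' * genPerm 𝒜 (Equiv.swap i i') - genTensor (casimir T B i i'))
  | perm_tensor (π : Equiv.Perm (Fin n)) (a : SuperPower 𝒜 n) :
      Rel B n (genPerm 𝒜 π * genTensor a) (genTensor (SuperPower.superPerm 𝒜 π a) * genPerm 𝒜 π)

/-- The affine wreath product algebra `𝒜_n(F)`. -/
abbrev AffineWreathAlgebra {ι : Type w} [Fintype ι] (B : Module.Basis ι k F) (n : ℕ) :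
    Type (max u v) := RingQuot (Rel T B n)

namespace AffineWreathAlgebra

variable {ι : Type w} [Fintype ι] (B : Module.Basis ι k F) {n : ℕ}

/-- The element `x_i` of `𝒜_n(F)`. -/
def x (i : Fin n) : AffineWreathAlgebra T B n := RingQuot.mkAlgHom k (Rel T B n) (genX i)

/-- The image in `𝒜_n(F)` of an element of `F^{⊗ n}`. -/
def tensor (a : SuperPower 𝒜 n) : AffineWreathAlgebra T B n :=
  RingQuot.mkAlgHom k (Rel T B n) (genTensor a)

/-- The image in `𝒜_n(F)` of a permutation. -/
def perm (π : Equiv.Perm (Fin n)) : AffineWreathAlgebra T B n :=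
  RingQuot.mkAlgHom k (Rel T B n) (genPerm 𝒜 π)

/-- The monomial `x^α = x_1^{α_1} ⋯ x_n^{α_n}`. -/
def monomial (α : Fin n → ℕ) : AffineWreathAlgebra T B n :=
  (List.ofFn fun i => x T B i ^ α i).prod

end AffineWreathAlgebra

/-! ## Cyclotomic quotients -/

/-- `𝐅_ψ^{(α)} = F_ψ^{(α_1)} ⊗ ⋯ ⊗ F_ψ^{(α_n)}`, as a submodule of `F^{⊗ n}`. -/
def twistedTensor {n : ℕ} (α : Fin n → ℤ) : Submodule k (SuperPower 𝒜 n) :=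
  Submodule.span k {z | ∃ a : Fin n → F, (∀ i, a i ∈ T.twistedCenter (α i)) ∧
    SuperPower.tprod 𝒜 a = z}

/-- `𝐅_i^{(m)}`: the elements of `𝐅_ψ^{(0, …, 0, m, 0, …, 0)}`, with `m` in place `i`, which are
invariant under the permutations fixing `i`. -/
def shiftSpace {n : ℕ} (i : Fin n) (m : ℤ) : Submodule k (SuperPower 𝒜 n) where
  carrier := {a | a ∈ twistedTensor T (Pi.single i m) ∧
    ∀ π : Equiv.Perm (Fin n), π i = i → SuperPower.superPerm 𝒜 π a = a}
  zero_mem' := ⟨zero_mem _, fun π _ => map_zero _⟩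
  add_mem' := by
    rintro a b ⟨ha, ha'⟩ ⟨hb, hb'⟩
    exact ⟨add_mem ha hb, fun π h => by rw [map_add, ha' π h, hb' π h]⟩
  smul_mem' := by
    rintro r a ⟨ha, ha'⟩
    exact ⟨Submodule.smul_mem _ r ha, fun π h => by rw [map_smul, ha' π h]⟩

/-- A cyclotomic parameter `C`: for `1 ≤ m ≤ θ`, a number `e_m` and even elements
`c^{(m,1)}, …, c^{(m,e_m)}` of `𝐅_1^{(m)}` of degree `m δ`. The index `m - 1` ranges over
`Fin θ`. -/
structure CyclotomicParameter (n : ℕ) [NeZero n] where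
  e : Fin T.θ → ℕ
  c : (m : Fin T.θ) → Fin (e m) → SuperPower 𝒜 n
  c_mem : ∀ (m : Fin T.θ) (j : Fin (e m)), c m j ∈ shiftSpace T (0 : Fin n) ((m : ℕ) + 1 : ℤ)
  c_homogeneous : ∀ (m : Fin T.θ) (j : Fin (e m)),
    c m j ∈ SuperPower.homogeneous 𝒜 n (((m : ℕ) + 1) * T.δ, 0)

namespace CyclotomicParameter

variable {T} {n : ℕ} [NeZero n] (C : CyclotomicParameter T n)

/-- The level `d_C = ∑_m m e_m`. -/
def level : ℕ := ∑ m : Fin T.θ, ((m : ℕ) + 1) * C.e m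

variable {ι : Type w} [Fintype ι] (B : Module.Basis ι k F)

/-- The element `χ_C = ∏_m ∏_j (x_1^m - c^{(m,j)})`. -/
def chi : AffineWreathAlgebra T B n :=
  (List.ofFn fun m : Fin T.θ => (List.ofFn fun j : Fin (C.e m) =>
    AffineWreathAlgebra.x T B 0 ^ ((m : ℕ) + 1) -
      AffineWreathAlgebra.tensor T B (C.c m j)).prod).prod

/-- The two-sided ideal `J_C` generated by `χ_C`. -/
def ideal : TwoSidedIdeal (AffineWreathAlgebra T B n) := TwoSidedIdeal.span {C.chi B}

/-- The cyclotomic wreath product algebra `𝒜_n^C(F) = 𝒜_n(F) / J_C`. -/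
abbrev Quotient : Type (max u v) := (C.ideal B).ringCon.Quotient

/-- The canonical projection `𝒜_n(F) → 𝒜_n^C(F)`. -/
def proj : AffineWreathAlgebra T B n →ₐ[k] C.Quotient B := (C.ideal B).ringCon.mkₐ (α := k)

end CyclotomicParameter

end Affine

end AffineWreath

end

/-! ## Wreath data and their regular representation -/

noncomputable section

namespace AffineWreath

open Equiv

/-! Two basis theorems are stacked: one for the affine algebra `A`, one for its quotient. Write `S`
for the tensor power of `F`.

In `A` the elements `x^α a π`, with `a` running through a basis of `S`, form a basis. This uses only
the action of the symmetric group on `S`, the endomorphisms `ψ_i`, the elements `t_{i,j}` and a few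
identities between them, which make up a `WreathDatum`. The elements span because each generator can
be moved into normal form modulo terms of lower degree in the `x_i`. They are independent because
the space of formal sums of symbols `x^α a π` carries an action that imitates right multiplication.
It is dictated by the formula `π x_i = x_{π i} π + ∑_m ([m < i] - [π m < π i]) t_{π m, π i} π (m
i)`. The hard relation to check is that the operators of `x_i` and `x_j` commute (`mulX_comm`); it
rests on a three-term identity for the coefficients (`invCoef_three_term`). Acting on `1` then
recovers the coefficients of a normal form (`RegularHom.orbit_normal`).

For the quotient, let `χ` be the generator of the ideal and `d` its level. It commutes with all
`x_i` and with the permutations fixing the first place, moves past `S` up to changing the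
coefficient, and has leading term `x_0^d`. Let `χ_i` be its conjugate by the transposition `(0 i)`.
The two-sided ideal is the sum of the right ideals `χ_i A`, since left multiplication by generators
preserves this sum. In the basis of `A` replace each `x^α a π` that has some `α_i ≥ d` by `χ_i x^{α
- d e_i} a π`, where `i` is the last such index. This change is unitriangular for the degree, so the
result is again a basis (`cycNormal`).

The new elements lie in the ideal, and they span it: `χ_i` and `χ_j` commute modulo a lower step of
the ideal (`conj_mul_conj_sub_mem_cyc`), so `χ_i x_j^d y` may be traded for `χ_j x_i^d y` until the
index in front is the last one possible (`cyc_le_map_cycNormal`). What survives in the quotient is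
the part of the basis with all `α_i < d`.

The Frobenius structure enters in three ways. The Nakayama map is an even algebra homomorphism, the
dual basis identities give the rules for `t_{i,j}` (`mul_casimir`, `nakayama_casimir`), and each
parameter `c^{(m,j)}` moves past `S` exactly as `x_0^m` does (`mul_of_mem_shiftSpace`). -/

/-- The data on a `k`-algebra `S` needed to define an affine wreath product algebra with
coefficients in `S`: an action of the symmetric group, commuting endomorphisms `ψ_i`, and elements
`t_{i,j}`. -/
structure WreathDatum (k S : Type*) [CommRing k] [Ring S] [Algebra k S] (n : ℕ) where
  act : Perm (Fin n) →* (S →ₐ[k] S)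
  ψ : Fin n → S →ₐ[k] S
  t : Fin n → Fin n → S
  ψ_comm : ∀ i j a, ψ i (ψ j a) = ψ j (ψ i a)
  act_ψ : ∀ σ i a, act σ (ψ i a) = ψ (σ i) (act σ a)
  act_t : ∀ σ i j, act σ (t i j) = t (σ i) (σ j)
  mul_t : ∀ i j a, i ≠ j → a * t i j = t i j * act (swap i j) (ψ j a)
  ψ_t : ∀ i j, i ≠ j → ψ i (t j i) = t i j
  ψ_t_of_ne : ∀ l i j, l ≠ i → l ≠ j → ψ l (t i j) = t i j

/-- Elements of a `k`-algebra `A` satisfying the relations of the affine wreath product algebra. -/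
structure WreathRep {k S : Type*} [CommRing k] [Ring S] [Algebra k S] {n : ℕ}
    (D : WreathDatum k S n) (A : Type*) [Ring A] [Algebra k A] where
  x : Fin n → A
  τ : S →ₐ[k] A
  p : Perm (Fin n) →* A
  x_comm : ∀ i j, x i * x j = x j * x i
  τ_x : ∀ a i, τ a * x i = x i * τ (D.ψ i a)
  p_x_of_ne : ∀ i i' j : Fin n, (i' : ℕ) = i + 1 → j ≠ i → j ≠ i' →
    p (swap i i') * x j = x j * p (swap i i')
  p_x : ∀ i i' : Fin n, (i' : ℕ) = i + 1 →
    p (swap i i') * x i = x i' * p (swap i i') - τ (D.t i i')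
  p_τ : ∀ π a, p π * τ a = τ (D.act π a) * p π

/-! ### Combinatorics of the correction coefficients -/

/-- `[m < i] - [π m < π i]`. -/
def invCoef {n : ℕ} (π : Perm (Fin n)) (m i : Fin n) : ℤ :=
  (if m < i then 1 else 0) - (if π m < π i then 1 else 0)

@[simp] theorem invCoef_self {n : ℕ} (π : Perm (Fin n)) (i : Fin n) : invCoef π i i = 0 := by
  simp [invCoef]

@[simp] theorem invCoef_one {n : ℕ} (m i : Fin n) : invCoef 1 m i = 0 :=
  sub_self _

/-- The cocycle rule: moving `σ` and then `π` past a variable gives the same corrections as moving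
`π * σ` at once. The middle comparison of `σ m` with `σ i` telescopes. -/
theorem invCoef_add_invCoef {n : ℕ} (π σ : Perm (Fin n)) (m i : Fin n) :
    invCoef π (σ m) (σ i) + invCoef σ m i = invCoef (π * σ) m i :=
  sub_add_sub_cancel' _ _ _

theorem ite_lt_add_ite_lt {X : Type*} [LinearOrder X] {a b : X} (h : a ≠ b) :
    (if a < b then (1 : ℤ) else 0) + (if b < a then 1 else 0) = 1 := by
  rcases lt_or_gt_of_ne h with h | h <;> simp [h, h.not_gt]

/-- If `m` lies below both `i` and `j`, exactly one of the chains `m < j < i` and `m < i < j` holds;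
otherwise neither does. -/
theorem ite_lt_mul_ite_lt {X : Type*} [LinearOrder X] {m i j : X} (h1 : m ≠ i) (h2 : m ≠ j)
    (h3 : i ≠ j) :
    (if m < j then (1 : ℤ) else 0) * (if j < i then 1 else 0) +
      (if i < j then 1 else 0) * (if m < i then 1 else 0) =
      (if m < i then 1 else 0) * (if m < j then 1 else 0) := by
  rcases lt_or_gt_of_ne h1 with a | a <;> rcases lt_or_gt_of_ne h2 with b | b <;>
    rcases lt_or_gt_of_ne h3 with c | c <;> simp [a, b, c, a.not_gt, b.not_gt, c.not_gt]
  -- What remains are the two cyclic orders, excluded by transitivity.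
  · exact absurd (b.trans a) c.not_gt
  · exact absurd (a.trans b) c.not_gt

theorem invCoef_swap {n : ℕ} (π : Perm (Fin n)) {i j : Fin n} (h : i ≠ j) :
    invCoef π i j = -invCoef π j i := by
  have h1 := ite_lt_add_ite_lt h
  have h2 := ite_lt_add_ite_lt (π.injective.ne h)
  simp only [invCoef]
  linear_combination h1 - h2

/-- After replacing `[j < i]` by `1 - [i < j]`, before and after applying `π`, the mixed terms
cancel. The rest is the difference of `ite_lt_mul_ite_lt` for `m, i, j` and for their images. -/
theorem invCoef_three_term {n : ℕ} (π : Perm (Fin n)) {m i j : Fin n} (h1 : m ≠ i) (h2 : m ≠ j)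
    (h3 : i ≠ j) :
    invCoef π m i * invCoef (π * swap m i) i j + invCoef π j i * invCoef (π * swap j i) m j =
      invCoef π m j * invCoef (π * swap m j) m i := by
  simp only [invCoef, Perm.mul_apply, swap_apply_left, swap_apply_right,
    swap_apply_of_ne_of_ne h2.symm h3.symm, swap_apply_of_ne_of_ne h1.symm h3,
    swap_apply_of_ne_of_ne h2 h1]
  have a1 := ite_lt_mul_ite_lt h1 h2 h3
  have b1 := ite_lt_mul_ite_lt (π.injective.ne h1) (π.injective.ne h2) (π.injective.ne h3)
  have a2 := ite_lt_add_ite_lt h3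
  have b2 := ite_lt_add_ite_lt (π.injective.ne h3)
  generalize (if m < i then (1 : ℤ) else 0) = ami at *
  generalize (if m < j then (1 : ℤ) else 0) = amj at *
  generalize (if i < j then (1 : ℤ) else 0) = aij at *
  generalize (if j < i then (1 : ℤ) else 0) = aji at *
  generalize (if π m < π i then (1 : ℤ) else 0) = bmi at *
  generalize (if π m < π j then (1 : ℤ) else 0) = bmj at *
  generalize (if π i < π j then (1 : ℤ) else 0) = bij at *
  generalize (if π j < π i then (1 : ℤ) else 0) = bji at *
  obtain rfl : aji = 1 - aij := by linarith
  obtain rfl : bji = 1 - bij := by linarith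
  linear_combination a1 - b1

/-- With `b = [π j < π i]` the factors are `1 - b` and `-b` in some order, and `b` is `0` or `1`. -/
theorem invCoef_mul_invCoef_swap {n : ℕ} (π : Perm (Fin n)) {i j : Fin n} (h : i ≠ j) :
    invCoef π j i * invCoef (π * swap j i) i j = 0 := by
  simp only [invCoef, Perm.mul_apply, swap_apply_left, swap_apply_right]
  rcases lt_or_gt_of_ne h with a | a <;>
    rcases lt_or_gt_of_ne (π.injective.ne h) with b | b <;> simp [a, b, a.not_gt, b.not_gt]

section sums

variable {N : Type*} [AddCommGroup N] {n : ℕ}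

/-- Bookkeeping for the commutator of two degree zero parts: disjoint transpositions cancel
termwise, and the remaining pairs of indices are grouped into one triple for each `m`. -/
theorem sum_sum_eq_zero {i j : Fin n} (hij : i ≠ j) (h : Fin n → Fin n → N)
    (h1 : ∀ m l, m ≠ i → m ≠ j → l ≠ i → l ≠ j → m ≠ l → h m l = 0)
    (h2 : ∀ l, h i l = 0) (h3 : ∀ m, h m j = 0) (h4 : h j i = 0)
    (h5 : ∀ m, m ≠ i → m ≠ j → h m m + h m i + h j m = 0) :
    ∑ m, ∑ l, h m l = 0 := by
  have key : ∀ m, ∑ l, h m l =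
      (if m = j then ∑ l, h j l else 0) + (if m = i ∨ m = j then 0 else h m m + h m i) := by
    intro m
    by_cases hmj : m = j
    · simp [hmj]
    by_cases hmi : m = i
    · simp [hmi, h2, hij]
    rw [if_neg hmj, if_neg (by tauto), zero_add, ← Finset.sum_pair hmi]
    refine (Finset.sum_subset (Finset.subset_univ _) fun l _ hl => ?_).symm
    simp only [Finset.mem_insert, Finset.mem_singleton, not_or] at hl
    by_cases hlj : l = j
    · rw [hlj, h3]
    · exact h1 m l hmi hmj hl.2 hlj (Ne.symm hl.1)
  rw [Finset.sum_congr rfl fun m _ => key m, Finset.sum_add_distrib]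
  simp only [Finset.sum_ite_eq', Finset.mem_univ, if_true]
  rw [← Finset.sum_add_distrib]
  refine Finset.sum_eq_zero fun m _ => ?_
  by_cases hm : m = i ∨ m = j
  · rw [if_pos hm]
    rcases hm with rfl | rfl
    · simp [h4]
    · simp [h3]
  · rw [if_neg hm, add_comm]
    exact h5 m (fun h => hm (Or.inl h)) fun h => hm (Or.inr h)

end sums

namespace WreathDatum

variable {k S : Type*} [CommRing k] [Ring S] [Algebra k S] {n : ℕ} (D : WreathDatum k S n)

/-- This and the next two lemmas are `mul_t` with `a` itself some `t`. Here neither `ψ_i` nor the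
transposition `(m i)` touches the indices `l, j`. -/
theorem t_mul_t_comm {m i l j : Fin n} (h1 : m ≠ i) (h2 : m ≠ l) (h3 : m ≠ j) (h4 : i ≠ l)
    (h5 : i ≠ j) : D.t l j * D.t m i = D.t m i * D.t l j := by
  rw [D.mul_t m i _ h1, D.ψ_t_of_ne _ _ _ h4 h5, D.act_t, swap_apply_of_ne_of_ne h2.symm h4.symm,
    swap_apply_of_ne_of_ne h3.symm h5.symm]

theorem t_mul_t_left {m i j : Fin n} (h1 : m ≠ i) (h2 : m ≠ j) (h3 : i ≠ j) :
    D.t m j * D.t j i = D.t j i * D.t m i := by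
  rw [D.mul_t j i _ h3.symm, D.ψ_t_of_ne _ _ _ h1.symm h3, D.act_t, swap_apply_left,
    swap_apply_of_ne_of_ne h2 h1]

/-- Here `ψ_i` turns `t_{j,i}` into `t_{i,j}`, which the transposition `(m i)` sends to `t_{m,j}`.
-/
theorem t_mul_t_right {m i j : Fin n} (h1 : m ≠ i) (h2 : m ≠ j) (h3 : i ≠ j) :
    D.t j i * D.t m i = D.t m i * D.t m j := by
  rw [D.mul_t m i _ h1, D.ψ_t _ _ h3, D.act_t, swap_apply_right,
    swap_apply_of_ne_of_ne h2.symm h3.symm]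

/-! ### Operators of right multiplication and their relations -/

/-- The module underlying the right regular representation: `single (α, π) a` stands for
`x^α a π`. -/
abbrev RegularModule (S : Type*) [Ring S] (n : ℕ) : Type _ := ((Fin n → ℕ) × Perm (Fin n)) →₀ S

/-- Right multiplication by an element of `S`. -/
def mulTensor (b : S) : RegularModule S n →ₗ[k] RegularModule S n :=
  Finsupp.lsum k fun q => Finsupp.lsingle q ∘ₗ LinearMap.mulRight k (D.act q.2 b)

/-- Right multiplication by a permutation. -/
def mulPerm (k : Type*) [CommRing k] [Algebra k S] (σ : Perm (Fin n)) :
    RegularModule S n →ₗ[k] RegularModule S n :=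
  Finsupp.lsum k fun q => Finsupp.lsingle (q.1, q.2 * σ)

/-- The leading part of right multiplication by `x_i`. -/
def mulLead (i : Fin n) : RegularModule S n →ₗ[k] RegularModule S n :=
  Finsupp.lsum k fun q =>
    Finsupp.lsingle (q.1 + Pi.single (q.2 i) 1, q.2) ∘ₗ (D.ψ (q.2 i)).toLinearMap

/-- The degree zero part of right multiplication by `x_i`. -/
def mulLow (i : Fin n) : RegularModule S n →ₗ[k] RegularModule S n :=
  Finsupp.lsum k fun q => ∑ m, invCoef q.2 m i •
      (Finsupp.lsingle (q.1, q.2 * swap m i) ∘ₗ LinearMap.mulRight k (D.t (q.2 m) (q.2 i)))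

/-- Right multiplication by `x_i`. -/
def mulX (i : Fin n) : RegularModule S n →ₗ[k] RegularModule S n := D.mulLead i + D.mulLow i

variable (α : Fin n → ℕ) (π : Perm (Fin n)) (a : S)

@[simp] theorem mulTensor_single (b : S) :
    D.mulTensor b (Finsupp.single (α, π) a) = Finsupp.single (α, π) (a * D.act π b) := by
  simp [mulTensor]

@[simp] theorem mulPerm_single (σ : Perm (Fin n)) :
    mulPerm k σ (Finsupp.single (α, π) a) = Finsupp.single (α, π * σ) a := by
  simp [mulPerm]

@[simp] theorem mulLead_single (i : Fin n) :
    D.mulLead i (Finsupp.single (α, π) a) =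
      Finsupp.single (α + Pi.single (π i) 1, π) (D.ψ (π i) a) := by
  simp [mulLead]

theorem mulLow_single (i : Fin n) :
    D.mulLow i (Finsupp.single (α, π) a) =
      ∑ m, invCoef π m i • Finsupp.single (α, π * swap m i) (a * D.t (π m) (π i)) := by
  simp [mulLow]

theorem mulX_single (i : Fin n) :
    D.mulX i (Finsupp.single (α, π) a) =
      Finsupp.single (α + Pi.single (π i) 1, π) (D.ψ (π i) a) +
      ∑ m, invCoef π m i • Finsupp.single (α, π * swap m i) (a * D.t (π m) (π i)) := by
  rw [mulX, LinearMap.add_apply, mulLead_single, mulLow_single]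

theorem regular_hom_ext {N : Type*} [AddCommGroup N] [Module k N]
    {f g : RegularModule S n →ₗ[k] N}
    (h : ∀ α π a, f (Finsupp.single (α, π) a) = g (Finsupp.single (α, π) a)) : f = g :=
  Finsupp.lhom_ext fun q a => h q.1 q.2 a

theorem mulLead_comm (i j : Fin n) : D.mulLead j ∘ₗ D.mulLead i = D.mulLead i ∘ₗ D.mulLead j := by
  refine regular_hom_ext fun α π a => ?_
  simp only [LinearMap.comp_apply, mulLead_single]
  rw [D.ψ_comm, add_right_comm]

/-- Only the summand `m = j` notices the order: its transposition makes the second variable land in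
place `π i` instead of `π j`, and `ψ` reverses the indices of `t`. The other summands agree. -/
theorem mulLead_mulLow (i j : Fin n) (hij : i ≠ j) :
    D.mulLead j (D.mulLow i (Finsupp.single (α, π) a)) =
      D.mulLow i (D.mulLead j (Finsupp.single (α, π) a)) + invCoef π j i •
      (Finsupp.single (α + Pi.single (π i) 1, π * swap j i) (D.ψ (π i) a * D.t (π i) (π j)) -
        Finsupp.single (α + Pi.single (π j) 1, π * swap j i)
          (D.ψ (π j) a * D.t (π j) (π i))) := by
  rw [mulLow_single, mulLead_single, mulLow_single, map_sum, ← sub_eq_iff_eq_add',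
    ← Finset.sum_sub_distrib, Finset.sum_eq_single j]
  · rw [map_zsmul, ← zsmul_sub, mulLead_single, Perm.mul_apply, swap_apply_left, map_mul,
      D.ψ_t _ _ (π.injective.ne hij)]
  · intro m _ hm
    rw [map_zsmul, ← zsmul_sub]
    by_cases hmi : m = i
    · simp [hmi]
    rw [mulLead_single, Perm.mul_apply, swap_apply_of_ne_of_ne (Ne.symm hm) hij.symm, map_mul,
      D.ψ_t_of_ne _ _ _ (π.injective.ne (Ne.symm hm)) (π.injective.ne hij.symm), sub_self,
      smul_zero]
  · simp

/-- The terms of the composition of the degree zero parts of the multiplications by `x_i` and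
`x_j`. -/
def lowTerm (i j m l : Fin n) : RegularModule S n :=
  (invCoef π m i * invCoef (π * swap m i) l j) •
    Finsupp.single (α, π * swap m i * swap l j)
      (a * D.t (π m) (π i) * D.t ((π * swap m i) l) ((π * swap m i) j))

theorem mulLow_mulLow (i j : Fin n) :
    D.mulLow j (D.mulLow i (Finsupp.single (α, π) a)) =
      ∑ m, ∑ l, D.lowTerm α π a i j m l := by
  rw [mulLow_single, map_sum]
  refine Finset.sum_congr rfl fun m _ => ?_
  rw [map_zsmul, mulLow_single, Finset.smul_sum]
  simp only [lowTerm, mul_smul]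

theorem lowTerm_disjoint {i j m l : Fin n} (hij : i ≠ j) (h1 : m ≠ i) (h2 : m ≠ j) (h3 : l ≠ i)
    (h4 : l ≠ j) (h5 : m ≠ l) : D.lowTerm α π a i j m l = D.lowTerm α π a j i l m := by
  have hs : swap m i * swap l j = swap l j * swap m i := by
    have : Perm.Disjoint (swap m i) (swap l j) := by
      rw [Perm.disjoint_iff_disjoint_support, Perm.support_swap h1, Perm.support_swap h4]
      simp [Ne.symm h5, h3, Ne.symm h2, Ne.symm hij]
    exact this.commute
  simp only [lowTerm, invCoef, Perm.mul_apply, swap_apply_of_ne_of_ne h5.symm h3,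
    swap_apply_of_ne_of_ne h2.symm hij.symm, swap_apply_of_ne_of_ne h5 h2,
    swap_apply_of_ne_of_ne h3.symm hij, mul_assoc, hs]
  rw [mul_comm, D.t_mul_t_comm (π.injective.ne h4) (π.injective.ne h5.symm)
    (π.injective.ne h3) (π.injective.ne h2.symm) (π.injective.ne hij.symm)]

/-- All three terms carry the same product of two transpositions and the same product of two
elements `t`; the coefficients match by `invCoef_three_term`. -/
theorem lowTerm_three_term {i j m : Fin n} (hij : i ≠ j) (h1 : m ≠ i) (h2 : m ≠ j) :
    D.lowTerm α π a i j m i + D.lowTerm α π a i j j m = D.lowTerm α π a j i m m := by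
  have hs1 : π * swap m i * swap i j = π * swap m j * swap m i := by
    rw [mul_assoc, mul_assoc]
    congr 1
    ext z
    simp only [Perm.mul_apply, swap_apply_def]
    split_ifs <;> simp_all
  have hs2 : π * swap j i * swap m j = π * swap m j * swap m i := by
    rw [mul_assoc, mul_assoc]
    congr 1
    ext z
    simp only [Perm.mul_apply, swap_apply_def]
    split_ifs <;> simp_all
  rw [lowTerm, lowTerm, lowTerm, hs1, hs2]
  simp only [Perm.mul_apply, swap_apply_left, swap_apply_right,
    swap_apply_of_ne_of_ne h2.symm hij.symm, swap_apply_of_ne_of_ne h1.symm hij,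
    swap_apply_of_ne_of_ne h2 h1]
  rw [mul_assoc a, mul_assoc a, mul_assoc a,
    ← D.t_mul_t_right (π.injective.ne h1) (π.injective.ne h2) (π.injective.ne hij),
    D.t_mul_t_left (π.injective.ne h1) (π.injective.ne h2)
    (π.injective.ne hij), ← add_smul, invCoef_three_term π h1 h2 hij]

theorem mulLow_comm (i j : Fin n) : D.mulLow j ∘ₗ D.mulLow i = D.mulLow i ∘ₗ D.mulLow j := by
  by_cases hij : i = j
  · rw [hij]
  refine regular_hom_ext fun α π a => ?_
  simp only [LinearMap.comp_apply]
  rw [mulLow_mulLow, mulLow_mulLow, Finset.sum_comm (f := D.lowTerm α π a j i), ← sub_eq_zero,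
    ← Finset.sum_sub_distrib]
  simp only [← Finset.sum_sub_distrib]
  refine sum_sum_eq_zero hij _ (fun m l h1 h2 h3 h4 h5 => ?_) (fun l => ?_) (fun m => ?_) ?_
    fun m h1 h2 => ?_
  · rw [D.lowTerm_disjoint α π a hij h1 h2 h3 h4 h5, sub_self]
  · simp [lowTerm]
  · simp [lowTerm]
  · rw [lowTerm, lowTerm, invCoef_mul_invCoef_swap π hij,
      invCoef_mul_invCoef_swap π (Ne.symm hij)]
    simp
  · rw [← D.lowTerm_three_term α π a hij h1 h2, ← D.lowTerm_three_term α π a (Ne.symm hij) h2 h1]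
    abel

/-- Leading parts commute with each other and so do low parts. The error of a mixed commutator is
symmetric in `i` and `j`, as both its coefficient and its difference of terms change sign, so the
two mixed errors cancel. -/
theorem mulX_comm (i j : Fin n) : D.mulX j ∘ₗ D.mulX i = D.mulX i ∘ₗ D.mulX j := by
  by_cases hij : i = j
  · rw [hij]
  refine regular_hom_ext fun α π a => ?_
  have h1 := LinearMap.congr_fun (D.mulLead_comm i j) (Finsupp.single (α, π) a)
  have h2 := LinearMap.congr_fun (D.mulLow_comm i j) (Finsupp.single (α, π) a)
  have h3 := D.mulLead_mulLow α π a i j hij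
  have h4 := D.mulLead_mulLow α π a j i (Ne.symm hij)
  simp only [LinearMap.comp_apply] at h1 h2
  simp only [mulX, LinearMap.comp_apply, LinearMap.add_apply, map_add]
  rw [h1, h2, h3, h4, invCoef_swap π hij, swap_comm i j]
  simp only [smul_sub, neg_smul]
  abel

theorem mulX_mulTensor (b : S) (i : Fin n) :
    D.mulX i ∘ₗ D.mulTensor b = D.mulTensor (D.ψ i b) ∘ₗ D.mulX i := by
  refine regular_hom_ext fun α π a => ?_
  simp only [LinearMap.comp_apply]
  rw [mulTensor_single, mulX_single, mulX_single, map_add, map_sum, mulTensor_single, map_mul,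
    D.act_ψ]
  congr 1
  refine Finset.sum_congr rfl fun m _ => ?_
  rw [map_zsmul, mulTensor_single]
  by_cases h : m = i
  · simp [h]
  -- The transposition `(π m π i)` produced by `mul_t` is the conjugate of `(m i)` by `π`, and so is
  -- absorbed in the group component.
  rw [mul_assoc, D.mul_t _ _ _ (π.injective.ne h), mul_assoc, ← D.act_ψ, ← AlgHom.mul_apply,
    ← map_mul, Equiv.swap_apply_apply, inv_mul_cancel_right]

theorem mulX_mulPerm (σ : Perm (Fin n)) (i : Fin n) :
    D.mulX i (mulPerm k σ (Finsupp.single (α, π) a)) =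
      mulPerm k σ (D.mulX (σ i) (Finsupp.single (α, π) a)) +
      ∑ m, invCoef σ m i • Finsupp.single (α, π * σ * swap m i)
        (a * D.t (π (σ m)) (π (σ i))) := by
  rw [mulPerm_single, mulX_single, mulX_single, map_add, mulPerm_single, map_sum, add_assoc]
  congr 1
  -- Reindexing by `σ` puts both sums over the same permutations, so that the cocycle rule adds
  -- their coefficients.
  rw [← Equiv.sum_comp σ (fun m => mulPerm k σ _), ← Finset.sum_add_distrib]
  refine Finset.sum_congr rfl fun m _ => ?_
  rw [map_zsmul, mulPerm_single, Equiv.swap_apply_apply]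
  simp only [mul_assoc, inv_mul_cancel, mul_one, ← add_smul]
  rw [invCoef_add_invCoef]
  rfl

/-- An adjacent transposition reverses the order of no pair other than `i, i'`; this is why the
general formula specialises to the defining relations. -/
theorem invCoef_swap_succ {i i' : Fin n} (hi : (i' : ℕ) = i + 1) (m j : Fin n) :
    invCoef (swap i i') m j =
      if m = i' ∧ j = i then -1 else if m = i ∧ j = i' then 1 else 0 := by
  simp only [invCoef, swap_apply_def, Fin.ext_iff, Fin.lt_def]
  split_ifs <;> omega

theorem mulX_mulPerm_of_ne {i i' j : Fin n} (hi : (i' : ℕ) = i + 1) (h : j ≠ i) (h' : j ≠ i') :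
    D.mulX j ∘ₗ mulPerm k (swap i i') = mulPerm k (swap i i') ∘ₗ D.mulX j := by
  refine regular_hom_ext fun α π a => ?_
  rw [LinearMap.comp_apply, mulX_mulPerm, swap_apply_of_ne_of_ne h h', LinearMap.comp_apply]
  simp [invCoef_swap_succ hi, h, h']

theorem mulX_mulPerm_succ {i i' : Fin n} (hi : (i' : ℕ) = i + 1) :
    D.mulX i ∘ₗ mulPerm k (swap i i') =
      mulPerm k (swap i i') ∘ₗ D.mulX i' - D.mulTensor (D.t i i') := by
  refine regular_hom_ext fun α π a => ?_
  have hne : i ≠ i' := by rintro rfl; omega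
  rw [LinearMap.comp_apply, mulX_mulPerm, swap_apply_left, LinearMap.sub_apply,
    LinearMap.comp_apply, Finset.sum_eq_single i']
  · rw [invCoef_swap_succ hi, if_pos ⟨rfl, rfl⟩, swap_apply_right, mulTensor_single, D.act_t,
      mul_assoc, swap_comm i' i, swap_mul_self, mul_one, neg_one_zsmul, sub_eq_add_neg]
  · intro m _ hm
    simp [invCoef_swap_succ hi, hm, hne]
  · simp

/-- The right regular representation. -/
def regularRep : WreathRep D (Module.End k (RegularModule S n))ᵐᵒᵖ where
  -- Right multiplications reverse the order of products, hence the opposite algebra.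
  x i := MulOpposite.op (D.mulX i)
  τ := AlgHom.ofLinearMap
    { toFun := fun b => MulOpposite.op (D.mulTensor b)
      map_add' := fun b c => by
        rw [← MulOpposite.op_add]
        congr 1
        refine regular_hom_ext fun α π a => ?_
        simp [mul_add]
      map_smul' := fun r b => by
        rw [RingHom.id_apply, ← MulOpposite.op_smul]
        congr 1
        refine regular_hom_ext fun α π a => ?_
        simp [-Finsupp.single_mul] }
    (by
      change MulOpposite.op (D.mulTensor 1) = 1
      rw [← MulOpposite.op_one]
      congr 1
      refine regular_hom_ext fun α π a => ?_
      simp)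
    (fun b c => by
      change MulOpposite.op (D.mulTensor (b * c)) =
        MulOpposite.op (D.mulTensor b) * MulOpposite.op (D.mulTensor c)
      rw [← MulOpposite.op_mul]
      congr 1
      refine regular_hom_ext fun α π a => ?_
      simp [-Finsupp.single_mul, Module.End.mul_apply, mul_assoc])
  p :=
    { toFun := fun σ => MulOpposite.op (mulPerm k σ)
      map_one' := by
        rw [← MulOpposite.op_one]
        congr 1
        refine regular_hom_ext fun α π a => ?_
        simp
      map_mul' := fun σ ρ => by
        rw [← MulOpposite.op_mul]
        congr 1
        refine regular_hom_ext fun α π a => ?_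
        simp [Module.End.mul_apply, mul_assoc] }
  x_comm i j := congrArg MulOpposite.op (D.mulX_comm i j)
  τ_x a i := congrArg MulOpposite.op (D.mulX_mulTensor a i)
  p_x_of_ne i i' j hi h h' := congrArg MulOpposite.op (D.mulX_mulPerm_of_ne hi h h')
  p_x i i' hi := congrArg MulOpposite.op (D.mulX_mulPerm_succ hi)
  p_τ σ b := congrArg MulOpposite.op (by
    refine regular_hom_ext fun α π a => ?_
    simp [-Finsupp.single_mul, Module.End.mul_apply])

end WreathDatum

end AffineWreath

end

/-! ## Normal forms and the degree filtration -/

noncomputable section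

namespace AffineWreath

open Equiv

/-! ### Monomials in commuting elements -/

section monomials

variable {A : Type*} [Monoid A]

theorem commute_prod_ofFn_pow {n : ℕ} (y : A) (x : Fin n → A) (h : ∀ i, Commute y (x i))
    (α : Fin n → ℕ) : Commute y (List.ofFn fun i => x i ^ α i).prod := by
  refine Commute.list_prod_right _ _ fun z hz => ?_
  obtain ⟨i, rfl⟩ := (List.mem_ofFn' _ _).1 hz
  exact (h i).pow_right _

theorem prod_ofFn_pow_mul {n : ℕ} (x : Fin n → A) (h : ∀ i j, Commute (x i) (x j))
    (α β : Fin n → ℕ) :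
    (List.ofFn fun i => x i ^ α i).prod * (List.ofFn fun i => x i ^ β i).prod =
      (List.ofFn fun i => x i ^ (α + β) i).prod := by
  induction n with
  | zero => simp
  | succ n ih =>
    have hc := commute_prod_ofFn_pow (x 0) (fun i : Fin n => x i.succ) (fun i => h _ _)
      (fun i => α i.succ)
    simp only [List.ofFn_succ, List.prod_cons]
    have := ih (fun i => x i.succ) (fun i j => h _ _) (fun i => α i.succ) (fun i => β i.succ)
    simp only [Pi.add_apply] at this ⊢
    rw [← this, pow_add, mul_assoc, mul_assoc, ← mul_assoc _ (x 0 ^ β 0),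
      ← (hc.pow_left (β 0)).eq, mul_assoc]

theorem prod_ofFn_pow_single {n : ℕ} (x : Fin n → A) (i : Fin n) (m : ℕ) :
    (List.ofFn fun j => x j ^ (Pi.single i m : Fin n → ℕ) j).prod = x i ^ m := by
  induction n with
  | zero => exact i.elim0
  | succ n ih =>
    rw [List.ofFn_succ, List.prod_cons]
    induction i using Fin.cases with
    | zero =>
      rw [List.prod_eq_one, Pi.single_eq_same, mul_one]
      intro z hz
      obtain ⟨j, rfl⟩ := (List.mem_ofFn' _ _).1 hz
      simp
    | succ i =>
      rw [Pi.single_eq_of_ne (Fin.succ_ne_zero i).symm, pow_zero, one_mul,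
        ← ih (fun j => x j.succ) i]
      simp [Pi.single_apply]

end monomials

/-- The relations move only adjacent transpositions past the variables, so statements on all
permutations are proved along words in these. -/
theorem perm_induction {n : ℕ} {P : Perm (Fin n) → Prop} (one : P 1)
    (mul : ∀ (i i' : Fin n) (σ : Perm (Fin n)), (i' : ℕ) = i + 1 → P σ → P (swap i i' * σ))
    (π : Perm (Fin n)) : P π := by
  cases n with
  | zero => rwa [Subsingleton.elim π 1]
  | succ n =>
    have h : π ∈ Submonoid.closure (Set.range fun i : Fin n => swap i.castSucc i.succ) := by
      rw [Perm.mclosure_swap_castSucc_succ]; trivial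
    induction h using Submonoid.closure_induction_left with
    | one => exact one
    | mul_left s hs σ _ ih =>
      obtain ⟨i, rfl⟩ := hs
      exact mul _ _ _ (by simp) ih

namespace WreathRep

open WreathDatum

variable {k S : Type*} [CommRing k] [Ring S] [Algebra k S] {n : ℕ} {D : WreathDatum k S n}
variable {A : Type*} [Ring A] [Algebra k A] (R : WreathRep D A)

/-- The monomial `x^α`. -/
def mon (α : Fin n → ℕ) : A := (List.ofFn fun i => R.x i ^ α i).prod

theorem mon_mul_mon (α β : Fin n → ℕ) : R.mon α * R.mon β = R.mon (α + β) :=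
  prod_ofFn_pow_mul R.x R.x_comm α β

@[simp] theorem mon_zero : R.mon 0 = 1 :=
  List.prod_eq_one fun z hz => by
    obtain ⟨j, rfl⟩ := (List.mem_ofFn' _ _).1 hz
    simp

theorem mon_single (i : Fin n) (m : ℕ) : R.mon (Pi.single i m) = R.x i ^ m :=
  prod_ofFn_pow_single R.x i m

theorem x_mul_mon (i : Fin n) (α : Fin n → ℕ) :
    R.x i * R.mon α = R.mon (α + Pi.single i 1) := by
  rw [← pow_one (R.x i), ← mon_single, mon_mul_mon, add_comm]

theorem exists_add_single {α : Fin n → ℕ} (h : ∑ i, α i ≠ 0) :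
    ∃ (β : Fin n → ℕ) (i : Fin n), α = β + Pi.single i 1 ∧ ∑ i, α i = ∑ i, β i + 1 := by
  obtain ⟨i, -, hi⟩ := Finset.exists_ne_zero_of_sum_ne_zero h
  have hα : α = α - Pi.single i 1 + Pi.single i 1 := by
    refine (tsub_add_cancel_of_le fun j => ?_).symm
    by_cases hj : j = i
    · subst hj; simp; omega
    · simp [hj]
  refine ⟨α - Pi.single i 1, i, hα, ?_⟩
  conv_lhs => rw [hα]
  simp [Finset.sum_add_distrib]

/-- Each variable passed applies its `ψ_i` to the coefficient; later arguments need only that some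
coefficient results. -/
theorem τ_mul_mon (α : Fin n → ℕ) : ∀ a, ∃ b, R.τ a * R.mon α = R.mon α * R.τ b := by
  induction h : ∑ i, α i generalizing α with
  | zero =>
    obtain rfl : α = 0 := by
      ext i
      exact (Finset.sum_eq_zero_iff.1 h) i (Finset.mem_univ _)
    exact fun a => ⟨a, by simp⟩
  | succ d ih =>
    obtain ⟨β, i, rfl, hs⟩ := exists_add_single (α := α) (by omega)
    intro a
    obtain ⟨b, hb⟩ := ih β (by omega) (D.ψ i a)
    exact ⟨b, by rw [← x_mul_mon, ← mul_assoc, τ_x, mul_assoc, hb, mul_assoc]⟩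

/-- The linear map from the regular module to `A` which sends `single (α, π) a` to `x^α a π`. -/
def normal : RegularModule S n →ₗ[k] A :=
  Finsupp.lsum k fun q =>
    (LinearMap.mulRight k (R.p q.2) ∘ₗ LinearMap.mulLeft k (R.mon q.1)) ∘ₗ R.τ.toLinearMap

@[simp] theorem normal_single (α : Fin n → ℕ) (π : Perm (Fin n)) (a : S) :
    R.normal (Finsupp.single (α, π) a) = R.mon α * R.τ a * R.p π := by
  simp [normal]

/-! ### The filtration by degree in the variables -/

/-- The span of the elements `x^α a π` with `|α| < m`. -/
def fil (m : ℕ) : Submodule k A :=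
  Submodule.span k {z | ∃ α a π, ∑ i, α i < m ∧ R.mon α * R.τ a * R.p π = z}

theorem mem_fil {m : ℕ} {α : Fin n → ℕ} (h : ∑ i, α i < m) (a : S) (π : Perm (Fin n)) :
    R.mon α * R.τ a * R.p π ∈ R.fil m :=
  Submodule.subset_span ⟨α, a, π, h, rfl⟩

theorem fil_mono {m m' : ℕ} (h : m ≤ m') : R.fil m ≤ R.fil m' :=
  Submodule.span_mono fun _ ⟨α, a, π, h1, h2⟩ => ⟨α, a, π, h1.trans_le h, h2⟩

theorem fil_le {m : ℕ} {N : Submodule k A}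
    (h : ∀ α a π, ∑ i, α i < m → R.mon α * R.τ a * R.p π ∈ N) : R.fil m ≤ N :=
  Submodule.span_le.2 fun _ ⟨α, a, π, h1, h2⟩ => h2 ▸ h α a π h1

theorem mul_mem_of_mem_fil {m : ℕ} {N : Submodule k A} {y : A}
    (h : ∀ α a π, ∑ i, α i < m → y * (R.mon α * R.τ a * R.p π) ∈ N) {z : A}
    (hz : z ∈ R.fil m) : y * z ∈ N :=
  R.fil_le (N := N.comap (LinearMap.mulLeft k y)) h hz

theorem mem_of_mem_fil_mul {m : ℕ} {N : Submodule k A} {y : A}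
    (h : ∀ α a π, ∑ i, α i < m → R.mon α * R.τ a * R.p π * y ∈ N) {z : A}
    (hz : z ∈ R.fil m) : z * y ∈ N :=
  R.fil_le (N := N.comap (LinearMap.mulRight k y)) h hz

theorem mon_mem_fil {m : ℕ} {α : Fin n → ℕ} (h : ∑ i, α i < m) : R.mon α ∈ R.fil m := by
  simpa using R.mem_fil h 1 1

theorem x_pow_mem_fil (i : Fin n) {m d : ℕ} (h : d < m) : R.x i ^ d ∈ R.fil m := by
  rw [← mon_single]
  exact R.mon_mem_fil (by simpa using h)

theorem τ_mul_p_mem_fil {m : ℕ} (h : 0 < m) (a : S) (π : Perm (Fin n)) :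
    R.τ a * R.p π ∈ R.fil m := by
  simpa using R.mem_fil (α := 0) (by simpa using h) a π

theorem τ_mem_fil {m : ℕ} (h : 0 < m) (a : S) : R.τ a ∈ R.fil m := by
  simpa using R.τ_mul_p_mem_fil h a 1

theorem p_mem_fil {m : ℕ} (h : 0 < m) (π : Perm (Fin n)) : R.p π ∈ R.fil m := by
  simpa using R.τ_mul_p_mem_fil h 1 π

theorem x_mul_mem_fil (i : Fin n) {m : ℕ} {z : A} (hz : z ∈ R.fil m) :
    R.x i * z ∈ R.fil (m + 1) := by
  refine R.mul_mem_of_mem_fil (fun α a π h => ?_) hz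
  rw [mul_assoc, ← mul_assoc, x_mul_mon, ← mul_assoc]
  exact R.mem_fil (by simpa [Finset.sum_add_distrib] using h) _ _

theorem mon_mul_mem_fil (α : Fin n → ℕ) {m : ℕ} {z : A} (hz : z ∈ R.fil m) :
    R.mon α * z ∈ R.fil (∑ i, α i + m) := by
  refine R.mul_mem_of_mem_fil (fun β a π h => ?_) hz
  rw [mul_assoc, ← mul_assoc, mon_mul_mon, ← mul_assoc]
  exact R.mem_fil (by simpa [Finset.sum_add_distrib] using h) _ _

theorem x_pow_mul_mem_fil (i : Fin n) (d : ℕ) {m : ℕ} {z : A} (hz : z ∈ R.fil m) :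
    R.x i ^ d * z ∈ R.fil (d + m) := by
  rw [← mon_single]
  simpa using R.mon_mul_mem_fil (Pi.single i d) hz

theorem τ_mul_mem_fil (b : S) {m : ℕ} {z : A} (hz : z ∈ R.fil m) : R.τ b * z ∈ R.fil m := by
  refine R.mul_mem_of_mem_fil (fun α a π h => ?_) hz
  obtain ⟨c, hc⟩ := R.τ_mul_mon α b
  rw [mul_assoc, ← mul_assoc, hc, mul_assoc, ← mul_assoc (R.τ c), ← map_mul, ← mul_assoc]
  exact R.mem_fil h _ _

theorem mem_fil_mul_p (σ : Perm (Fin n)) {m : ℕ} {z : A} (hz : z ∈ R.fil m) :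
    z * R.p σ ∈ R.fil m := by
  refine R.mem_of_mem_fil_mul (fun α a π h => ?_) hz
  rw [mul_assoc, ← map_mul]
  exact R.mem_fil h _ _

theorem exists_p_simple_mul_x {i i' : Fin n} (hi : (i' : ℕ) = i + 1) (j : Fin n) :
    ∃ c : S, R.p (swap i i') * R.x j = R.x (swap i i' j) * R.p (swap i i') + R.τ c := by
  by_cases h : j = i
  · subst h
    exact ⟨-D.t j i', by rw [R.p_x j i' hi, swap_apply_left, map_neg, sub_eq_add_neg]⟩
  by_cases h' : j = i'
  · subst h'
    refine ⟨D.t j i, ?_⟩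
    -- The value of `s_i x_{i+1}` is not a defining relation: it comes from the one for `s_i x_i` by
    -- multiplying with `s_i` on both sides.
    have h1 := congrArg (fun z => R.p (swap i j) * z * R.p (swap i j)) (R.p_x i j hi)
    have h2 : R.p (swap i j) * R.p (swap i j) = 1 := by rw [← map_mul, swap_mul_self, map_one]
    simp only [mul_sub, sub_mul, ← mul_assoc, h2, one_mul] at h1
    rw [mul_assoc _ (R.p _) (R.p _), h2, mul_one, p_τ, mul_assoc, h2, mul_one, D.act_t,
      swap_apply_left, swap_apply_right] at h1
    rw [swap_apply_right, h1, sub_add_cancel]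
  · exact ⟨0, by rw [R.p_x_of_ne i i' j hi h h', swap_apply_of_ne_of_ne h h', map_zero, add_zero]⟩

theorem p_simple_mul_mem_fil {i i' : Fin n} (hi : (i' : ℕ) = i + 1) {m : ℕ} {z : A}
    (hz : z ∈ R.fil m) : R.p (swap i i') * z ∈ R.fil m := by
  refine R.mul_mem_of_mem_fil (fun α a π h => ?_) hz
  -- Induction on the degree: moving the transposition past one variable leaves a coefficient in
  -- front of a monomial of smaller degree.
  induction m generalizing z α with
  | zero => omega
  | succ m ih =>
    by_cases h0 : ∑ i, α i = 0
    · obtain rfl : α = 0 := by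
        ext i
        exact (Finset.sum_eq_zero_iff.1 h0) i (Finset.mem_univ _)
      rw [mon_zero, one_mul, ← mul_assoc, p_τ, mul_assoc, ← map_mul]
      exact R.τ_mul_p_mem_fil (by omega) _ _
    obtain ⟨β, j, rfl, hs⟩ := exists_add_single h0
    obtain ⟨c, hc⟩ := R.exists_p_simple_mul_x hi j
    have h1 : ∑ i, β i < m := by omega
    rw [← x_mul_mon, mul_assoc, mul_assoc, ← mul_assoc, hc, add_mul, mul_assoc, ← mul_assoc]
    refine add_mem ?_ ?_
    · rw [mul_assoc, ← mul_assoc (R.mon β)]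
      -- The induction hypothesis also asks for a member of the filtration that its conclusion does
      -- not mention; zero serves.
      exact R.x_mul_mem_fil _ (ih (zero_mem _) β h1)
    · rw [← mul_assoc (R.mon β)]
      exact R.fil_mono m.le_succ (R.τ_mul_mem_fil _ (R.mem_fil h1 _ _))

theorem p_mul_mem_fil (σ : Perm (Fin n)) {m : ℕ} {z : A} (hz : z ∈ R.fil m) :
    R.p σ * z ∈ R.fil m := by
  induction σ using perm_induction generalizing z with
  | one => simpa using hz
  | mul i i' σ hi ih =>
    rw [map_mul, mul_assoc]
    exact R.p_simple_mul_mem_fil hi (ih hz)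

/-- The bound in `fil` is strict, so `fil 1` is the span of the elements `a π`: the error has degree
zero in the variables. -/
theorem p_mul_x_sub_mem_fil (σ : Perm (Fin n)) (j : Fin n) :
    R.p σ * R.x j - R.x (σ j) * R.p σ ∈ R.fil 1 := by
  induction σ using perm_induction with
  | one => simp
  | mul i i' σ hi ih =>
    obtain ⟨c, hc⟩ := R.exists_p_simple_mul_x hi (σ j)
    have h : R.p (swap i i' * σ) * R.x j - R.x ((swap i i' * σ) j) * R.p (swap i i' * σ) =
        R.p (swap i i') * (R.p σ * R.x j - R.x (σ j) * R.p σ) + R.τ c * R.p σ := by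
      rw [mul_sub, ← mul_assoc _ (R.x (σ j)), hc, map_mul, Perm.mul_apply]
      noncomm_ring
    rw [h]
    exact add_mem (R.p_mul_mem_fil _ ih) (R.τ_mul_p_mem_fil one_pos _ _)

/-- A Leibniz rule: peeling off one factor at a time, each step costs one variable. -/
theorem p_mul_x_pow_sub_mem_fil (σ : Perm (Fin n)) (j : Fin n) (d : ℕ) :
    R.p σ * R.x j ^ d - R.x (σ j) ^ d * R.p σ ∈ R.fil d := by
  induction d with
  | zero => simp
  | succ d ih =>
    have h : R.p σ * R.x j ^ (d + 1) - R.x (σ j) ^ (d + 1) * R.p σ =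
        (R.p σ * R.x j - R.x (σ j) * R.p σ) * R.x j ^ d +
          R.x (σ j) * (R.p σ * R.x j ^ d - R.x (σ j) ^ d * R.p σ) := by
      rw [pow_succ', pow_succ']
      noncomm_ring
    rw [h]
    refine add_mem (R.mem_of_mem_fil_mul (fun α a π hα => ?_) (R.p_mul_x_sub_mem_fil σ j))
      (R.x_mul_mem_fil _ ih)
    obtain rfl : α = 0 := by
      ext i
      exact (Finset.sum_eq_zero_iff.1 (Nat.lt_one_iff.1 hα)) i (Finset.mem_univ _)
    rw [mon_zero, one_mul, mul_assoc]
    exact R.τ_mul_mem_fil _ (R.p_mul_mem_fil _ (R.x_pow_mem_fil _ d.lt_succ_self))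

/-- Degrees at most `m - 1` and `m'` add up to less than `m + m'`; the strict bound explains the
offset on one side only. -/
theorem mem_fil_mul_mem_fil {m m' : ℕ} {y z : A} (hy : y ∈ R.fil m) (hz : z ∈ R.fil (m' + 1)) :
    y * z ∈ R.fil (m + m') := by
  refine R.mem_of_mem_fil_mul (fun α a π hα => ?_) hy
  rw [mul_assoc, mul_assoc]
  exact R.fil_mono (by omega) (R.mon_mul_mem_fil α (R.τ_mul_mem_fil a (R.p_mul_mem_fil π hz)))

/-- The union of the filtration contains `1` and is stable under left multiplication by the
generators, hence by the algebra they generate. -/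
theorem range_normal_eq_top
    (hgen : Algebra.adjoin k (Set.range R.x ∪ Set.range R.τ ∪ Set.range R.p) = ⊤) (y : A) :
    ∃ m, y ∈ R.fil m := by
  suffices ∀ z, ∀ m, z ∈ R.fil m → ∃ m', y * z ∈ R.fil m' by
    simpa using this 1 1 (by simpa using R.τ_mem_fil one_pos 1)
  have hy : y ∈ Algebra.adjoin k (Set.range R.x ∪ Set.range R.τ ∪ Set.range R.p) := by
    rw [hgen]; trivial
  induction hy using Algebra.adjoin_induction with
  | mem y hy =>
    intro z m hz
    rcases hy with (⟨i, rfl⟩ | ⟨a, rfl⟩) | ⟨σ, rfl⟩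
    · exact ⟨_, R.x_mul_mem_fil i hz⟩
    · exact ⟨_, R.τ_mul_mem_fil a hz⟩
    · exact ⟨_, R.p_mul_mem_fil σ hz⟩
  | algebraMap r =>
    intro z m hz
    exact ⟨m, by rw [← Algebra.smul_def]; exact Submodule.smul_mem _ _ hz⟩
  | add y y' _ _ h h' =>
    intro z m hz
    obtain ⟨m1, h1⟩ := h z m hz
    obtain ⟨m2, h2⟩ := h' z m hz
    exact ⟨max m1 m2, by
      rw [add_mul]
      exact add_mem (R.fil_mono (le_max_left _ _) h1) (R.fil_mono (le_max_right _ _) h2)⟩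
  | mul y y' _ _ h h' =>
    intro z m hz
    obtain ⟨m1, h1⟩ := h' z m hz
    obtain ⟨m2, h2⟩ := h _ m1 h1
    exact ⟨m2, by rwa [mul_assoc]⟩

theorem fil_le_range_normal (m : ℕ) : R.fil m ≤ LinearMap.range R.normal :=
  R.fil_le fun α a π _ => ⟨_, R.normal_single α π a⟩

/-! ### Independence through the regular representation -/

/-- A compatible homomorphism to the algebra of operators of the right regular
representation. -/
structure RegularHom where
  φ : A →ₐ[k] (Module.End k (RegularModule S n))ᵐᵒᵖ
  φ_x : ∀ i, φ (R.x i) = D.regularRep.x i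
  φ_τ : ∀ a, φ (R.τ a) = D.regularRep.τ a
  φ_p : ∀ π, φ (R.p π) = D.regularRep.p π

variable {R} (H : R.RegularHom)

/-- The image of `1` under the right action of an element. -/
def RegularHom.orbit : A →ₗ[k] RegularModule S n where
  toFun y := (H.φ y).unop (Finsupp.single (0, 1) 1)
  map_add' y z := by simp
  map_smul' r y := by simp

theorem RegularHom.orbit_mul_x (y : A) (i : Fin n) :
    H.orbit (y * R.x i) = D.mulX i (H.orbit y) := by
  simp [orbit, H.φ_x, regularRep]

theorem RegularHom.orbit_mul_τ (y : A) (a : S) :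
    H.orbit (y * R.τ a) = D.mulTensor a (H.orbit y) := by
  simp [orbit, H.φ_τ, regularRep]

theorem RegularHom.orbit_mul_p (y : A) (π : Perm (Fin n)) :
    H.orbit (y * R.p π) = mulPerm k π (H.orbit y) := by
  simp [orbit, H.φ_p, regularRep]

/-- At the identity permutation all correction coefficients vanish, so multiplying by a variable
only raises an exponent. -/
theorem RegularHom.orbit_mon (α : Fin n → ℕ) : H.orbit (R.mon α) = Finsupp.single (α, 1) 1 := by
  induction h : ∑ i, α i generalizing α with
  | zero =>
    obtain rfl : α = 0 := by
      ext i
      exact (Finset.sum_eq_zero_iff.1 h) i (Finset.mem_univ _)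
    simp [orbit]
  | succ d ih =>
    obtain ⟨β, i, rfl, hs⟩ := exists_add_single (α := α) (by omega)
    rw [← mon_mul_mon, mon_single, pow_one, H.orbit_mul_x, ih β (by omega), mulX_single]
    simp

/-- Acting on `1` reads the coefficients off a normal form; this is the linear independence in the
affine algebra. -/
theorem RegularHom.orbit_normal (v : RegularModule S n) : H.orbit (R.normal v) = v := by
  have : H.orbit ∘ₗ R.normal = LinearMap.id := by
    refine regular_hom_ext fun α π a => ?_
    rw [LinearMap.comp_apply, normal_single, H.orbit_mul_p, H.orbit_mul_τ, H.orbit_mon,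
      mulTensor_single, mulPerm_single]
    simp
  exact LinearMap.congr_fun this v

theorem RegularHom.normal_bijective (H : R.RegularHom)
    (hgen : Algebra.adjoin k (Set.range R.x ∪ Set.range R.τ ∪ Set.range R.p) = ⊤) :
    Function.Bijective R.normal :=
  ⟨Function.LeftInverse.injective H.orbit_normal, fun y => by
    obtain ⟨m, hm⟩ := R.range_normal_eq_top hgen y
    exact R.fil_le_range_normal m hm⟩

end WreathRep

end AffineWreath

end

/-! ## Cyclotomic quotients in terms of normal forms -/

noncomputable section

namespace AffineWreath

open Equiv

namespace WreathRep

open WreathDatum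

variable {k S : Type*} [CommRing k] [Ring S] [Algebra k S] {n : ℕ} {D : WreathDatum k S n}
variable {A : Type*} [Ring A] [Algebra k A] {R : WreathRep D A} [NeZero n]

/-- Nothing lies below place `0`, so for `π` fixing it all coefficients `[m < 0] - [π m < 0]`
vanish. The equality is verified in the regular module, to which the algebra maps injectively. -/
theorem RegularHom.p_mul_x_zero (H : R.RegularHom) (hR : Function.Bijective R.normal)
    {π : Perm (Fin n)} (hπ : π 0 = 0) : R.p π * R.x 0 = R.x 0 * R.p π := by
  have hinj : Function.Injective H.orbit := by
    intro y z h
    obtain ⟨v, rfl⟩ := hR.2 y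
    obtain ⟨w, rfl⟩ := hR.2 z
    rw [H.orbit_normal, H.orbit_normal] at h
    rw [h]
  apply hinj
  have h1 : H.orbit (R.p π) = Finsupp.single (0, π) 1 := by
    simpa using H.orbit_normal (Finsupp.single (0, π) 1)
  have h2 : H.orbit (R.x 0) = Finsupp.single (Pi.single 0 1, 1) 1 := by
    simpa [mon_single] using H.orbit_normal (Finsupp.single (Pi.single 0 1, 1) 1)
  have h3 : ∀ m, invCoef π m 0 = 0 := fun m => by simp [invCoef, hπ]
  rw [H.orbit_mul_x, H.orbit_mul_p, h1, h2, mulX_single, mulPerm_single]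
  simp [h3, hπ]

/-! ### Cyclotomic generators and the two-sided ideal -/

variable (R)

/-- The properties of the generator of a cyclotomic ideal of level `d`. -/
structure IsCyclotomic (χ : A) (d : ℕ) : Prop where
  x_mul : ∀ i, R.x i * χ = χ * R.x i
  τ_mul : ∀ a, ∃ b, R.τ a * χ = χ * R.τ b
  p_mul : ∀ π : Perm (Fin n), π 0 = 0 → R.p π * χ = χ * R.p π
  lead_mem : χ - R.x 0 ^ d ∈ R.fil d

/-- The conjugate of `χ` by the transposition `(0 i)`. -/
def conj (χ : A) (i : Fin n) : A := R.p (swap 0 i) * χ * R.p (swap 0 i)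

/-- The span of the elements `χ_i y` with `y` of filtration degree less than `m`. -/
def cyc (χ : A) (m : ℕ) : Submodule k A :=
  Submodule.span k {z | ∃ i, ∃ y ∈ R.fil m, R.conj χ i * y = z}

variable {R}

omit [NeZero n] in
theorem p_swap_mul_self (i j : Fin n) : R.p (swap i j) * R.p (swap i j) = 1 := by
  rw [← map_mul, swap_mul_self, map_one]

theorem conj_mul_mem_cyc (χ : A) (i : Fin n) {m : ℕ} {y : A} (hy : y ∈ R.fil m) :
    R.conj χ i * y ∈ R.cyc χ m := Submodule.subset_span ⟨i, y, hy, rfl⟩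

theorem cyc_le {χ : A} {m : ℕ} {N : Submodule k A}
    (h : ∀ i, ∀ y ∈ R.fil m, R.conj χ i * y ∈ N) : R.cyc χ m ≤ N :=
  Submodule.span_le.2 fun _ ⟨i, y, hy, hz⟩ => hz ▸ h i y hy

theorem mul_mem_of_mem_cyc {χ : A} {m : ℕ} {N : Submodule k A} {u : A}
    (h : ∀ i, ∀ y ∈ R.fil m, u * (R.conj χ i * y) ∈ N) {z : A} (hz : z ∈ R.cyc χ m) :
    u * z ∈ N :=
  cyc_le (N := N.comap (LinearMap.mulLeft k u)) h hz

theorem cyc_mono (χ : A) {m m' : ℕ} (h : m ≤ m') : R.cyc χ m ≤ R.cyc χ m' :=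
  cyc_le fun i _ hy => conj_mul_mem_cyc χ i (R.fil_mono h hy)

theorem mem_cyc_mul_mem_fil {χ : A} {m m' : ℕ} {z y : A} (hz : z ∈ R.cyc χ m)
    (hy : y ∈ R.fil (m' + 1)) : z * y ∈ R.cyc χ (m + m') := by
  refine cyc_le (N := (R.cyc χ (m + m')).comap (LinearMap.mulRight k y)) (fun i u hu => ?_) hz
  rw [Submodule.mem_comap, LinearMap.mulRight_apply, mul_assoc]
  exact conj_mul_mem_cyc χ i (R.mem_fil_mul_mem_fil hu hy)

@[simp] theorem conj_zero (χ : A) : R.conj χ 0 = χ := by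
  rw [conj, swap_self]
  change R.p 1 * χ * R.p 1 = χ
  simp

theorem mem_cyc_one (χ : A) : χ ∈ R.cyc χ 1 := by
  simpa using conj_mul_mem_cyc (R := R) χ 0 (R.p_mem_fil one_pos 1)

namespace IsCyclotomic

variable {χ : A} {d : ℕ} (hχ : R.IsCyclotomic χ d)

include hχ

/-- Factor `π` as the transposition `(0 π 0)` times a permutation fixing `0`, which commutes with
`χ`. -/
theorem p_mul_gen (π : Perm (Fin n)) : R.p π * χ = R.conj χ (π 0) * R.p π := by
  have h : (swap 0 (π 0) * π) 0 = 0 := by simp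
  rw [conj, mul_assoc, ← map_mul, mul_assoc, ← hχ.p_mul _ h, ← mul_assoc, ← map_mul, ← mul_assoc,
    swap_mul_self, one_mul]

theorem p_mul_conj (π : Perm (Fin n)) (i : Fin n) :
    R.p π * R.conj χ i = R.conj χ (π i) * R.p π := by
  rw [conj, ← mul_assoc, ← mul_assoc, ← map_mul, hχ.p_mul_gen, Perm.mul_apply, swap_apply_left,
    mul_assoc, ← map_mul, mul_assoc, swap_mul_self, mul_one]

theorem τ_mul_conj (a : S) (i : Fin n) : ∃ b, R.τ a * R.conj χ i = R.conj χ i * R.τ b := by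
  have h : ∀ c, R.τ c * R.p (swap 0 i) = R.p (swap 0 i) * R.τ (D.act (swap 0 i) c) := by
    intro c
    rw [p_τ, ← AlgHom.mul_apply, ← map_mul, swap_mul_self, map_one, AlgHom.one_apply]
  obtain ⟨b, hb⟩ := hχ.τ_mul (D.act (swap 0 i) a)
  refine ⟨D.act (swap 0 i) b, ?_⟩
  rw [conj, ← mul_assoc, ← mul_assoc, h, mul_assoc _ _ χ, hb, ← mul_assoc, mul_assoc _ (R.τ b), h,
    ← mul_assoc]

theorem τ_mul_mem_cyc (a : S) {m : ℕ} {z : A} (hz : z ∈ R.cyc χ m) : R.τ a * z ∈ R.cyc χ m := by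
  refine mul_mem_of_mem_cyc (fun i y hy => ?_) hz
  obtain ⟨b, hb⟩ := hχ.τ_mul_conj a i
  rw [← mul_assoc, hb, mul_assoc]
  exact conj_mul_mem_cyc χ i (R.τ_mul_mem_fil b hy)

theorem p_mul_mem_cyc (π : Perm (Fin n)) {m : ℕ} {z : A} (hz : z ∈ R.cyc χ m) :
    R.p π * z ∈ R.cyc χ m := by
  refine mul_mem_of_mem_cyc (fun i y hy => ?_) hz
  rw [← mul_assoc, hχ.p_mul_conj, mul_assoc]
  exact conj_mul_mem_cyc χ _ (R.p_mul_mem_fil π hy)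

theorem x_mul_mem_cyc (j : Fin n) {m : ℕ} {z : A} (hz : z ∈ R.cyc χ m) :
    R.x j * z ∈ R.cyc χ (m + 1) := by
  refine mul_mem_of_mem_cyc (fun i y hy => ?_) hz
  have hw := R.p_mul_x_sub_mem_fil (swap 0 i) (swap 0 i j)
  rw [swap_apply_self] at hw
  have hq : R.p (swap 0 i) * y ∈ R.fil m := R.p_mul_mem_fil _ hy
  -- Move `x_j` past the transposition `s = (0 i)`, then past `χ`, with which it commutes. The error
  -- is a sum of terms `a π` in front of `χ`, and `π χ = χ_{π 0} π` brings these back to the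
  -- required form without raising the degree.
  have key : R.x j * (R.conj χ i * y) =
      R.conj χ i * (R.p (swap 0 i) * (R.x (swap 0 i j) * (R.p (swap 0 i) * y))) -
      (R.p (swap 0 i) * R.x (swap 0 i j) - R.x j * R.p (swap 0 i)) *
        (χ * (R.p (swap 0 i) * y)) := by
    simp only [conj, sub_mul, mul_assoc]
    rw [← mul_assoc (R.p (swap 0 i)) (R.p (swap 0 i)), p_swap_mul_self, one_mul,
      ← mul_assoc χ (R.x _), ← hχ.x_mul]
    simp only [mul_assoc]
    rw [sub_sub_cancel]
  rw [key]
  refine sub_mem (conj_mul_mem_cyc χ i (R.p_mul_mem_fil _ (R.x_mul_mem_fil _ hq)))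
    (cyc_mono χ m.le_succ (R.mem_of_mem_fil_mul (fun α a π hα => ?_) hw))
  obtain rfl : α = 0 := by
    ext i
    exact (Finset.sum_eq_zero_iff.1 (Nat.lt_one_iff.1 hα)) i (Finset.mem_univ _)
  rw [mon_zero, one_mul, mul_assoc, ← mul_assoc (R.p π), hχ.p_mul_gen, mul_assoc]
  exact hχ.τ_mul_mem_cyc _ (conj_mul_mem_cyc χ _ (R.p_mul_mem_fil _ hq))

theorem mon_mul_mem_cyc (α : Fin n → ℕ) {m : ℕ} {z : A} (hz : z ∈ R.cyc χ m) :
    R.mon α * z ∈ R.cyc χ (∑ i, α i + m) := by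
  induction h : ∑ i, α i generalizing α with
  | zero =>
    obtain rfl : α = 0 := by
      ext i
      exact (Finset.sum_eq_zero_iff.1 h) i (Finset.mem_univ _)
    simpa using hz
  | succ e ih =>
    obtain ⟨β, i, rfl, hs⟩ := exists_add_single (α := α) (by omega)
    rw [← x_mul_mon, mul_assoc]
    exact cyc_mono χ (by omega) (hχ.x_mul_mem_cyc i (ih β (by omega)))

theorem mem_fil_mul_mem_cyc {m m' : ℕ} {y z : A} (hy : y ∈ R.fil m) (hz : z ∈ R.cyc χ (m' + 1)) :
    y * z ∈ R.cyc χ (m + m') := by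
  refine R.mem_of_mem_fil_mul (fun α a π hα => ?_) hy
  rw [mul_assoc, mul_assoc]
  exact cyc_mono χ (by omega)
    (hχ.mon_mul_mem_cyc α (hχ.τ_mul_mem_cyc a (hχ.p_mul_mem_cyc π hz)))

theorem conj_sub_mem_fil (i : Fin n) : R.conj χ i - R.x i ^ d ∈ R.fil d := by
  have h := R.p_mul_x_pow_sub_mem_fil (swap 0 i) 0 d
  rw [swap_apply_left] at h
  have key : R.conj χ i - R.x i ^ d = R.p (swap 0 i) * (χ - R.x 0 ^ d) * R.p (swap 0 i) +
      (R.p (swap 0 i) * R.x 0 ^ d - R.x i ^ d * R.p (swap 0 i)) * R.p (swap 0 i) := by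
    rw [sub_mul, mul_assoc (R.x i ^ d), p_swap_mul_self, conj]
    noncomm_ring
  rw [key]
  exact add_mem (R.mem_fil_mul_p _ (R.p_mul_mem_fil _ hχ.lead_mem)) (R.mem_fil_mul_p _ h)

theorem x_pow_mul (i : Fin n) (e : ℕ) : R.x i ^ e * χ = χ * R.x i ^ e :=
  Commute.pow_left (hχ.x_mul i) e

/-- Since `χ` commutes with `x_l^d`, only the lower part of `χ_l` contributes to the commutator.
This gains one step over the bound for either product. -/
theorem conj_mul_gen_sub_mem_cyc (l : Fin n) :
    χ * R.conj χ l - R.conj χ l * χ ∈ R.cyc χ d := by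
  have h := hχ.conj_sub_mem_fil l
  have key : χ * R.conj χ l - R.conj χ l * χ =
      R.conj χ 0 * (R.conj χ l - R.x l ^ d) - (R.conj χ l - R.x l ^ d) * χ := by
    rw [conj_zero, mul_sub, sub_mul, hχ.x_pow_mul, sub_sub_sub_cancel_right]
  rw [key]
  have h' := hχ.mem_fil_mul_mem_cyc (m' := 0) h (mem_cyc_one χ)
  exact sub_mem (conj_mul_mem_cyc χ 0 h) h'

/-- Conjugation by `(0 i)` reduces to the commutator of `χ` with a conjugate. -/
theorem conj_mul_conj_sub_mem_cyc (i j : Fin n) :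
    R.conj χ i * R.conj χ j - R.conj χ j * R.conj χ i ∈ R.cyc χ d := by
  have hj : R.conj χ j = R.p (swap 0 i) * R.conj χ (swap 0 i j) * R.p (swap 0 i) := by
    rw [hχ.p_mul_conj, swap_apply_self, mul_assoc, p_swap_mul_self, mul_one]
  have key : R.conj χ i * R.conj χ j - R.conj χ j * R.conj χ i =
      R.p (swap 0 i) * (χ * R.conj χ (swap 0 i j) - R.conj χ (swap 0 i j) * χ) *
        R.p (swap 0 i) := by
    have hi : R.conj χ i = R.p (swap 0 i) * χ * R.p (swap 0 i) := rfl
    rw [hj, hi]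
    generalize R.conj χ (swap 0 i j) = y
    have h1 : ∀ u v, R.p (swap 0 i) * u * R.p (swap 0 i) * (R.p (swap 0 i) * v * R.p (swap 0 i)) =
        R.p (swap 0 i) * (u * v) * R.p (swap 0 i) := by
      intro u v
      have := congrArg (fun w => R.p (swap 0 i) * u * w * v * R.p (swap 0 i))
        (p_swap_mul_self (R := R) 0 i)
      simpa only [mul_assoc, mul_one, one_mul] using this
    rw [h1, h1, mul_sub, sub_mul]
  rw [key]
  simpa using mem_cyc_mul_mem_fil (hχ.p_mul_mem_cyc _ (hχ.conj_mul_gen_sub_mem_cyc _))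
    (m' := 0) (R.p_mem_fil one_pos _)

/-- The two-sided ideal generated by `χ` lies in the union of the `cyc χ m`. -/
theorem exists_mem_cyc (hR : Function.Bijective R.normal) {z : A}
    (hz : z ∈ TwoSidedIdeal.span {χ}) : ∃ m, z ∈ R.cyc χ m := by
  have hfil : ∀ y : A, ∃ m, y ∈ R.fil (m + 1) := by
    intro y
    obtain ⟨v, rfl⟩ := hR.2 y
    induction v using Finsupp.induction_linear with
    | zero => exact ⟨0, by simp⟩
    | add v w hv hw =>
      obtain ⟨m, hm⟩ := hv
      obtain ⟨m', hm'⟩ := hw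
      refine ⟨max m m', ?_⟩
      rw [map_add]
      exact add_mem (R.fil_mono (by omega) hm) (R.fil_mono (by omega) hm')
    | single q a => exact ⟨_, R.normal_single q.1 q.2 a ▸ R.mem_fil (Nat.lt_succ_self _) _ _⟩
  let I : TwoSidedIdeal A := TwoSidedIdeal.mk' {z | ∃ m, z ∈ R.cyc χ m} ⟨0, zero_mem _⟩
    (fun ⟨m, hm⟩ ⟨m', hm'⟩ => ⟨max m m', add_mem (cyc_mono χ (le_max_left _ _) hm)
      (cyc_mono χ (le_max_right _ _) hm')⟩)
    (fun ⟨m, hm⟩ => ⟨m, neg_mem hm⟩)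
    (fun {y z} ⟨m, hm⟩ => by
      obtain ⟨m', hy⟩ := hfil y
      exact ⟨m' + 1 + m, hχ.mem_fil_mul_mem_cyc hy (cyc_mono χ m.le_succ hm)⟩)
    (fun {z y} ⟨m, hm⟩ => by
      obtain ⟨m', hy⟩ := hfil y
      exact ⟨m + m', mem_cyc_mul_mem_fil hm hy⟩)
  have hI : z ∈ I := TwoSidedIdeal.mem_span_iff.1 hz I
    (Set.singleton_subset_iff.2 ((TwoSidedIdeal.mem_mk' _ _ _ _ _ _ _).2 ⟨1, mem_cyc_one χ⟩))
  simpa only [I, TwoSidedIdeal.mem_mk', Set.mem_ofPred_eq] using hI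

omit hχ in
theorem mem_span_of_mem_cyc {m : ℕ} {z : A} (hz : z ∈ R.cyc χ m) :
    z ∈ TwoSidedIdeal.span {χ} := by
  induction hz using Submodule.span_induction with
  | mem z h =>
    obtain ⟨i, y, -, rfl⟩ := h
    exact TwoSidedIdeal.mul_mem_right _ _ _ (TwoSidedIdeal.mul_mem_right _ _ _
      (TwoSidedIdeal.mul_mem_left _ _ _ (TwoSidedIdeal.subset_span rfl)))
  | zero => exact zero_mem _
  | add y z _ _ hy hz => exact add_mem hy hz
  | smul r z _ hz =>
    rw [Algebra.smul_def]
    exact TwoSidedIdeal.mul_mem_left _ _ _ hz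

end IsCyclotomic

/-! ### The triangular change of basis -/

/-- The index `i` is the last one with `d ≤ α_i`. -/
def IsLastIndex (d : ℕ) (α : Fin n → ℕ) (i : Fin n) : Prop := d ≤ α i ∧ ∀ j, i < j → α j < d

omit [NeZero n] in
theorem IsLastIndex.eq {d : ℕ} {α : Fin n → ℕ} {i j : Fin n} (hi : IsLastIndex d α i)
    (hj : IsLastIndex d α j) : i = j :=
  le_antisymm (not_lt.1 fun h => (hj.2 i h).not_ge hi.1) (not_lt.1 fun h => (hi.2 j h).not_ge hj.1)

open Classical in
/-- The linear map which sends `single (α, π) a` to `x^α a π` if all `α_i` are less than `d`, and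
to `χ_i x^{α - d e_i} a π` if `i` is the last index with `d ≤ α_i`. -/
def cycNormal (R : WreathRep D A) (χ : A) (d : ℕ) : RegularModule S n →ₗ[k] A :=
  Finsupp.lsum k fun q =>
    if h : ∃ i, IsLastIndex d q.1 i then
      LinearMap.mulLeft k (R.conj χ h.choose) ∘ₗ R.normal ∘ₗ
        Finsupp.lsingle (q.1 - Pi.single h.choose d, q.2)
    else R.normal ∘ₗ Finsupp.lsingle q

theorem cycNormal_of_lt {χ : A} {d : ℕ} {α : Fin n → ℕ} (h : ∀ i, α i < d) (π : Perm (Fin n))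
    (a : S) : R.cycNormal χ d (Finsupp.single (α, π) a) = R.mon α * R.τ a * R.p π := by
  have h' : ¬∃ i, IsLastIndex d α i := fun ⟨i, hi⟩ => (h i).not_ge hi.1
  rw [cycNormal, Finsupp.lsum_single, dif_neg h', LinearMap.comp_apply, Finsupp.lsingle_apply,
    normal_single]

theorem cycNormal_add_single {χ : A} {d : ℕ} {α : Fin n → ℕ} {i : Fin n}
    (h : ∀ j, i < j → α j < d) (π : Perm (Fin n)) (a : S) :
    R.cycNormal χ d (Finsupp.single (α + Pi.single i d, π) a) =
      R.conj χ i * (R.mon α * R.τ a * R.p π) := by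
  have hi : IsLastIndex d (α + Pi.single i d) i :=
    ⟨by simp, fun j hj => by simpa [Pi.single_eq_of_ne hj.ne'] using h j hj⟩
  have h' : ∃ j, IsLastIndex d (α + Pi.single i d) j := ⟨i, hi⟩
  have hc : h'.choose = i := h'.choose_spec.eq hi
  rw [cycNormal, Finsupp.lsum_single, dif_pos h', LinearMap.comp_apply, LinearMap.comp_apply,
    Finsupp.lsingle_apply, normal_single, LinearMap.mulLeft_apply, hc, add_tsub_cancel_right]

omit [NeZero n] in
theorem exists_add_single_of_le {d : ℕ} {α : Fin n → ℕ} {i : Fin n} (h : d ≤ α i) :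
    ∃ β : Fin n → ℕ, α = β + Pi.single i d := by
  refine ⟨α - Pi.single i d, (tsub_add_cancel_of_le fun j => ?_).symm⟩
  by_cases hj : j = i
  · subst hj; simpa using h
  · simp [hj]

omit [NeZero n] in
-- The predicate allows two uses: the last large exponent among all indices, and the last one beyond
-- a given index.
theorem exists_last {d : ℕ} {α : Fin n → ℕ} (P : Fin n → Prop) (h : ∃ i, P i ∧ d ≤ α i) :
    ∃ i, P i ∧ (∀ j, i < j → P j → α j < d) ∧ ∃ β : Fin n → ℕ, α = β + Pi.single i d := by
  classical
  let s : Finset (Fin n) := Finset.univ.filter fun i => P i ∧ d ≤ α i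
  have hs : s.Nonempty := by
    obtain ⟨i, hi⟩ := h
    exact ⟨i, by simp [s, hi]⟩
  have hm := s.max'_mem hs
  simp only [s, Finset.mem_filter] at hm
  refine ⟨_, hm.2.1, fun j hj hP => ?_, exists_add_single_of_le hm.2.2⟩
  by_contra hlt
  exact hj.not_ge (s.le_max' j (by simp [s, hP, not_lt.1 hlt]))

namespace IsCyclotomic

variable {χ : A} {d : ℕ} (hχ : R.IsCyclotomic χ d)

include hχ

/-- Unitriangularity: `χ_i` differs from `x_i^d` by lower terms. Surjectivity and injectivity of
`cycNormal` both come from this. -/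
theorem cycNormal_sub_normal_mem_fil (α : Fin n → ℕ) (π : Perm (Fin n)) (a : S) :
    R.cycNormal χ d (Finsupp.single (α, π) a) - R.normal (Finsupp.single (α, π) a) ∈
      R.fil (∑ i, α i) := by
  by_cases h : ∃ i, True ∧ d ≤ α i
  · obtain ⟨i, -, hi, β, rfl⟩ := exists_last _ h
    have hβ : ∀ j, i < j → β j < d := fun j hj => by
      simpa [Pi.single_eq_of_ne hj.ne'] using hi j hj trivial
    rw [cycNormal_add_single hβ, normal_single, add_comm β, ← mon_mul_mon, mon_single, mul_assoc,
      mul_assoc (R.x i ^ d * _), mul_assoc (R.x i ^ d), ← sub_mul, ← mul_assoc]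
    simp only [Pi.add_apply, Finset.sum_add_distrib, Finset.sum_pi_single', Finset.mem_univ,
      if_true]
    rw [mul_assoc]
    refine R.mem_fil_mul_mem_fil (hχ.conj_sub_mem_fil i) ?_
    rw [← mul_assoc]
    exact R.mem_fil (Nat.lt_succ_self _) _ _
  · rw [cycNormal_of_lt (fun i => not_le.1 fun hi => h ⟨i, trivial, hi⟩), normal_single, sub_self]
    exact zero_mem _

theorem fil_le_range_cycNormal (m : ℕ) : R.fil m ≤ LinearMap.range (R.cycNormal χ d) := by
  induction m with
  | zero => exact R.fil_le fun α a π h => absurd h (Nat.not_lt_zero _)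
  | succ m ih =>
    refine R.fil_le fun α a π h => ?_
    have h1 := ih (R.fil_mono (Nat.le_of_lt_succ h) (hχ.cycNormal_sub_normal_mem_fil α π a))
    rw [← normal_single, ← sub_sub_cancel (R.cycNormal χ d (Finsupp.single (α, π) a))
      (R.normal (Finsupp.single (α, π) a))]
    exact sub_mem ⟨_, rfl⟩ h1

theorem cycNormal_surjective (hR : Function.Bijective R.normal) :
    Function.Surjective (R.cycNormal χ d) := by
  intro y
  obtain ⟨v, rfl⟩ := hR.2 y
  change R.normal v ∈ LinearMap.range (R.cycNormal χ d)
  induction v using Finsupp.induction_linear with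
  | zero => rw [map_zero]; exact zero_mem _
  | add v w hv hw => rw [map_add]; exact add_mem hv hw
  | single q a =>
    exact hχ.fil_le_range_cycNormal (∑ i, q.1 i + 1)
      (R.normal_single q.1 q.2 a ▸ R.mem_fil (Nat.lt_succ_self _) _ _)

theorem cycNormal_injective (hR : Function.Bijective R.normal) :
    Function.Injective (R.cycNormal χ d) := by
  rw [injective_iff_map_eq_zero]
  intro v hv
  -- Descent on the degree: an element of the kernel equals the negative of its own error terms, so
  -- its top degree part vanishes.
  have key : ∀ m, v ∈ Finsupp.supported S k {q : (Fin n → ℕ) × Perm (Fin n) | ∑ i, q.1 i < m} →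
      v = 0 := by
    intro m
    induction m with
    | zero => intro h; simpa [Finsupp.mem_supported] using h
    | succ m ih =>
      intro h
      refine ih ?_
      have h1 : R.normal v ∈ R.fil m := by
        rw [← sub_zero (R.normal v), ← hv, ← LinearMap.sub_apply, ← Finsupp.sum_single v,
          Finsupp.sum, map_sum]
        refine sum_mem fun q hq => ?_
        have h2 := hχ.cycNormal_sub_normal_mem_fil q.1 q.2 (v q)
        rw [LinearMap.sub_apply, ← neg_sub]
        exact neg_mem (R.fil_mono (Nat.le_of_lt_succ (h hq)) h2)
      have h3 : R.fil m ≤ (Finsupp.supported S k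
          {q : (Fin n → ℕ) × Perm (Fin n) | ∑ i, q.1 i < m}).map R.normal :=
        R.fil_le fun α a π hα => ⟨_, Finsupp.single_mem_supported k _ hα, R.normal_single α π a⟩
      obtain ⟨w, hw, hwv⟩ := h3 h1
      rwa [← hR.1 hwv]
  refine key (v.support.sup (fun q => ∑ i, q.1 i) + 1) fun q hq => ?_
  exact Nat.lt_succ_of_le (Finset.le_sup (f := fun q : (Fin n → ℕ) × Perm (Fin n) => ∑ i, q.1 i) hq)

/-- An element `χ_i x^α a π` is a new basis element unless some later exponent is at least `d`; in
that case the index in front is exchanged for the last such `j`, at the price of terms in a smaller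
step. -/
theorem cyc_le_map_cycNormal (m : ℕ) :
    R.cyc χ m ≤ (Finsupp.supported S k
      {q : (Fin n → ℕ) × Perm (Fin n) | ∃ i, d ≤ q.1 i}).map (R.cycNormal χ d) := by
  have base : ∀ (i : Fin n) (α : Fin n → ℕ) (a : S) (π : Perm (Fin n)), (∀ j, i < j → α j < d) →
      R.conj χ i * (R.mon α * R.τ a * R.p π) ∈ (Finsupp.supported S k
        {q : (Fin n → ℕ) × Perm (Fin n) | ∃ i, d ≤ q.1 i}).map (R.cycNormal χ d) :=
    fun i α a π h => ⟨_, Finsupp.single_mem_supported k _ ⟨i, by simp⟩,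
      cycNormal_add_single h π a⟩
  induction m with
  | zero =>
    refine cyc_le fun i y hy => R.mul_mem_of_mem_fil (fun α a π h => ?_) hy
    exact absurd h (Nat.not_lt_zero _)
  | succ m ih =>
    refine cyc_le fun i y hy => R.mul_mem_of_mem_fil (fun α a π hα => ?_) hy
    by_cases h : ∃ j, i < j ∧ d ≤ α j
    · obtain ⟨j, hij, hj, β, rfl⟩ := exists_last _ h
      have hs : d + ∑ i, β i ≤ m := by
        simp only [Pi.add_apply, Finset.sum_add_distrib, Finset.sum_pi_single', Finset.mem_univ,
          if_true] at hα
        omega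
      have hy : R.mon β * R.τ a * R.p π ∈ R.fil (∑ i, β i + 1) :=
        R.mem_fil (Nat.lt_succ_self _) _ _
      have e1 : R.mon (β + Pi.single j d) * R.τ a * R.p π =
          R.x j ^ d * (R.mon β * R.τ a * R.p π) := by
        rw [add_comm β, ← mon_mul_mon, mon_single]; simp only [mul_assoc]
      have e2 : R.mon (β + Pi.single i d) * R.τ a * R.p π =
          R.x i ^ d * (R.mon β * R.τ a * R.p π) := by
        rw [add_comm β, ← mon_mul_mon, mon_single]; simp only [mul_assoc]
      -- Beyond `j` the exponents are those of the original monomial, all below `d` by the choice of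
      -- `j`.
      have hb := base j (β + Pi.single i d) a π fun l hl => by
        have h1 := hj l hl (hij.trans hl)
        simpa [Pi.single_eq_of_ne hl.ne', Pi.single_eq_of_ne (hij.trans hl).ne'] using h1
      rw [e2] at hb
      rw [e1]
      generalize R.mon β * R.τ a * R.p π = y at hy hb
      have hmem : ∀ {z}, z ∈ R.cyc χ (d + ∑ i, β i) → z ∈ (Finsupp.supported S k
          {q : (Fin n → ℕ) × Perm (Fin n) | ∃ i, d ≤ q.1 i}).map (R.cycNormal χ d) :=
        fun hz => ih (cyc_mono χ hs hz)
      -- Besides the exchanged term there are the commutator of `χ_i` and `χ_j` and their deviations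
      -- from `x_i^d` and `x_j^d`, each one degree lower.
      have key : R.conj χ i * (R.x j ^ d * y) =
          R.conj χ j * (R.x i ^ d * y) +
          ((R.conj χ i * R.conj χ j - R.conj χ j * R.conj χ i) * y +
            R.conj χ j * ((R.conj χ i - R.x i ^ d) * y) -
            R.conj χ i * ((R.conj χ j - R.x j ^ d) * y)) := by
        noncomm_ring
      rw [key]
      refine add_mem hb (hmem (sub_mem (add_mem ?_ ?_) ?_))
      · exact mem_cyc_mul_mem_fil (hχ.conj_mul_conj_sub_mem_cyc i j) hy
      · exact conj_mul_mem_cyc χ _ (R.mem_fil_mul_mem_fil (hχ.conj_sub_mem_fil i) hy)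
      · exact conj_mul_mem_cyc χ _ (R.mem_fil_mul_mem_fil (hχ.conj_sub_mem_fil j) hy)
    · exact base i α a π fun j hj => not_le.1 fun hd => h ⟨j, hj, hd⟩

/-- The basis theorem for the quotient by the two-sided ideal generated by `χ`. -/
theorem exists_basis (hR : Function.Bijective R.normal) {κ : Type*} (b : Module.Basis κ k S)
    {N : Type*} [AddCommGroup N] [Module k N] (q : A →ₗ[k] N) (hq : Function.Surjective q)
    (hker : ∀ z, q z = 0 ↔ z ∈ TwoSidedIdeal.span {χ}) :
    ∃ 𝓑 : Module.Basis ((Fin n → Fin d) × κ × Perm (Fin n)) k N,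
      ∀ α β π, 𝓑 (α, β, π) = q (R.mon (fun i => (α i : ℕ)) * R.τ (b β) * R.p π) := by
  let e : (Fin n → Fin d) × κ × Perm (Fin n) → RegularModule S n :=
    fun u => Finsupp.single (fun i => (u.1 i : ℕ), u.2.2) (b u.2.1)
  let v : (Fin n → Fin d) × κ × Perm (Fin n) → N :=
    fun u => q (R.mon (fun i => (u.1 i : ℕ)) * R.τ (b u.2.1) * R.p u.2.2)
  have hv : v = (q ∘ₗ R.cycNormal χ d) ∘ e := funext fun u => by
    simp only [v, e, Function.comp_apply, LinearMap.comp_apply]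
    rw [cycNormal_of_lt fun i => (u.1 i).2]
  have he : LinearIndependent k e := by
    have h1 := (Finsupp.basis (ι := (Fin n → ℕ) × Perm (Fin n)) fun _ => b).linearIndependent.comp
      (fun u : (Fin n → Fin d) × κ × Perm (Fin n) => ⟨(fun i => (u.1 i : ℕ), u.2.2), u.2.1⟩) (by
        rintro ⟨α, β, π⟩ ⟨α', β', π'⟩ h
        simp only [Sigma.mk.injEq, Prod.mk.injEq, heq_eq_eq] at h
        obtain ⟨⟨h1, rfl⟩, rfl⟩ := h
        rw [show α = α' from funext fun i => Fin.ext (congrFun h1 i)])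
    rwa [Finsupp.coe_basis] at h1
  have hmem : ∀ u, e u ∈ Finsupp.supported S k
      {q : (Fin n → ℕ) × Perm (Fin n) | ∃ i, d ≤ q.1 i}ᶜ := fun u => by
    refine Finsupp.single_mem_supported k _ ?_
    simp
  -- The kernel consists of images of vectors supported where some exponent is at least `d`; the
  -- chosen family is supported on the complement.
  have hdis : Disjoint (Submodule.span k (Set.range e)) (LinearMap.ker (q ∘ₗ R.cycNormal χ d)) := by
    refine Disjoint.mono (Submodule.span_le.2 (Set.range_subset_iff.2 hmem)) ?_
      (Finsupp.disjoint_supported_supported (M := S) (R := k) disjoint_compl_left)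
    intro w hw
    rw [LinearMap.mem_ker, LinearMap.comp_apply, hker] at hw
    obtain ⟨m, hm⟩ := hχ.exists_mem_cyc hR hw
    obtain ⟨w', hw', hww⟩ := hχ.cyc_le_map_cycNormal m hm
    rwa [← hχ.cycNormal_injective hR hww]
  have hli : LinearIndependent k v := by rw [hv]; exact he.map hdis
  have hspan : ⊤ ≤ Submodule.span k (Set.range v) := by
    rintro y -
    obtain ⟨z, rfl⟩ := hq y
    obtain ⟨w, rfl⟩ := hχ.cycNormal_surjective hR z
    induction w using Finsupp.induction_linear with
    | zero => simp
    | add w w' h h' => rw [map_add, map_add]; exact add_mem h h'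
    | single u a =>
      obtain ⟨α, π⟩ := u
      -- A basis element with a large exponent has some `χ_i` in front and dies in the quotient.
      by_cases h : ∃ i, True ∧ d ≤ α i
      · obtain ⟨i, -, hi, β, rfl⟩ := exists_last _ h
        rw [cycNormal_add_single fun j hj => by
          simpa [Pi.single_eq_of_ne hj.ne'] using hi j hj trivial]
        rw [(hker _).2 (mem_span_of_mem_cyc
          (conj_mul_mem_cyc χ i (R.mem_fil (Nat.lt_succ_self _) _ _)))]
        exact zero_mem _
      · have hα : ∀ i, α i < d := fun i => not_le.1 fun hi => h ⟨i, trivial, hi⟩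
        have ha : a ∈ Submodule.span k (Set.range b) := b.span_eq ▸ Submodule.mem_top
        induction ha using Submodule.span_induction with
        | mem a h =>
          obtain ⟨β, rfl⟩ := h
          refine Submodule.subset_span ⟨(fun i => ⟨α i, hα i⟩, β, π), ?_⟩
          rw [cycNormal_of_lt hα]
        | zero => simp
        | add a a' _ _ h h' =>
          rw [Finsupp.single_add, map_add, map_add]; exact add_mem h h'
        | smul r a _ h =>
          rw [← Finsupp.smul_single, map_smul, map_smul]; exact Submodule.smul_mem _ _ h
  exact ⟨Module.Basis.mk hli hspan, fun α β π => by rw [Module.Basis.mk_apply]⟩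

end IsCyclotomic

end WreathRep

end AffineWreath

end

/-! ## The Nakayama automorphism -/

noncomputable section

namespace AffineWreath

/-! ### Elements of pure parity -/

section Parity

variable {k : Type*} [CommRing k] {F : Type*} [Ring F] [Algebra k F]
variable (𝒜 : ℕ × ZMod 2 → Submodule k F) [GradedAlgebra 𝒜]

@[simp] theorem sgn_zero (k : Type*) [CommRing k] : sgn k 0 = 1 := if_pos rfl

theorem sgn_sum (k : Type*) [CommRing k] {κ : Type*} (s : Finset κ) (f : κ → ZMod 2) :
    sgn k (∑ i ∈ s, f i) = ∏ i ∈ s, sgn k (f i) := by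
  classical
  induction s using Finset.induction_on with
  | empty => simp
  | insert a s h ih => rw [Finset.sum_insert h, Finset.prod_insert h, sgn_add, ih]

theorem zmod_two_add_eq_zero {a b : ZMod 2} : a + b = 0 ↔ a = b := by
  revert a b; decide

/-- The element `f` is of parity `ε`. -/
def IsPar (ε : ZMod 2) (f : F) : Prop := parityProj 𝒜 ε f = f

variable {𝒜}

theorem isPar_of_mem {p : ℕ × ZMod 2} {f : F} (hf : f ∈ 𝒜 p) : IsPar 𝒜 p.2 f := by
  rw [IsPar, parityProj_of_mem 𝒜 hf, if_pos rfl]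

theorem isPar_parityProj (ε : ZMod 2) (f : F) : IsPar 𝒜 ε (parityProj 𝒜 ε f) := by
  rw [IsPar, parityProj_parityProj, if_pos rfl]

theorem isPar_one : IsPar 𝒜 0 (1 : F) := parityProj_zero_one 𝒜

theorem IsPar.mul {ε η : ZMod 2} {f g : F} (hf : IsPar 𝒜 ε f) (hg : IsPar 𝒜 η g) :
    IsPar 𝒜 (ε + η) (f * g) := by
  rw [IsPar, ← show _ = f from hf, ← show _ = g from hg]
  exact parityProj_mul 𝒜 _ _ _ _

theorem IsPar.parityProj_eq {ε : ZMod 2} {f : F} (hf : IsPar 𝒜 ε f) (η : ZMod 2) :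
    parityProj 𝒜 η f = if ε = η then f else 0 := by
  rw [← show _ = f from hf, parityProj_parityProj]

theorem isPar_iff {ε : ZMod 2} {f : F} : IsPar 𝒜 ε f ↔ ∀ η, η ≠ ε → parityProj 𝒜 η f = 0 := by
  refine ⟨fun h η hη => by rw [h.parityProj_eq, if_neg hη.symm], fun h => ?_⟩
  rw [IsPar]
  conv_rhs => rw [← sum_parityProj 𝒜 f]
  exact (Finset.sum_eq_single ε (fun η _ hη => h η hη) (by simp)).symm

/-- An additive property holds for all elements if it holds for the elements of pure parity. -/
theorem isPar_induction {P : F → Prop} (add : ∀ f g, P f → P g → P (f + g))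
    (par : ∀ ε f, IsPar 𝒜 ε f → P f) (f : F) : P f := by
  have h : parityProj 𝒜 0 f + parityProj 𝒜 1 f = f := by
    conv_rhs => rw [← sum_parityProj 𝒜 f]
    exact (Fin.sum_univ_two fun ε : ZMod 2 => parityProj 𝒜 ε f).symm
  rw [← h]
  exact add _ _ (par _ _ (isPar_parityProj _ _)) (par _ _ (isPar_parityProj _ _))

end Parity

/-! ### The trace form and multiplicativity of the Nakayama map -/

namespace FrobeniusStructure

variable {k : Type*} [CommRing k] {F : Type*} [Ring F] [Algebra k F]
variable {𝒜 : ℕ × ZMod 2 → Submodule k F} [GradedAlgebra 𝒜] (T : FrobeniusStructure 𝒜)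

theorem tr_eq_zero_of_isPar {ε : ZMod 2} (hε : ε ≠ 0) {f : F} (hf : IsPar 𝒜 ε f) :
    T.tr f = 0 := by
  have h : ∀ g : F, T.tr (parityProj 𝒜 ε g) = 0 := by
    intro g
    induction g using DirectSum.Decomposition.inductionOn 𝒜 with
    | zero => simp
    | @homogeneous p f =>
      rw [parityProj_of_mem 𝒜 f.2]
      split_ifs with h
      · exact T.tr_eq_zero _ (fun hp => hε (by rw [← h, hp])) _ f.2
      · simp
    | add f g hf hg => rw [map_add, map_add, hf, hg, add_zero]
  rw [← show _ = f from hf, h]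

theorem tr_mul_eq_zero {ε η : ZMod 2} (h : ε ≠ η) {f g : F} (hf : IsPar 𝒜 ε f)
    (hg : IsPar 𝒜 η g) : T.tr (f * g) = 0 :=
  T.tr_eq_zero_of_isPar (fun h' => h (zmod_two_add_eq_zero.1 h')) (hf.mul hg)

theorem tr_mul_parityProj {ε : ZMod 2} {g : F} (hg : IsPar 𝒜 ε g) (y : F) :
    T.tr (g * parityProj 𝒜 ε y) = T.tr (g * y) := by
  conv_rhs => rw [← sum_parityProj 𝒜 y, Finset.mul_sum, map_sum]
  exact (Finset.sum_eq_single ε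
    (fun η _ hη => T.tr_mul_eq_zero hη.symm hg (isPar_parityProj _ _)) (by simp)).symm

theorem tr_parityProj_mul {ε : ZMod 2} {g : F} (hg : IsPar 𝒜 ε g) (y : F) :
    T.tr (parityProj 𝒜 ε y * g) = T.tr (y * g) := by
  conv_rhs => rw [← sum_parityProj 𝒜 y, Finset.sum_mul, map_sum]
  exact (Finset.sum_eq_single ε
    (fun η _ hη => T.tr_mul_eq_zero hη (isPar_parityProj _ _) hg) (by simp)).symm

/-- Nondegeneracy of the trace; for a test element of pure parity the sign is a common factor on
both sides. -/
theorem eq_of_tr_mul {y z : F} (h : ∀ ε g, IsPar 𝒜 ε g → T.tr (g * y) = T.tr (g * z)) :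
    y = z := by
  refine T.dualEquiv.injective (LinearMap.ext fun g => ?_)
  induction g using DirectSum.Decomposition.inductionOn 𝒜 with
  | zero => simp
  | homogeneous g =>
    rw [T.dualEquiv_apply_of_mem y g.2, T.dualEquiv_apply_of_mem z g.2, h _ _ (isPar_of_mem g.2)]
  | add f g hf hg => rw [map_add, map_add, hf, hg]

variable [Module.Free k F] [Module.Finite k F]

/-- An element of pure parity may mix degrees; decomposing it brings the identity back to
homogeneous elements. -/
theorem tr_mul_nakayama_of_isPar {ε η : ZMod 2} {f g : F} (hf : IsPar 𝒜 ε f)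
    (hg : IsPar 𝒜 η g) : T.tr (f * g) = sgn k (ε * η) * T.tr (g * T.nakayama f) := by
  have h : ∀ f g : F, T.tr (parityProj 𝒜 ε f * parityProj 𝒜 η g) =
      sgn k (ε * η) * T.tr (parityProj 𝒜 η g * T.nakayama (parityProj 𝒜 ε f)) := by
    intro f g
    induction f using DirectSum.Decomposition.inductionOn 𝒜 with
    | zero => simp
    | @homogeneous p f =>
      induction g using DirectSum.Decomposition.inductionOn 𝒜 with
      | zero => simp
      | @homogeneous q g =>
        rw [parityProj_of_mem 𝒜 f.2, parityProj_of_mem 𝒜 g.2]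
        split_ifs with h1 h2
        · rw [T.tr_mul_nakayama f.2 g.2, h1, h2]
        all_goals simp
      | add g g' h h' => simp only [map_add, mul_add, add_mul, h, h']
    | add f f' h h' => simp only [map_add, mul_add, add_mul, h, h']
  have := h f g
  rwa [show _ = f from hf, show _ = g from hg] at this

theorem tr_mul_nakayama_of_isPar' {ε η : ZMod 2} {f g : F} (hf : IsPar 𝒜 ε f)
    (hg : IsPar 𝒜 η g) : T.tr (g * T.nakayama f) = sgn k (ε * η) * T.tr (f * g) := by
  rw [T.tr_mul_nakayama_of_isPar hf hg, ← mul_assoc, sgn_mul_self, one_mul]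

/-- Up to sign, pairing `ψ f` with `g` is pairing `f` with `g`, which vanishes when the parities
differ. -/
theorem isPar_nakayama {ε : ZMod 2} {f : F} (hf : IsPar 𝒜 ε f) :
    IsPar 𝒜 ε (T.nakayama f) := by
  refine isPar_iff.2 fun η hη => T.eq_of_tr_mul fun ζ g hg => ?_
  rw [mul_zero, map_zero]
  by_cases h : ζ = η
  · subst h
    rw [T.tr_mul_parityProj hg, T.tr_mul_nakayama_of_isPar' hf hg,
      T.tr_mul_eq_zero hη.symm hf hg, mul_zero]
  · exact T.tr_mul_eq_zero h hg (isPar_parityProj _ _)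

theorem nakayama_one : T.nakayama 1 = 1 :=
  T.eq_of_tr_mul fun ε g hg => by
    rw [T.tr_mul_nakayama_of_isPar' isPar_one hg, zero_mul, sgn_zero, one_mul, one_mul, mul_one]

/-- Rotate under the trace: `tr (h ψ(f g))`, `tr (f g h)`, `tr (g h ψ(f))` and `tr (h ψ(f) ψ(g))`
agree up to signs, and the three signs cancel. -/
theorem nakayama_mul (f g : F) : T.nakayama (f * g) = T.nakayama f * T.nakayama g := by
  induction f using isPar_induction (𝒜 := 𝒜) with
  | add f f' h h' => rw [add_mul, map_add, h, h', map_add, add_mul]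
  | par ε f hf =>
    induction g using isPar_induction (𝒜 := 𝒜) with
    | add g g' h h' => rw [mul_add, map_add, h, h', map_add, mul_add]
    | par η g hg =>
      refine T.eq_of_tr_mul fun ζ h hh => ?_
      rw [T.tr_mul_nakayama_of_isPar' (hf.mul hg) hh, mul_assoc,
        T.tr_mul_nakayama_of_isPar hf (hg.mul hh), mul_assoc,
        T.tr_mul_nakayama_of_isPar hg (hh.mul (T.isPar_nakayama hf)), ← mul_assoc, ← mul_assoc,
        ← sgn_add, ← sgn_add, mul_assoc h]
      have : (ε + η) * ζ + ε * (η + ζ) + η * (ζ + ε) = 0 := by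
        clear hf hg hh; revert ε η ζ; decide
      rw [this, sgn_zero, one_mul]

/-- The Nakayama automorphism as a homomorphism of algebras. -/
def nakayamaHom : F →ₐ[k] F :=
  AlgHom.ofLinearMap (T.nakayama : F →ₗ[k] F) T.nakayama_one T.nakayama_mul

end FrobeniusStructure

/-! ## Homomorphisms of tensor powers of superalgebras -/

namespace SuperPower

variable {k : Type*} [CommRing k] {F : Type*} [Ring F] [Algebra k F]
variable {𝒜 : ℕ × ZMod 2 → Submodule k F} [GradedAlgebra 𝒜] {n : ℕ}

/-- The linear endomorphism of `F^{⊗ n}` which applies `φ i` in place `i`. -/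
def mapAll (φ : Fin n → F →ₗ[k] F) : SuperPower 𝒜 n →ₗ[k] SuperPower 𝒜 n :=
  PiTensorProduct.map φ

@[simp] theorem mapAll_tprod (φ : Fin n → F →ₗ[k] F) (a : Fin n → F) :
    mapAll (𝒜 := 𝒜) φ (tprod 𝒜 a) = tprod 𝒜 fun i => φ i (a i) :=
  PiTensorProduct.map_tprod _ _

theorem mapAt_tprod (ψ : F →ₗ[k] F) (i : Fin n) (a : Fin n → F) :
    mapAt 𝒜 ψ i (tprod 𝒜 a) = tprod 𝒜 fun j => if j = i then ψ (a j) else a j := by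
  refine (PiTensorProduct.map_tprod _ _).trans ?_
  change tprod 𝒜 _ = _
  congr 1
  funext j
  by_cases h : j = i
  · subst h; simp
  · simp [h]

/-- Multiplication of the homogeneous elements of parity `ε` by `(-1)^{ε η}`. -/
def twist (𝒜 : ℕ × ZMod 2 → Submodule k F) [GradedAlgebra 𝒜] (η : ZMod 2) : F →ₗ[k] F :=
  ∑ ε : ZMod 2, sgn k (ε * η) • parityProj 𝒜 ε

theorem twist_of_isPar {ε : ZMod 2} {f : F} (hf : IsPar 𝒜 ε f) (η : ZMod 2) :
    twist 𝒜 η f = sgn k (ε * η) • f := by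
  simp [twist, hf.parityProj_eq]

theorem twist_one (η : ZMod 2) : twist 𝒜 η (1 : F) = 1 := by
  simp [twist_of_isPar isPar_one]

theorem twist_twist (η : ZMod 2) (f : F) : twist 𝒜 η (twist 𝒜 η f) = f := by
  induction f using isPar_induction (𝒜 := 𝒜) with
  | add f g hf hg => rw [map_add, map_add, hf, hg]
  | par ε f hf =>
    rw [twist_of_isPar hf, map_smul, twist_of_isPar hf, smul_smul,
      FrobeniusStructure.sgn_mul_self, one_smul]

theorem isPar_single {i : Fin n} {η : ZMod 2} {g : F} (hg : IsPar 𝒜 η g) (j : Fin n) :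
    IsPar 𝒜 ((Pi.single i η : Fin n → ZMod 2) j)
      ((Function.update (fun _ => 1) i g : Fin n → F) j) := by
  by_cases h : j = i
  · subst h; simpa using hg
  · simpa [h] using isPar_one

/-- Only the factors before place `i` pass the entry `g`. Recording their signs by `twist` makes the
formula valid for all pure tensors. -/
theorem single_mul_tprod {i : Fin n} {η : ZMod 2} {g : F} (hg : IsPar 𝒜 η g) (z : Fin n → F) :
    single 𝒜 i g * tprod 𝒜 z = tprod 𝒜 fun j =>
      if j < i then twist 𝒜 η (z j) else if j = i then g * z j else z j := by
  have h : LinearMap.mulLeft k (single 𝒜 i g) = mapAll (𝒜 := 𝒜) fun j =>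
      if j < i then twist 𝒜 η else if j = i then LinearMap.mulLeft k g else LinearMap.id := by
    refine hom_ext 𝒜 fun ε z hz => ?_
    rw [LinearMap.mulLeft_apply, mapAll_tprod, single,
      tprod_mul_tprod 𝒜 (isPar_single hg) hz]
    have hs : mulExp (Pi.single i η) ε = ∑ j, if j < i then ε j * η else 0 := by
      rw [mulExp, Finset.sum_eq_single i]
      · simp [mul_comm η]
      · intro j _ hj
        simp [Pi.single_eq_of_ne hj]
      · simp
    rw [hs, sgn_sum, ← MultilinearMap.map_smul_univ]
    congr 1
    funext j
    rcases lt_trichotomy j i with h | h | h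
    · simp [h, h.ne, twist_of_isPar (hz j)]
    · simp [h]
    · simp [h.ne', h.not_gt]
  refine (LinearMap.congr_fun h (tprod 𝒜 z)).trans ?_
  rw [mapAll_tprod]
  congr 1
  funext j
  split_ifs <;> rfl

theorem tprod_mul_single {i : Fin n} {η : ZMod 2} {g : F} (hg : IsPar 𝒜 η g) (z : Fin n → F) :
    tprod 𝒜 z * single 𝒜 i g = tprod 𝒜 fun j =>
      if i < j then twist 𝒜 η (z j) else if j = i then z j * g else z j := by
  have h : LinearMap.mulRight k (single 𝒜 i g) = mapAll (𝒜 := 𝒜) fun j =>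
      if i < j then twist 𝒜 η else if j = i then LinearMap.mulRight k g else LinearMap.id := by
    refine hom_ext 𝒜 fun ε z hz => ?_
    rw [LinearMap.mulRight_apply, mapAll_tprod, single,
      tprod_mul_tprod 𝒜 hz (isPar_single hg)]
    have hs : mulExp ε (Pi.single i η) = ∑ j, if i < j then ε j * η else 0 := by
      rw [mulExp]
      refine Finset.sum_congr rfl fun j _ => ?_
      rw [Finset.sum_eq_single i]
      · simp
      · intro l _ hl
        simp [Pi.single_eq_of_ne hl]
      · simp
    rw [hs, sgn_sum, ← MultilinearMap.map_smul_univ]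
    congr 1
    funext j
    rcases lt_trichotomy j i with h | h | h
    · simp [h.ne, h.not_gt]
    · simp [h]
    · simp [h, h.ne', twist_of_isPar (hz j)]
  refine (LinearMap.congr_fun h (tprod 𝒜 z)).trans ?_
  rw [mapAll_tprod]
  congr 1
  funext j
  split_ifs <;> rfl

/-- `f ↦ f_i` as a linear map. -/
def singleHom (𝒜 : ℕ × ZMod 2 → Submodule k F) (i : Fin n) : F →ₗ[k] SuperPower 𝒜 n :=
  (tprod 𝒜).toLinearMap (fun _ => 1) i

theorem single_add (i : Fin n) (f g : F) : single 𝒜 i (f + g) = single 𝒜 i f + single 𝒜 i g :=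
  map_add (singleHom 𝒜 i) f g

theorem single_mul_single_self (i : Fin n) (f g : F) :
    single 𝒜 i f * single 𝒜 i g = single 𝒜 i (f * g) := by
  induction f using isPar_induction (𝒜 := 𝒜) with
  | add f f' h h' => rw [single_add, add_mul, h, h', add_mul, single_add]
  | par ε f hf =>
    change single 𝒜 i f * tprod 𝒜 _ = tprod 𝒜 _
    rw [single_mul_tprod hf]
    congr 1
    funext j
    by_cases h : j = i
    · subst h; simp
    · simp [h, twist_one]

/-- Exactly one of the two products moves an entry past the other, according to whether `i < j`. -/
theorem single_mul_single_comm {i j : Fin n} (hij : i ≠ j) {ε η : ZMod 2} {f g : F}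
    (hf : IsPar 𝒜 ε f) (hg : IsPar 𝒜 η g) :
    single 𝒜 i f * single 𝒜 j g = sgn k (ε * η) • (single 𝒜 j g * single 𝒜 i f) := by
  have h1 := single_mul_tprod (i := i) hf (Function.update (fun _ => 1) j g)
  have h2 := tprod_mul_single (i := i) hf (Function.update (fun _ => 1) j g)
  have hc : ∀ z : Fin n → F, (tprod 𝒜 fun l => (if l = j then sgn k (ε * η) else 1) • z l) =
      sgn k (ε * η) • tprod 𝒜 z := by
    intro z
    rw [MultilinearMap.map_smul_univ]
    simp
  have hg' : twist 𝒜 ε g = sgn k (ε * η) • g := by rw [twist_of_isPar hg, mul_comm]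
  change single 𝒜 i f * single 𝒜 j g = _ at h1
  change single 𝒜 j g * single 𝒜 i f = _ at h2
  rw [h1, h2, ← hc]
  congr 1
  funext l
  by_cases hli : l = i
  · subst hli
    simp [hij]
  by_cases hlj : l = j
  · subst hlj
    rcases lt_or_gt_of_ne hij with h | h
    · simp [h, h.not_gt, hli, hg', smul_smul, FrobeniusStructure.sgn_mul_self]
    · simp [h, h.not_gt, hli, hg']
  · simp [hli, hlj, twist_one]

/-- The elements `f_i`, with `f` of pure parity, generate `F^{⊗ n}`. -/
theorem single_induction {P : SuperPower 𝒜 n → Prop}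
    (single : ∀ i ε f, IsPar 𝒜 ε f → P (single 𝒜 i f)) (one : P 1)
    (mul : ∀ a b, P a → P b → P (a * b)) (add : ∀ a b, P a → P b → P (a + b))
    (smul : ∀ (r : k) a, P a → P (r • a)) (a : SuperPower 𝒜 n) : P a := by
  have hs : ∀ i f, P (SuperPower.single 𝒜 i f) := fun i f =>
    isPar_induction (𝒜 := 𝒜) (P := fun f => P (SuperPower.single 𝒜 i f))
      (fun f g hf hg => by rw [single_add]; exact add _ _ hf hg) (fun ε f hf => single i ε f hf) f
  -- Filling the places from left to right creates no signs, since the later factors are still `1`.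
  have hstep : ∀ (z : Fin n → F) (i : Fin n) (f : F), (∀ j, i < j → z j = 1) → z i = 1 →
      tprod 𝒜 z * SuperPower.single 𝒜 i f = tprod 𝒜 (Function.update z i f) := by
    intro z i f hz hi
    induction f using isPar_induction (𝒜 := 𝒜) with
    | add f g hf hg => rw [single_add, mul_add, hf, hg, MultilinearMap.map_update_add]
    | par ε f hf =>
      rw [tprod_mul_single hf]
      congr 1
      funext j
      rcases lt_trichotomy i j with h | h | h
      · simp [h, hz j h, h.ne', twist_one]
      · subst h; simp [hi]
      · simp [h.not_gt, h.ne]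
  have ht : ∀ (z : Fin n → F) (m : ℕ), P (tprod 𝒜 fun j => if (j : ℕ) < m then z j else 1) := by
    intro z m
    induction m with
    | zero => simpa [← one_def] using one
    | succ m ih =>
      by_cases hm : m < n
      · have := hstep (fun j => if (j : ℕ) < m then z j else 1) ⟨m, hm⟩ (z ⟨m, hm⟩)
          (fun j hj => if_neg (not_lt.2 (le_of_lt hj))) (if_neg (lt_irrefl m))
        have h2 := mul _ _ ih (hs ⟨m, hm⟩ (z ⟨m, hm⟩))
        rw [this] at h2
        convert h2 using 2
        funext j
        by_cases hj : j = ⟨m, hm⟩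
        · subst hj; simp
        · have : (j : ℕ) ≠ m := fun h => hj (Fin.ext h)
          simp only [Function.update_of_ne hj]
          congr 1
          simp only [eq_iff_iff]
          omega
      · convert ih using 2
        funext j
        rw [if_pos (by omega), if_pos (by omega)]
  have ht' : ∀ z : Fin n → F, P (tprod 𝒜 z) := fun z => by simpa using ht z n
  refine PiTensorProduct.induction_on (R := k) (motive := P) a (fun r z => smul r _ (ht' z))
    fun a b ha hb => add _ _ ha hb

theorem algHom_ext {N : Type*} [Ring N] [Algebra k N] {f g : SuperPower 𝒜 n →ₐ[k] N}
    (h : ∀ i u, f (single 𝒜 i u) = g (single 𝒜 i u)) : f = g := by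
  refine AlgHom.ext fun a => ?_
  induction a using single_induction with
  | single i ε u _ => exact h i u
  | one => rw [map_one, map_one]
  | mul a b ha hb => rw [map_mul, map_mul, ha, hb]
  | add a b ha hb => rw [map_add, map_add, ha, hb]
  | smul r a ha => rw [map_smul, map_smul, ha]

/-- A linear endomorphism is a homomorphism of algebras if it is so on pure tensors of elements of
pure parity. -/
def algHomOfTprod (f : SuperPower 𝒜 n →ₗ[k] SuperPower 𝒜 n) (one : f 1 = 1)
    (mul : ∀ (ε η : Fin n → ZMod 2) (a b : Fin n → F), (∀ i, IsPar 𝒜 (ε i) (a i)) →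
      (∀ i, IsPar 𝒜 (η i) (b i)) →
      f (tprod 𝒜 a * tprod 𝒜 b) = f (tprod 𝒜 a) * f (tprod 𝒜 b)) :
    SuperPower 𝒜 n →ₐ[k] SuperPower 𝒜 n :=
  AlgHom.ofLinearMap f one fun a b => by
    have h : (LinearMap.mul k (SuperPower 𝒜 n)).compr₂ f =
        (LinearMap.mul k (SuperPower 𝒜 n)).compl₁₂ f f :=
      hom_ext 𝒜 fun ε a ha => hom_ext 𝒜 fun η b hb => mul ε η a b ha hb
    exact LinearMap.congr_fun₂ h a b

/-- The sign rule that makes superpermutation multiplicative. Modulo two, the cross terms `ε_i η_j`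
over the inversions account for the change of the product sign when the places are permuted. -/
theorem mulExp_add_permExp (π : Equiv.Perm (Fin n)) (ε η : Fin n → ZMod 2) :
    mulExp ε η + permExp π (fun i => ε i + η i) =
      permExp π ε + permExp π η + mulExp (fun i => ε (π.symm i)) (fun i => η (π.symm i)) := by
  have h1 : mulExp (fun i => ε (π.symm i)) (fun i => η (π.symm i)) =
      ∑ i, ∑ j, if π j < π i then ε i * η j else 0 := by
    rw [mulExp, ← Equiv.sum_comp π]
    refine Finset.sum_congr rfl fun i _ => ?_
    rw [← Equiv.sum_comp π]
    simp
  have h2 : ∑ i, ∑ j, (if i < j ∧ π j < π i then ε j * η i else 0) =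
      ∑ i, ∑ j, if j < i ∧ π i < π j then ε i * η j else 0 := Finset.sum_comm
  have h3 : permExp π (fun i => ε i + η i) = permExp π ε + permExp π η +
      ∑ i, ∑ j, (if i < j ∧ π j < π i then ε i * η j else 0) +
      ∑ i, ∑ j, if j < i ∧ π i < π j then ε i * η j else 0 := by
    rw [← h2]
    simp only [permExp, ← Finset.sum_add_distrib]
    refine Finset.sum_congr rfl fun i _ => Finset.sum_congr rfl fun j _ => ?_
    split_ifs
    · ring
    · ring
  have h4 : mulExp ε η + ∑ i, ∑ j, (if i < j ∧ π j < π i then ε i * η j else 0) +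
      ∑ i, ∑ j, (if j < i ∧ π i < π j then ε i * η j else 0) =
      ∑ i, ∑ j, if π j < π i then ε i * η j else 0 := by
    simp only [mulExp, ← Finset.sum_add_distrib]
    refine Finset.sum_congr rfl fun i _ => Finset.sum_congr rfl fun j _ => ?_
    have hd : ∀ c : ZMod 2, c + c = 0 := by decide
    rcases lt_trichotomy i j with h | rfl | h
    · simp [h, h.not_gt]
    · simp
    · have hp : π i ≠ π j := π.injective.ne h.ne'
      rcases lt_or_gt_of_ne hp with h' | h' <;> simp [h, h.not_gt, h', h'.not_gt, hd]
  rw [h3, h1, ← h4]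
  ring

/-- Superpermutation as a homomorphism of algebras. -/
def superPermHom (𝒜 : ℕ × ZMod 2 → Submodule k F) [GradedAlgebra 𝒜] (π : Equiv.Perm (Fin n)) :
    SuperPower 𝒜 n →ₐ[k] SuperPower 𝒜 n :=
  algHomOfTprod (superPerm 𝒜 π)
    (by
      rw [one_def, superPerm_tprod 𝒜 π (ε := fun _ => 0) fun _ => isPar_one]
      simp [permExp])
    (fun ε η a b ha hb => by
      rw [tprod_mul_tprod 𝒜 ha hb, superPerm_tprod 𝒜 π ha, superPerm_tprod 𝒜 π hb, map_smul,
        superPerm_tprod 𝒜 π (ε := fun i => ε i + η i) fun i => (ha i).mul (hb i),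
        smul_mul_smul_comm, tprod_mul_tprod 𝒜 (fun i => ha (π.symm i)) fun i => hb (π.symm i),
        smul_smul, smul_smul, ← sgn_add, ← sgn_add, ← sgn_add, mulExp_add_permExp])

@[simp] theorem superPermHom_apply (π : Equiv.Perm (Fin n)) (a : SuperPower 𝒜 n) :
    superPermHom 𝒜 π a = superPerm 𝒜 π a := rfl

@[simp] theorem superPerm_single (π : Equiv.Perm (Fin n)) (i : Fin n) (f : F) :
    superPerm 𝒜 π (single 𝒜 i f) = single 𝒜 (π i) f := by
  induction f using isPar_induction (𝒜 := 𝒜) with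
  | add f g hf hg => rw [single_add, map_add, hf, hg, single_add]
  | par η f hf =>
    rw [single, superPerm_tprod 𝒜 π (isPar_single hf), single]
    have h : permExp π (Pi.single i η) = 0 := by
      refine Finset.sum_eq_zero fun j _ => Finset.sum_eq_zero fun l _ => ?_
      by_cases hj : j = i
      · by_cases hl : l = i
        · simp [hj, hl]
        · simp [hl]
      · simp [hj]
    rw [h, sgn_zero, one_smul]
    congr 1
    funext j
    simp only [Function.update_apply, Equiv.symm_apply_eq]

/-- Superpermutation as an action of the symmetric group by homomorphisms of algebras. -/
def superPermAction (𝒜 : ℕ × ZMod 2 → Submodule k F) [GradedAlgebra 𝒜] (n : ℕ) :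
    Equiv.Perm (Fin n) →* (SuperPower 𝒜 n →ₐ[k] SuperPower 𝒜 n) where
  toFun := superPermHom 𝒜
  map_one' := algHom_ext fun i u => by simp
  map_mul' π σ := AlgHom.ext fun a => superPerm_mul 𝒜 π σ a

@[simp] theorem superPermAction_apply (π : Equiv.Perm (Fin n)) (a : SuperPower 𝒜 n) :
    superPermAction 𝒜 n π a = superPerm 𝒜 π a := rfl

/-- The homomorphism `ψ_i` for an even endomorphism `ψ`. -/
def mapAtHom (ψ : F →ₐ[k] F) (hψ : ∀ ε f, IsPar 𝒜 ε f → IsPar 𝒜 ε (ψ f)) (i : Fin n) :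
    SuperPower 𝒜 n →ₐ[k] SuperPower 𝒜 n :=
  algHomOfTprod (mapAt 𝒜 ψ.toLinearMap i)
    (by
      rw [one_def, mapAt_tprod]
      congr 1
      funext j
      simp)
    (fun ε η a b ha hb => by
      have h : ∀ {ε : Fin n → ZMod 2} {a : Fin n → F}, (∀ i, IsPar 𝒜 (ε i) (a i)) →
          ∀ j, IsPar 𝒜 (ε j) (if j = i then ψ.toLinearMap (a j) else a j) := by
        intro ε a ha j
        split_ifs
        · exact hψ _ _ (ha j)
        · exact ha j
      rw [tprod_mul_tprod 𝒜 ha hb, map_smul, mapAt_tprod, mapAt_tprod, mapAt_tprod,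
        tprod_mul_tprod 𝒜 (h ha) (h hb)]
      congr 2
      funext j
      split_ifs
      · exact map_mul ψ _ _
      · rfl)

@[simp] theorem mapAt_single_self (ψ : F →ₗ[k] F) (i : Fin n) (f : F) :
    mapAt 𝒜 ψ i (single 𝒜 i f) = single 𝒜 i (ψ f) := by
  rw [single, mapAt_tprod, single]
  congr 1
  funext j
  by_cases h : j = i
  · subst h; simp
  · simp [h]

theorem mapAt_single_of_ne {ψ : F →ₗ[k] F} (hψ : ψ 1 = 1) {i j : Fin n} (hij : i ≠ j) (f : F) :
    mapAt 𝒜 ψ i (single 𝒜 j f) = single 𝒜 j f := by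
  rw [single, mapAt_tprod]
  congr 1
  funext l
  by_cases h : l = i
  · subst h; simp [hij, hψ]
  · simp [h]

end SuperPower

end AffineWreath

end

/-! ## The Casimir elements and the wreath datum of a Frobenius superalgebra -/

noncomputable section

namespace AffineWreath

open Equiv

namespace FrobeniusStructure

variable {k : Type*} [CommRing k] {F : Type*} [Ring F] [Algebra k F]
variable {𝒜 : ℕ × ZMod 2 → Submodule k F} [GradedAlgebra 𝒜] (T : FrobeniusStructure 𝒜)
variable [Module.Free k F] [Module.Finite k F] {ι : Type*} [Fintype ι] (B : Module.Basis ι k F)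

theorem sum_tr_leftDual_smul (f : F) : ∑ b, T.tr (T.leftDual B b * f) • B b = f := by
  conv_rhs => rw [← B.sum_repr f]
  refine Finset.sum_congr rfl fun b _ => ?_
  have h : T.leftForm (T.leftDual B b) = B.coord b := T.leftEquiv.apply_symm_apply _
  rw [← leftForm_apply, h, Module.Basis.coord_apply]

theorem sum_tr_mul_smul_leftDual (f : F) : ∑ b, T.tr (f * B b) • T.leftDual B b = f := by
  classical
  refine T.leftForm_bijective.1 (B.ext fun c => ?_)
  rw [map_sum, LinearMap.sum_apply]
  simp only [map_smul, LinearMap.smul_apply, leftForm_apply, tr_leftDual_mul, smul_eq_mul,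
    mul_ite, mul_one, mul_zero, Finset.sum_ite_eq', Finset.mem_univ, if_true]

omit [Fintype ι] in
theorem isPar_leftDual {p : ι → ZMod 2} (hp : ∀ b, IsPar 𝒜 (p b) (B b)) (b : ι) :
    IsPar 𝒜 (p b) (T.leftDual B b) := by
  classical
  refine isPar_iff.2 fun η hη => T.leftForm_bijective.1 (B.ext fun c => ?_)
  rw [map_zero, LinearMap.zero_apply, leftForm_apply]
  by_cases h : η = p c
  · subst h
    rw [T.tr_parityProj_mul (hp c), tr_leftDual_mul, if_neg]
    rintro rfl
    exact hη rfl
  · exact T.tr_mul_eq_zero h (isPar_parityProj _ _) (hp c)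

variable {N : Type*} [AddCommGroup N] [Module k N] (Θ : F →ₗ[k] F →ₗ[k] N)

/-- Expanding `f b` in the basis and `b^∨ f` in the dual basis gives the same coefficients `tr (c^∨
f b)`. The bilinear map `Θ` stands for the tensor product of two places. -/
theorem sum_mul_left (f : F) :
    ∑ b, Θ (f * B b) (T.leftDual B b) = ∑ b, Θ (B b) (T.leftDual B b * f) := by
  have h1 : ∀ b, Θ (f * B b) (T.leftDual B b) =
      ∑ c, T.tr (T.leftDual B c * (f * B b)) • Θ (B c) (T.leftDual B b) := fun b => by
    conv_lhs => rw [← T.sum_tr_leftDual_smul B (f * B b)]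
    simp only [map_sum, map_smul, LinearMap.sum_apply, LinearMap.smul_apply]
  have h2 : ∀ b, Θ (B b) (T.leftDual B b * f) =
      ∑ c, T.tr (T.leftDual B b * f * B c) • Θ (B b) (T.leftDual B c) := fun b => by
    conv_lhs => rw [← T.sum_tr_mul_smul_leftDual B (T.leftDual B b * f)]
    simp only [map_sum, map_smul]
  simp only [h1, h2]
  rw [Finset.sum_comm]
  simp only [mul_assoc]

theorem sum_sgn_mul_right {p : ι → ZMod 2} (hp : ∀ b, IsPar 𝒜 (p b) (B b)) {φ : ZMod 2} {f : F}
    (hf : IsPar 𝒜 φ f) :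
    ∑ b, sgn k (φ * p b) • Θ (B b) (f * T.leftDual B b) =
      ∑ b, sgn k (φ * p b) • Θ (B b * T.nakayama f) (T.leftDual B b) := by
  have h1 : ∀ b, sgn k (φ * p b) • Θ (B b) (f * T.leftDual B b) =
      ∑ c, (sgn k (φ * p b) * T.tr (f * (T.leftDual B b * B c))) • Θ (B b) (T.leftDual B c) :=
    fun b => by
      conv_lhs => rw [← T.sum_tr_mul_smul_leftDual B (f * T.leftDual B b)]
      simp only [map_sum, map_smul, Finset.smul_sum, mul_smul, mul_assoc]
  have h2 : ∀ b, sgn k (φ * p b) • Θ (B b * T.nakayama f) (T.leftDual B b) =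
      ∑ c, (sgn k (φ * p b) * T.tr (T.leftDual B c * (B b * T.nakayama f))) •
        Θ (B c) (T.leftDual B b) := fun b => by
    conv_lhs => rw [← T.sum_tr_leftDual_smul B (B b * T.nakayama f)]
    simp only [map_sum, map_smul, LinearMap.sum_apply, LinearMap.smul_apply, Finset.smul_sum,
      mul_smul]
  simp only [h1, h2]
  conv_rhs => rw [Finset.sum_comm]
  refine Finset.sum_congr rfl fun b _ => Finset.sum_congr rfl fun c _ => ?_
  rw [T.tr_mul_nakayama_of_isPar hf ((T.isPar_leftDual B hp b).mul (hp c)), ← mul_assoc (sgn k _),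
    ← sgn_add, mul_assoc (T.leftDual B b)]
  -- Rotating `f` under the trace replaces the sign attached to `b` by the one attached to `c`.
  congr 3
  have h : ∀ x y z : ZMod 2, x * y + x * (y + z) = x * z := by decide
  exact h _ _ _

theorem sum_nakayama_leftDual {p : ι → ZMod 2} (hp : ∀ b, IsPar 𝒜 (p b) (B b)) :
    ∑ b, Θ (B b) (T.nakayama (T.leftDual B b)) =
      ∑ b, sgn k (p b * p b) • Θ (T.leftDual B b) (B b) := by
  have h1 : ∀ b, Θ (B b) (T.nakayama (T.leftDual B b)) =
      ∑ c, T.tr (T.leftDual B c * T.nakayama (T.leftDual B b)) • Θ (B b) (B c) := fun b => by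
    conv_lhs => rw [← T.sum_tr_leftDual_smul B (T.nakayama (T.leftDual B b))]
    simp only [map_sum, map_smul]
  have h2 : ∀ b, sgn k (p b * p b) • Θ (T.leftDual B b) (B b) =
      ∑ c, (sgn k (p b * p b) * T.tr (T.leftDual B c * T.leftDual B b)) • Θ (B c) (B b) :=
    fun b => by
      conv_lhs => rw [← T.sum_tr_leftDual_smul B (T.leftDual B b)]
      simp only [map_sum, map_smul, LinearMap.sum_apply, LinearMap.smul_apply, Finset.smul_sum,
        mul_smul]
  simp only [h1, h2]
  conv_rhs => rw [Finset.sum_comm]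
  refine Finset.sum_congr rfl fun b _ => Finset.sum_congr rfl fun c _ => ?_
  have hb := T.isPar_leftDual B hp b
  have hc := T.isPar_leftDual B hp c
  by_cases h : p b = p c
  · rw [T.tr_mul_nakayama_of_isPar hb hc, h, ← mul_assoc, sgn_mul_self, one_mul]
  · rw [T.tr_mul_eq_zero h hb hc, T.tr_mul_eq_zero (Ne.symm h) hc (T.isPar_nakayama hb), mul_zero]

end FrobeniusStructure

section Datum

open SuperPower FrobeniusStructure

variable {k : Type*} [CommRing k] {F : Type*} [Ring F] [Algebra k F]
variable {𝒜 : ℕ × ZMod 2 → Submodule k F} [GradedAlgebra 𝒜] (T : FrobeniusStructure 𝒜)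
variable [Module.Free k F] [Module.Finite k F] {ι : Type*} [Fintype ι] (B : Module.Basis ι k F)
variable {n : ℕ}

/-- The bilinear map `(u, v) ↦ u_i v_j`. -/
def singleMulSingle (𝒜 : ℕ × ZMod 2 → Submodule k F) [GradedAlgebra 𝒜] (i j : Fin n) :
    F →ₗ[k] F →ₗ[k] SuperPower 𝒜 n :=
  (LinearMap.mul k (SuperPower 𝒜 n)).compl₁₂ (singleHom 𝒜 i) (singleHom 𝒜 j)

omit [Module.Free k F] [Module.Finite k F] in
theorem singleMulSingle_apply (i j : Fin n) (u v : F) :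
    singleMulSingle 𝒜 i j u v = single 𝒜 i u * single 𝒜 j v := rfl

/-- The homomorphism `ψ_i` for the Nakayama automorphism `ψ`. -/
def nakayamaAt (i : Fin n) : SuperPower 𝒜 n →ₐ[k] SuperPower 𝒜 n :=
  mapAtHom T.nakayamaHom (fun _ _ hf => T.isPar_nakayama hf) i

theorem nakayamaAt_apply (i : Fin n) (a : SuperPower 𝒜 n) :
    nakayamaAt T i a = mapAt 𝒜 (T.nakayama : F →ₗ[k] F) i a := rfl

@[simp] theorem nakayamaAt_single_self (i : Fin n) (f : F) :
    nakayamaAt T i (single 𝒜 i f) = single 𝒜 i (T.nakayama f) :=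
  mapAt_single_self _ i f

theorem nakayamaAt_single_of_ne {i j : Fin n} (hij : i ≠ j) (f : F) :
    nakayamaAt T i (single 𝒜 j f) = single 𝒜 j f :=
  mapAt_single_of_ne T.nakayama_one hij f

theorem superPerm_casimir (σ : Perm (Fin n)) (i j : Fin n) :
    superPerm 𝒜 σ (casimir T B i j) = casimir T B (σ i) (σ j) := by
  rw [← superPermHom_apply, casimir, map_sum, casimir]
  refine Finset.sum_congr rfl fun b _ => ?_
  rw [map_mul, superPermHom_apply, superPermHom_apply, superPerm_single, superPerm_single]

theorem nakayama_casimir_of_ne {l i j : Fin n} (hi : l ≠ i) (hj : l ≠ j) :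
    nakayamaAt T l (casimir T B i j) = casimir T B i j := by
  rw [casimir, map_sum]
  refine Finset.sum_congr rfl fun b _ => ?_
  rw [map_mul, nakayamaAt_single_of_ne T hi, nakayamaAt_single_of_ne T hj]

variable {p : ι → ZMod 2} (hp : ∀ b, IsPar 𝒜 (p b) (B b))

include hp

/-- The sign from exchanging the factors `b` and `b^∨` is the one that the Nakayama property
produces. -/
theorem nakayama_casimir {i j : Fin n} (hij : i ≠ j) :
    nakayamaAt T i (casimir T B j i) = casimir T B i j := by
  have h := T.sum_nakayama_leftDual B (singleMulSingle 𝒜 j i) hp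
  simp only [singleMulSingle_apply] at h
  rw [casimir, map_sum, casimir]
  refine Eq.trans (Finset.sum_congr rfl fun b _ => ?_)
    (h.trans (Finset.sum_congr rfl fun b _ => ?_))
  · rw [map_mul, nakayamaAt_single_of_ne T hij, nakayamaAt_single_self]
  · rw [single_mul_single_comm hij (hp b) (T.isPar_leftDual B hp b)]

/-- Enough for the generators `f_m`. Places `j` and `i` use the two dual basis identities; elsewhere
`f_m` passes `b` and `b^∨`, which have equal parity, so the signs cancel. -/
theorem mul_casimir {i j : Fin n} (hij : i ≠ j) (a : SuperPower 𝒜 n) :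
    a * casimir T B i j = casimir T B i j * superPermHom 𝒜 (swap i j) (nakayamaAt T j a) := by
  induction a using single_induction with
  | one => rw [map_one, map_one, one_mul, mul_one]
  | mul a b ha hb => rw [mul_assoc, hb, ← mul_assoc, ha, map_mul, map_mul, mul_assoc]
  | add a b ha hb => rw [add_mul, ha, hb, map_add, map_add, mul_add]
  | smul r a ha => rw [smul_mul_assoc, ha, map_smul, map_smul, mul_smul_comm]
  | single m φ f hf =>
    rw [superPermHom_apply]
    by_cases hmj : m = j
    · subst hmj
      rw [nakayamaAt_single_self, superPerm_single, swap_apply_right, casimir, Finset.mul_sum,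
        Finset.sum_mul]
      have h := T.sum_sgn_mul_right B (singleMulSingle 𝒜 i m) hp hf
      simp only [singleMulSingle_apply] at h
      refine Eq.trans (Finset.sum_congr rfl fun b _ => ?_)
        (h.trans (Finset.sum_congr rfl fun b _ => ?_))
      · rw [← mul_assoc, single_mul_single_comm (Ne.symm hij) hf (hp b), smul_mul_assoc,
          mul_assoc, single_mul_single_self]
      · rw [mul_assoc, single_mul_single_comm (Ne.symm hij) (T.isPar_leftDual B hp b)
          (T.isPar_nakayama hf), mul_smul_comm, ← mul_assoc, single_mul_single_self,
          mul_comm φ]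
    · rw [nakayamaAt_single_of_ne T (Ne.symm hmj), superPerm_single]
      by_cases hmi : m = i
      · subst hmi
        rw [swap_apply_left, casimir, Finset.mul_sum, Finset.sum_mul]
        have h := T.sum_mul_left B (singleMulSingle 𝒜 m j) f
        simp only [singleMulSingle_apply] at h
        refine Eq.trans (Finset.sum_congr rfl fun b _ => ?_)
          (h.trans (Finset.sum_congr rfl fun b _ => ?_))
        · rw [← mul_assoc, single_mul_single_self]
        · rw [mul_assoc, single_mul_single_self]
      · rw [swap_apply_of_ne_of_ne hmi hmj, casimir, Finset.mul_sum, Finset.sum_mul]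
        refine Finset.sum_congr rfl fun b _ => ?_
        rw [← mul_assoc, single_mul_single_comm hmi hf (hp b), smul_mul_assoc, mul_assoc,
          single_mul_single_comm hmj hf (T.isPar_leftDual B hp b), mul_smul_comm, smul_smul,
          sgn_mul_self, one_smul, mul_assoc]

/-- The wreath datum of a Frobenius superalgebra. -/
def frobeniusDatum (n : ℕ) : WreathDatum k (SuperPower 𝒜 n) n where
  act := superPermAction 𝒜 n
  ψ := nakayamaAt T
  t := casimir T B
  ψ_comm i j a := by
    rw [← AlgHom.comp_apply, ← AlgHom.comp_apply]
    refine DFunLike.congr_fun (algHom_ext fun l u => ?_) a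
    simp only [AlgHom.comp_apply]
    by_cases hi : i = l <;> by_cases hj : j = l
    · rw [hi, hj]
    · subst hi
      rw [nakayamaAt_single_of_ne T hj, nakayamaAt_single_self, nakayamaAt_single_of_ne T hj]
    · subst hj
      rw [nakayamaAt_single_of_ne T hi, nakayamaAt_single_self, nakayamaAt_single_of_ne T hi]
    · rw [nakayamaAt_single_of_ne T hj, nakayamaAt_single_of_ne T hi,
        nakayamaAt_single_of_ne T hj]
  act_ψ σ i a := by
    rw [← AlgHom.comp_apply, ← AlgHom.comp_apply]
    refine DFunLike.congr_fun (algHom_ext fun l u => ?_) a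
    simp only [AlgHom.comp_apply, superPermAction_apply, superPerm_single]
    by_cases hi : i = l
    · subst hi
      rw [nakayamaAt_single_self, nakayamaAt_single_self, superPerm_single]
    · rw [nakayamaAt_single_of_ne T hi, nakayamaAt_single_of_ne T (σ.injective.ne hi),
        superPerm_single]
  act_t σ i j := superPerm_casimir T B σ i j
  mul_t i j a hij := mul_casimir T B hp hij a
  ψ_t i j hij := nakayama_casimir T B hp hij
  ψ_t_of_ne l i j hi hj := nakayama_casimir_of_ne T B hi hj

omit hp

/-! ### Elements which commute up to a twist -/

theorem mul_eq_twist_mul {m : ℤ} {f g : F} {η : ZMod 2} (hg : IsPar 𝒜 η g)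
    (hf : f ∈ T.twistedCenter m) : g * f = twist 𝒜 η f * (T.nakayama ^ m) g := by
  have h := hf.2 g
  rw [h]
  simp only [koszul, LinearMap.sum_apply, LinearMap.smul_apply, LinearMap.compl₁₂_apply, twist,
    hg.parityProj_eq, Finset.sum_mul]
  refine Finset.sum_congr rfl fun ε _ => ?_
  rw [Finset.sum_eq_single η]
  · simp
  · intro ζ _ hζ
    simp [Ne.symm hζ]
  · simp

theorem isPar_nakayama_pow (m : ℕ) {η : ZMod 2} {g : F} (hg : IsPar 𝒜 η g) :
    IsPar 𝒜 η ((T.nakayama ^ m) g) := by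
  induction m with
  | zero => simpa using hg
  | succ m ih => rw [pow_succ']; exact T.isPar_nakayama ih

/-- Moving `g` through the whole tensor twists every factor; at place `i` twisted centrality also
turns `g` into a power of `ψ` applied to `g`. -/
theorem single_mul_twistedTensor {α : Fin n → ℤ} {i : Fin n} {η : ZMod 2} {g : F}
    (hg : IsPar 𝒜 η g) (hg' : IsPar 𝒜 η ((T.nakayama ^ α i) g)) {z : SuperPower 𝒜 n}
    (hz : z ∈ twistedTensor T α) :
    single 𝒜 i g * z = mapAll (fun _ => twist 𝒜 η) z * single 𝒜 i ((T.nakayama ^ α i) g) := by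
  induction hz using Submodule.span_induction with
  | zero => simp
  | add y z _ _ hy hz => rw [mul_add, hy, hz, map_add, add_mul]
  | smul r z _ hz => rw [mul_smul_comm, hz, map_smul, smul_mul_assoc]
  | mem z h =>
    obtain ⟨a, ha, rfl⟩ := h
    rw [single_mul_tprod hg, mapAll_tprod, tprod_mul_single hg']
    congr 1
    funext j
    rcases lt_trichotomy i j with h | h | h
    · simp [h, h.ne', h.not_gt, twist_twist]
    · subst h
      simp [mul_eq_twist_mul T hg (ha i)]
    · simp [h, h.ne, h.not_gt]

omit [Module.Free k F] [Module.Finite k F] in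
-- The product of the signs depends only on the total parity, which is even.
theorem mapAll_twist_of_homogeneous {d : ℕ} {z : SuperPower 𝒜 n}
    (hz : z ∈ homogeneous 𝒜 n (d, 0)) (η : ZMod 2) :
    mapAll (fun _ => twist 𝒜 η) z = z := by
  induction hz using Submodule.span_induction with
  | zero => simp
  | add y z _ _ hy hz => rw [map_add, hy, hz]
  | smul r z _ hz => rw [map_smul, hz]
  | mem z h =>
    obtain ⟨q, a, ha, hq, rfl⟩ := h
    rw [mapAll_tprod]
    have h1 : ∀ i, twist 𝒜 η (a i) = sgn k ((q i).2 * η) • a i := fun i =>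
      twist_of_isPar (isPar_of_mem (ha i)) η
    simp only [h1]
    rw [MultilinearMap.map_smul_univ, ← sgn_sum, ← Finset.sum_mul]
    have h2 : ∑ i, (q i).2 = 0 := by
      rw [← Prod.snd_sum, hq]
    rw [h2, zero_mul, sgn_zero, one_smul]

theorem nakayama_twistedTensor {α : Fin n → ℤ} (i : Fin n) {z : SuperPower 𝒜 n}
    (hz : z ∈ twistedTensor T α) : nakayamaAt T i z = z := by
  induction hz using Submodule.span_induction with
  | zero => simp
  | add y z _ _ hy hz => rw [map_add, hy, hz]
  | smul r z _ hz => rw [map_smul, hz]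
  | mem z h =>
    obtain ⟨a, ha, rfl⟩ := h
    rw [nakayamaAt_apply, mapAt_tprod]
    congr 1
    funext j
    split_ifs
    · exact (ha j).1
    · rfl

/-- The parameter `c` moves past coefficients by the same rule as `x_i^m`, hence so does `x_i^m -
c`. -/
theorem mul_of_mem_shiftSpace {i : Fin n} {m d : ℕ} {c : SuperPower 𝒜 n}
    (hc : c ∈ shiftSpace T i (m : ℤ)) (hc' : c ∈ homogeneous 𝒜 n (d, 0)) (a : SuperPower 𝒜 n) :
    a * c = c * (nakayamaAt T i ^ m) a := by
  induction a using single_induction with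
  | one => rw [map_one, one_mul, mul_one]
  | mul a b ha hb => rw [mul_assoc, hb, ← mul_assoc, ha, map_mul, mul_assoc]
  | add a b ha hb => rw [add_mul, ha, hb, map_add, mul_add]
  | smul r a ha => rw [smul_mul_assoc, ha, map_smul, mul_smul_comm]
  | single l η g hg =>
    have key : (nakayamaAt T i ^ m) (single 𝒜 l g) =
          single 𝒜 l ((T.nakayama ^ (Pi.single i (m : ℤ) : Fin n → ℤ) l) g) ∧
        IsPar 𝒜 η ((T.nakayama ^ (Pi.single i (m : ℤ) : Fin n → ℤ) l) g) := by
      clear hc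
      by_cases h : l = i
      · subst h
        rw [Pi.single_eq_same, zpow_natCast]
        refine ⟨?_, isPar_nakayama_pow T m hg⟩
        induction m with
        | zero => simp
        | succ m ih => rw [pow_succ', AlgHom.mul_apply, ih, nakayamaAt_single_self, pow_succ']; rfl
      · rw [Pi.single_eq_of_ne h, zpow_zero]
        refine ⟨?_, hg⟩
        induction m with
        | zero => simp
        | succ m ih =>
          rw [pow_succ', AlgHom.mul_apply, ih]
          exact nakayamaAt_single_of_ne T (Ne.symm h) g
    rw [key.1, single_mul_twistedTensor T hg key.2 hc.1, mapAll_twist_of_homogeneous hc']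

end Datum

end AffineWreath

end

/-! ## The basis theorem -/

noncomputable section

namespace AffineWreath

open Equiv

namespace WreathRep

variable {k S : Type*} [CommRing k] [Ring S] [Algebra k S] {n : ℕ} {D : WreathDatum k S n}
variable {A : Type*} [Ring A] [Algebra k A] {R : WreathRep D A} [NeZero n]

namespace IsCyclotomic

theorem one : R.IsCyclotomic 1 0 where
  x_mul i := by rw [mul_one, one_mul]
  τ_mul a := ⟨a, by rw [mul_one, one_mul]⟩
  p_mul π _ := by rw [mul_one, one_mul]
  lead_mem := by simp

/-- Leading terms multiply, so levels add; this reduces `χ_C` to its single factors. -/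
theorem mul {χ χ' : A} {d d' : ℕ} (h : R.IsCyclotomic χ d) (h' : R.IsCyclotomic χ' d') :
    R.IsCyclotomic (χ * χ') (d + d') where
  x_mul i := (Commute.mul_right (h.x_mul i) (h'.x_mul i) : Commute _ _)
  τ_mul a := by
    obtain ⟨b, hb⟩ := h.τ_mul a
    obtain ⟨c, hc⟩ := h'.τ_mul b
    exact ⟨c, by rw [← mul_assoc, hb, mul_assoc, hc, mul_assoc]⟩
  p_mul π hπ := (Commute.mul_right (h.p_mul π hπ) (h'.p_mul π hπ) : Commute _ _)
  lead_mem := by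
    have h1 : χ' ∈ R.fil (d' + 1) := by
      rw [← sub_add_cancel χ' (R.x 0 ^ d')]
      exact add_mem (R.fil_mono d'.le_succ h'.lead_mem) (R.x_pow_mem_fil 0 d'.lt_succ_self)
    have key : χ * χ' - R.x 0 ^ (d + d') =
        (χ - R.x 0 ^ d) * χ' + R.x 0 ^ d * (χ' - R.x 0 ^ d') := by
      rw [pow_add]
      noncomm_ring
    rw [key]
    exact add_mem (R.mem_fil_mul_mem_fil h.lead_mem h1) (R.x_pow_mul_mem_fil 0 d h'.lead_mem)

theorem prod_ofFn {l : ℕ} (χ : Fin l → A) (d : Fin l → ℕ)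
    (h : ∀ i, R.IsCyclotomic (χ i) (d i)) :
    R.IsCyclotomic (List.ofFn χ).prod (∑ i, d i) := by
  induction l with
  | zero => simpa using one
  | succ l ih =>
    rw [List.ofFn_succ, List.prod_cons, Fin.sum_univ_succ]
    exact (h 0).mul (ih _ _ fun i => h i.succ)

theorem x_pow_sub (H : R.RegularHom) (hR : Function.Bijective R.normal) {m : ℕ} (hm : 0 < m)
    {c : S} (hc : ∀ a, a * c = c * (D.ψ 0 ^ m) a) (hψ : ∀ i, D.ψ i c = c)
    (hact : ∀ π : Perm (Fin n), π 0 = 0 → D.act π c = c) :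
    R.IsCyclotomic (R.x 0 ^ m - R.τ c) m where
  x_mul i := by
    have h1 : R.x i * R.x 0 ^ m = R.x 0 ^ m * R.x i := Commute.pow_right (R.x_comm i 0) m
    rw [mul_sub, sub_mul, h1, R.τ_x, hψ]
  τ_mul a := by
    refine ⟨(D.ψ 0 ^ m) a, ?_⟩
    have h1 : ∀ a, R.τ a * R.x 0 ^ m = R.x 0 ^ m * R.τ ((D.ψ 0 ^ m) a) := by
      clear hm hc
      induction m with
      | zero => simp
      | succ m ih =>
        intro a
        rw [pow_succ', ← mul_assoc, R.τ_x, mul_assoc, ih, ← mul_assoc, pow_succ, AlgHom.mul_apply]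
    rw [mul_sub, sub_mul, h1, ← map_mul, hc, map_mul]
  p_mul π hπ := by
    have h1 : R.p π * R.x 0 ^ m = R.x 0 ^ m * R.p π :=
      Commute.pow_right (H.p_mul_x_zero hR hπ) m
    rw [mul_sub, sub_mul, h1, R.p_τ, hact π hπ]
  lead_mem := by
    -- The parameter has degree zero in the variables, which is below `m` because `m` is positive.
    rw [sub_sub_cancel_left]
    exact neg_mem (R.τ_mem_fil hm c)

end IsCyclotomic

end WreathRep

section Affine

open SuperPower FrobeniusStructure AffineWreathAlgebra

variable {k : Type*} [CommRing k] {F : Type*} [Ring F] [Algebra k F]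
variable {𝒜 : ℕ × ZMod 2 → Submodule k F} [GradedAlgebra 𝒜] (T : FrobeniusStructure 𝒜)
variable [Module.Free k F] [Module.Finite k F] {ι : Type*} [Fintype ι] (B : Module.Basis ι k F)
variable {p : ι → ZMod 2} (hp : ∀ b, IsPar 𝒜 (p b) (B b)) (n : ℕ)

/-- The affine wreath product algebra as a representation of the wreath datum. -/
def affineRep : WreathRep (frobeniusDatum T B hp n) (AffineWreathAlgebra T B n) where
  x := x T B
  τ := AlgHom.ofLinearMap
    { toFun := tensor T B
      map_add' := fun a b => by
        rw [tensor, RingQuot.mkAlgHom_rel k (Rel.tensor_add a b), map_add]; rfl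
      map_smul' := fun r a => by
        rw [tensor, RingQuot.mkAlgHom_rel k (Rel.tensor_smul r a), map_smul]; rfl }
    ((RingQuot.mkAlgHom_rel k Rel.tensor_one).trans (map_one _))
    (fun a b => (RingQuot.mkAlgHom_rel k (Rel.tensor_mul a b)).trans (map_mul _ _ _))
  p :=
    { toFun := perm T B
      map_one' := (RingQuot.mkAlgHom_rel k Rel.perm_one).trans (map_one _)
      map_mul' := fun π σ => (RingQuot.mkAlgHom_rel k (Rel.perm_mul π σ)).trans (map_mul _ _ _) }
  x_comm i j := (map_mul _ _ _).symm.trans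
    ((RingQuot.mkAlgHom_rel k (Rel.x_comm i j)).trans (map_mul _ _ _))
  τ_x a i := (map_mul _ _ _).symm.trans
    ((RingQuot.mkAlgHom_rel k (Rel.tensor_x a i)).trans (map_mul _ _ _))
  p_x_of_ne i i' j hi h h' := (map_mul _ _ _).symm.trans
    ((RingQuot.mkAlgHom_rel k (Rel.simple_x_of_ne i i' j hi h h')).trans (map_mul _ _ _))
  p_x i i' hi := (map_mul _ _ _).symm.trans
    ((RingQuot.mkAlgHom_rel k (Rel.simple_x i i' hi)).trans
      ((map_sub _ _ _).trans (congrArg₂ _ (map_mul _ _ _) rfl)))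
  p_τ π a := (map_mul _ _ _).symm.trans
    ((RingQuot.mkAlgHom_rel k (Rel.perm_tensor π a)).trans (map_mul _ _ _))

theorem adjoin_affineRep :
    Algebra.adjoin k (Set.range (affineRep T B hp n).x ∪ Set.range (affineRep T B hp n).τ ∪
      Set.range (affineRep T B hp n).p) = ⊤ := by
  rw [eq_top_iff]
  rintro y -
  obtain ⟨z, rfl⟩ := RingQuot.mkAlgHom_surjective k (Rel T B n) y
  induction z using FreeAlgebra.induction with
  | grade0 r => rw [AlgHom.commutes]; exact Subalgebra.algebraMap_mem _ r
  | grade1 g =>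
    refine Algebra.subset_adjoin ?_
    cases g with
    | x i => exact Or.inl (Or.inl ⟨i, rfl⟩)
    | tensor a => exact Or.inl (Or.inr ⟨a, rfl⟩)
    | perm π => exact Or.inr ⟨π, rfl⟩
  | mul a b ha hb => rw [map_mul]; exact mul_mem ha hb
  | add a b ha hb => rw [map_add]; exact add_mem ha hb

variable {T B n} in
/-- The homomorphism from the affine wreath product algebra given by a representation of the
wreath datum. -/
def liftRep {A : Type*} [Ring A] [Algebra k A] (R : WreathRep (frobeniusDatum T B hp n) A) :
    AffineWreathAlgebra T B n →ₐ[k] A :=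
  RingQuot.liftAlgHom k ⟨FreeAlgebra.lift k fun g => match g with
    | Gen.x i => R.x i
    | Gen.tensor a => R.τ a
    | Gen.perm π => R.p π, by
    intro y z h
    cases h with
    | x_comm i j => simpa using R.x_comm i j
    | tensor_one => simp
    | tensor_add a b => simp
    | tensor_smul r a => simp
    | tensor_mul a b => simp
    | perm_one => simp
    | perm_mul π σ => simp
    | tensor_x a i =>
      simp only [map_mul, FreeAlgebra.lift_ι_apply]
      exact R.τ_x a i
    | simple_x_of_ne i i' j hi h h' => simpa using R.p_x_of_ne i i' j hi h h'
    | simple_x i i' hi =>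
      simp only [map_mul, map_sub, FreeAlgebra.lift_ι_apply]
      exact R.p_x i i' hi
    | perm_tensor π a =>
      simp only [map_mul, FreeAlgebra.lift_ι_apply]
      exact R.p_τ π a⟩

/-- The action of the affine wreath product algebra in the right regular representation. -/
def affineRegularHom : (affineRep T B hp n).RegularHom where
  φ := liftRep hp (frobeniusDatum T B hp n).regularRep
  φ_x _ := (RingQuot.liftAlgHom_mkAlgHom_apply _ _ _ _).trans (FreeAlgebra.lift_ι_apply _ _)
  φ_τ _ := (RingQuot.liftAlgHom_mkAlgHom_apply _ _ _ _).trans (FreeAlgebra.lift_ι_apply _ _)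
  φ_p _ := (RingQuot.liftAlgHom_mkAlgHom_apply _ _ _ _).trans (FreeAlgebra.lift_ι_apply _ _)

variable {T n} in
theorem isCyclotomic_chi [NeZero n] (C : CyclotomicParameter T n) :
    (affineRep T B hp n).IsCyclotomic (C.chi B) C.level := by
  refine WreathRep.IsCyclotomic.prod_ofFn _ _ fun m => ?_
  -- The index `m` stands for the exponent `m + 1`, which is the level of each of the `e_m` factors.
  have h : ((m : ℕ) + 1) * C.e m = ∑ _j : Fin (C.e m), ((m : ℕ) + 1) := by simp [mul_comm]
  rw [h]
  refine WreathRep.IsCyclotomic.prod_ofFn _ _ fun j => ?_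
  have hc : C.c m j ∈ shiftSpace T (0 : Fin n) (((m : ℕ) + 1 : ℕ) : ℤ) := by
    exact_mod_cast C.c_mem m j
  exact WreathRep.IsCyclotomic.x_pow_sub (affineRegularHom T B hp n)
    ((affineRegularHom T B hp n).normal_bijective (adjoin_affineRep T B hp n)) (Nat.succ_pos _)
    (fun a => mul_of_mem_shiftSpace T hc (C.c_homogeneous m j) a)
    (fun i => nakayama_twistedTensor T i hc.1) hc.2

theorem proj_eq_zero_iff {n : ℕ} [NeZero n] (C : CyclotomicParameter T n)
    (z : AffineWreathAlgebra T B n) : C.proj B z = 0 ↔ z ∈ TwoSidedIdeal.span {C.chi B} :=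
  (RingCon.eq _).trans (TwoSidedIdeal.mem_iff _ _).symm

end Affine

end AffineWreath

end

theorem mainTheorem2 {k : Type*} [CommRing k] (hk : ringChar k ≠ 2)
    {F : Type*} [Ring F] [Algebra k F] [Module.Free k F] [Module.Finite k F]
    (𝒜 : ℕ × ZMod 2 → Submodule k F) [GradedAlgebra 𝒜]
    (T : AffineWreath.FrobeniusStructure 𝒜)
    {ι : Type*} [Fintype ι] (B : Module.Basis ι k F)
    (hB : ∀ b, ∃ p, B b ∈ 𝒜 p)
    (hθ : 0 < T.θ) (hkθ : ¬ ringChar k ∣ T.θ)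
    (hψ : ∃ E : Module.Basis ι k F, ∀ b, ∃ r : k, T.nakayama (E b) = r • E b)
    (n : ℕ) [NeZero n] (C : AffineWreath.CyclotomicParameter T n) :
    ∃ 𝓑 : Module.Basis ((Fin n → Fin C.level) × (Fin n → ι) × Equiv.Perm (Fin n)) k
        (C.Quotient B),
      ∀ (α : Fin n → Fin C.level) (β : Fin n → ι) (π : Equiv.Perm (Fin n)),
        𝓑 (α, β, π) = C.proj B
          (AffineWreath.AffineWreathAlgebra.monomial T B (fun i => (α i : ℕ)) *
            AffineWreath.AffineWreathAlgebra.tensor T B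
              (AffineWreath.SuperPower.tprod 𝒜 fun i => B (β i)) *
            AffineWreath.AffineWreathAlgebra.perm T B π) := by
  have hp : ∀ b, AffineWreath.IsPar 𝒜 (hB b).choose.2 (B b) := fun b =>
    AffineWreath.isPar_of_mem (hB b).choose_spec
  let b : Module.Basis (Fin n → ι) k (AffineWreath.SuperPower 𝒜 n) :=
    Basis.piTensorProduct fun _ => B
  have hb : ∀ β, b β = AffineWreath.SuperPower.tprod 𝒜 fun i => B (β i) := fun β =>
    Basis.piTensorProduct_apply _ _
  obtain ⟨𝓑, h𝓑⟩ := (AffineWreath.isCyclotomic_chi B hp C).exists_basis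
    ((AffineWreath.affineRegularHom T B hp n).normal_bijective
      (AffineWreath.adjoin_affineRep T B hp n)) b (C.proj B).toLinearMap
    (RingCon.mk'_surjective _) (AffineWreath.proj_eq_zero_iff T B C)
  refine ⟨𝓑, fun α β π => (h𝓑 α β π).trans ?_⟩
  rw [hb]
  rfl
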